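/- **Model.** A parallel machine consists of $P$ fully connected processors, each with unbounded local memory. A processor performs one task at a time: an operation on words (complex numbers) that it holds (field operations, conjugation, real square roots, zero tests), or the sending or receiving of a point-to-point message. The tasks of an execution form a DAG: the tasks of each processor are ordered in time, and each send precedes the matching receive. An algorithm costs at most $F$ operations, $N$ words and $S$ messages if every path of this DAG includes at most $F$ operations and at most $S$ sent or received messages, containing at most $N$ words in total. **Algorithm.** Let $m/n\ge P\ge 1$, and let the rows of an $m\times n$ complex matrix $A$ be distributed over the $P$ processors so that the numbers of rows owned by any two of them differ by at most one, and so that one of them, the root, owns the $n$ leading rows. 1D-CAQR-EG with block size $b\ge 1$ uses TSQR if $n\le b$: each processor QR-decomposes its rows locally by Householder's algorithm, the R-factors are combined along a binomial tree by QR decompositions of stacked pairs, the resulting Q-factors are applied down the tree to identity columns, and the Householder representation of the Q-factor is reconstructed by a sign-modified LU factorization on the root. If $n>b$, it splits $A=[A_1\;A_2]$ with $A_1$ having $\lfloor n/2\rfloor$ columns, recursively computes $A_1=(I-V_LT_LV_L^H)\begin{bmatrix}R_L\\0\end{bmatrix}$, forms $\begin{bmatrix}B_{12}\\B_{22}\end{bmatrix}=A_2-V_L\,(T_L^H(V_L^HA_2))$,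 where $B_{12}$ has $\lfloor n/2\rfloor$ rows, recursively computes $B_{22}=(I-V_RT_RV_R^H)\begin{bmatrix}R_R\\0\end{bmatrix}$, and assembles $$V=\begin{bmatrix}V_L&\begin{bmatrix}0\\V_R\end{bmatrix}\end{bmatrix},\quad T=\begin{bmatrix}T_L&-T_L\left(\left(V_L^H\begin{bmatrix}0\\V_R\end{bmatrix}\right)T_R\right)\\0&T_R\end{bmatrix},\quad R=\begin{bmatrix}R_L&B_{12}\\0&R_R\end{bmatrix}.$$ Products $V_L^HX$ are computed by local multiplications and a Reduce to the root, products $V_LM$ by a Broadcast from the root and local multiplications (both collectives by bidirectional exchange, i.e. Reduce-Scatter + Gather and Scatter + All-Gather), and products of small matrices locally on the root. **Theorem 2.** Suppose that $m/n\ge P\ge 1$, $n\ge 1$ and $P(\log P)^2=O(n^2)$. Then there are block sizes $b=\Theta(n/\log P)$ (any $b\ge 1$ if $P=1$), and for every such $b$ the algorithm 1D-CAQR-EG on $P$ processors computes, without fault for every $m\times n$ complex matrix $A$, a QR decomposition of $A$ in Householder representation: $V\in\mathbb C^{m\times n}$ unit lower trapezoidal, $T,R\in\mathbb C^{n\times n}$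 upper triangular, $Q=I-VTV^H$ unitary and $A=Q\begin{bmatrix}R\\0\end{bmatrix}$. Its costs are $$O(mn^2/P)\text{ operations},\qquad O(n^2)\text{ words},\qquad O((\log P)^2)\text{ messages},$$ where the implied constants depend only on the constants in $P(\log P)^2=O(n^2)$ and $b=\Theta(n/\log P)$. -/

import Mathlib

/-! Parallel programs on `P` fully connected processors with unbounded local memories.
`W p` is the type of the words held by processor `p`: since programs are written for an arbitrary
family `W`, an operation of processor `p` can only use words that `p` holds, and a word changes its
processor only through a message. -/

namespace CAQR

/-- A two-dimensional array in a local memory (with unbounded address space). -/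
abbrev Arr (X : Type) : Type := ℕ → ℕ → X

/-- The array `y` after its addresses in the list `S` have been overwritten with those of `x`. -/
def overwrite {X : Type} (S : List (ℕ × ℕ)) (x y : Arr X) : Arr X :=
  fun i j => if (i, j) ∈ S then x i j else y i j

/-- The operations: constants, field operations, conjugation, real square root, and the selection
`ifz c x y` of `x` or `y` according to whether `c = 0` (needed for signs and trivial reflectors). -/
inductive Oper (X : Type) : Type
  | zero : Oper X
  | one : Oper X
  | add (x y : X) : Oper X
  | sub (x y : X) : Oper X
  | mul (x y : X) : Oper X
  | div (x y : X) : Oper X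
  | conj (x : X) : Oper X
  | sqrt (x : X) : Oper X
  | ifz (c x y : X) : Oper X

open Classical in
/-- The value of an operation. Division by zero and the square root of anything
but a nonnegative real are faults. -/
noncomputable def Oper.eval : Oper ℂ → Option ℂ
  | .zero => some 0
  | .one => some 1
  | .add x y => some (x + y)
  | .sub x y => some (x - y)
  | .mul x y => some (x * y)
  | .div x y => if y = 0 then none else some (x / y)
  | .conj x => some (star x)
  | .sqrt x => if 0 ≤ x.re ∧ x.im = 0 then some ((Real.sqrt x.re : ℝ) : ℂ) else none
  | .ifz c x y => if c = 0 then some x else some y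

/-- Parallel programs, with their tasks listed in an order compatible with all dependencies:
`op p o k` lets processor `p` perform the operation `o`; `msg p q S x y k` lets processor `p` send
to processor `q` the words of its array `x` at the addresses in `S`, as one message,
which `q` receives into its array `y`. -/
inductive Par (P : ℕ) (W : Fin P → Type) (α : Type) : Type
  | ret (a : α) : Par P W α
  | op (p : Fin P) (o : Oper (W p)) (k : W p → Par P W α) : Par P W α
  | msg (p q : Fin P) (S : List (ℕ × ℕ)) (x : Arr (W p)) (y : Arr (W q))
      (k : Arr (W q) → Par P W α) : Par P W α

/-- Sequential composition of programs. Tasks of different processors are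
ordered by it only as far as messages order them, see `Edge`. -/
def Par.bind {P : ℕ} {W : Fin P → Type} {α β : Type} :
    Par P W α → (α → Par P W β) → Par P W β
  | .ret a, f => f a
  | .op p o k, f => .op p o (fun w => (k w).bind f)
  | .msg p q S x y k, f => .msg p q S x y (fun w => (k w).bind f)

instance {P : ℕ} {W : Fin P → Type} : Monad (Par P W) where
  pure a := Par.ret a
  bind := Par.bind

/-! ### Executions and their costs -/

/-- The tasks of an execution: processor `p` performs an operation; `p` sends a message of `w` words
to `q`; `q` receives a message of `w` words from `p`. -/
inductive Task (P : ℕ) : Type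
  | op (p : Fin P) : Task P
  | send (p q : Fin P) (w : ℕ) : Task P
  | recv (p q : Fin P) (w : ℕ) : Task P

/-- The processor that performs a task. -/
def Task.proc {P : ℕ} : Task P → Fin P
  | .op p => p
  | .send p _ _ => p
  | .recv _ q _ => q

/-- Number of operations of a task. -/
def Task.ops {P : ℕ} : Task P → ℕ
  | .op _ => 1
  | .send _ _ _ => 0
  | .recv _ _ _ => 0

/-- Number of words sent or received by a task. -/
def Task.words {P : ℕ} : Task P → ℕ
  | .op _ => 0
  | .send _ _ w => w
  | .recv _ _ w => w

/-- Number of messages sent or received by a task. -/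
def Task.messages {P : ℕ} : Task P → ℕ
  | .op _ => 0
  | .send _ _ _ => 1
  | .recv _ _ _ => 1

/-- The execution of a program: its result and the list of its tasks, or `none` after a fault.
Each `send` task is immediately followed in the list by the matching `recv` task. -/
noncomputable def Par.run {P : ℕ} {α : Type} :
    Par P (fun _ => ℂ) α → Option (α × List (Task P))
  | .ret a => some (a, [])
  | .op p o k =>
      match o.eval with
      | none => none
      | some z => (k z).run.map (fun r => (r.1, Task.op p :: r.2))
  | .msg p q S x y k =>
      (k (overwrite S x y)).run.map
        (fun r => (r.1, Task.send p q S.length :: Task.recv p q S.length :: r.2))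

/-- The dependence DAG of an execution, on the positions in its list of tasks:
the tasks of one processor are ordered by time, and each message is received after it is sent. -/
def Edge {P : ℕ} (t : List (Task P)) (i j : ℕ) : Prop :=
  (∃ a b : Task P, t[i]? = some a ∧ t[j]? = some b ∧ i < j ∧ a.proc = b.proc) ∨
  (∃ (p q : Fin P) (w : ℕ),
    t[i]? = some (Task.send p q w) ∧ t[j]? = some (Task.recv p q w) ∧ j = i + 1)

/-- `l` is the list of the tasks along a path of the dependence DAG. -/
def IsPath {P : ℕ} (t l : List (Task P)) : Prop :=
  ∃ s : List ℕ, List.IsChain (Edge t) s ∧ s.map (fun i => t[i]?) = l.map some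

/-- Every path includes at most `F` operations and at most `S` messages,
containing at most `N` words in total. -/
def CostsAtMost {P : ℕ} (t : List (Task P)) (F N S : ℝ) : Prop :=
  ∀ l : List (Task P), IsPath t l →
    (((l.map Task.ops).sum : ℕ) : ℝ) ≤ F ∧
    (((l.map Task.words).sum : ℕ) : ℝ) ≤ N ∧
    (((l.map Task.messages).sum : ℕ) : ℝ) ≤ S

/-! ### Elementary programs -/

section Programs

variable {P : ℕ} {W : Fin P → Type}

def zero (p : Fin P) : Par P W (W p) := .op p .zero .ret
def one (p : Fin P) : Par P W (W p) := .op p .one .ret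
def add (p : Fin P) (x y : W p) : Par P W (W p) := .op p (.add x y) .ret
def sub (p : Fin P) (x y : W p) : Par P W (W p) := .op p (.sub x y) .ret
def mul (p : Fin P) (x y : W p) : Par P W (W p) := .op p (.mul x y) .ret
def div (p : Fin P) (x y : W p) : Par P W (W p) := .op p (.div x y) .ret
def conj (p : Fin P) (x : W p) : Par P W (W p) := .op p (.conj x) .ret
def sqrt (p : Fin P) (x : W p) : Par P W (W p) := .op p (.sqrt x) .ret
def ifz (p : Fin P) (c x y : W p) : Par P W (W p) := .op p (.ifz c x y) .ret

/-- Send the words of `x` at the addresses `S` from `p` to `q`, into the array `y`. -/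
def msg (p q : Fin P) (S : List (ℕ × ℕ)) (x : Arr (W p)) (y : Arr (W q)) : Par P W (Arr (W q)) :=
  .msg p q S x y .ret

/-- An array of zeros (one stored zero). -/
def blank (p : Fin P) : Par P W (Arr (W p)) := do
  let z ← zero p
  return fun _ _ => z

/-- Compute `f i j` for the addresses `(i, j)` in `S`, in that order, and overwrite `y` there. -/
def fill (p : Fin P) (S : List (ℕ × ℕ)) (f : ℕ → ℕ → Par P W (W p)) (y : Arr (W p)) :
    Par P W (Arr (W p)) :=
  S.foldlM (fun z a => do
    let w ← f a.1 a.2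
    return fun i j => if i = a.1 ∧ j = a.2 then w else z i j) y

/-- The addresses with row in `[r, r')` and column in `[c, c')`. -/
def rect (r r' c c' : ℕ) : List (ℕ × ℕ) := (List.Ico r r').product (List.Ico c c')

/-- The addresses in the upper triangle of an `n × n` array. -/
def tri (n : ℕ) : List (ℕ × ℕ) := (rect 0 n 0 n).filter (fun a => decide (a.1 ≤ a.2))

/-- The sum of `f k * g k` over the list `ks`. -/
def dot (p : Fin P) (ks : List ℕ) (f g : ℕ → W p) : Par P W (W p) := do
  let z ← zero p
  ks.foldlM (fun s k => do
    let t ← mul p (f k) (g k)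
    add p s t) z

/-- Local matrix multiplication: the entries of `X * Y` at the addresses `S`,
with summation index in `ks`. -/
def mm (p : Fin P) (S : List (ℕ × ℕ)) (ks : List ℕ) (X Y : Arr (W p)) : Par P W (Arr (W p)) := do
  let Z ← blank p
  fill p S (fun i j => dot p ks (fun k => X i k) (fun k => Y k j)) Z

/-- The conjugate transpose of the part of `X` with row in `[r, r')` and column in `[0, c)`. -/
def adj (p : Fin P) (r r' c : ℕ) (X : Arr (W p)) : Par P W (Arr (W p)) := do
  let Z ← blank p
  fill p (rect 0 c r r') (fun i j => conj p (X j i)) Z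

/-- `z / |z|`, or `1` if `z = 0`. -/
def sgn (p : Fin P) (z : W p) : Par P W (W p) := do
  let u ← one p
  let c ← conj p z
  let s ← mul p z c
  let r ← sqrt p s
  let num ← ifz p z u z
  let den ← ifz p r u r
  div p num den

/-- Run one program for each of `k` indices. -/
def each : (k : ℕ) → {β : Fin k → Type} → ((i : Fin k) → Par P W (β i)) →
    Par P W ((i : Fin k) → β i)
  | 0, _, _ => return fun i => Fin.elim0 i
  | k + 1, _, f => do
      let a ← f 0
      let r ← each k (fun i => f i.succ)
      return Fin.cons a r

/-! ### Local QR decomposition -/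

/-- Basis `V`, kernel `T` and R-factor `R`, all held by one processor. -/
structure LocalQR (X : Type) where
  V : Arr X
  T : Arr X
  R : Arr X

/-- Householder reflector `1 - τ v vᴴ` that maps the column `a` (rows `o, …, μ - 1`) to a multiple
`β` of the unit vector at row `o`; here `v` is `1` at row `o` and `0` above. -/
def house (p : Fin P) (μ o : ℕ) (a : ℕ → W p) : Par P W ((ℕ → W p) × W p × W p) := do
  let z ← zero p
  let u ← one p
  let C ← adj p o μ 1 (fun i _ => a i)
  let nn ← dot p (List.Ico o μ) (fun i => C 0 i) a
  let nrm ← sqrt p nn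
  let s ← sgn p (a o)
  let sn ← mul p s nrm
  let d ← add p (a o) sn
  let den ← ifz p d u d
  let Q ← fill p (rect (o + 1) μ 0 1) (fun i _ => div p (a i) den)
    (fun i _ => if i = o then u else z)
  let D ← adj p o μ 1 Q
  let vv ← dot p (List.Ico o μ) (fun i => D 0 i) (fun i => Q i 0)
  let two ← add p u u
  let τ ← div p two vv
  let β ← sub p z sn
  return (fun i => Q i 0, τ, β)

/-- Householder QR decomposition, on processor `p`, of the part of `A` with rows `o, …, μ - 1`
and `ν` columns, column by column; the rows of the basis above row `o` are zero. -/
def localQR (p : Fin P) (μ : ℕ) : (ν o : ℕ) → Arr (W p) → Par P W (LocalQR (W p))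
  | 0, _, _ => do
      let Z ← blank p
      return ⟨Z, Z, Z⟩
  | ν + 1, o, A => do
      let Z ← blank p
      let (v, τ, β) ← house p μ o (fun i => A i 0)
      let vH ← adj p o μ 1 (fun i _ => v i)
      let A2 : Arr (W p) := fun i j => A i (j + 1)
      let w ← mm p (rect 0 1 0 ν) (List.Ico o μ) vH A2
      let w' ← fill p (rect 0 1 0 ν) (fun i j => mul p τ (w i j)) Z
      let B ← fill p (rect o μ 0 ν) (fun i j => do
        let t ← mul p (v i) (w' 0 j)
        sub p (A2 i j) t) A2
      let F ← localQR p μ ν (o + 1) B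
      let y ← mm p (rect 0 1 0 ν) (List.Ico (o + 1) μ) vH F.V
      let y' ← mm p (rect 0 1 0 ν) (List.Ico 0 ν) y F.T
      let t ← fill p (rect 0 1 0 ν) (fun i j => do
        let x ← mul p τ (y' i j)
        sub p (Z 0 0) x) Z
      return ⟨fun i j => if j = 0 then v i else F.V i (j - 1),
        fun i j =>
          if i = 0 then (if j = 0 then τ else t 0 (j - 1))
          else if j = 0 then Z 0 0 else F.T (i - 1) (j - 1),
        fun i j =>
          if i = 0 then (if j = 0 then β else B o (j - 1))
          else if j = 0 then Z 0 0 else F.R (i - 1) (j - 1)⟩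

/-- `(1 - V T Vᴴ) [B; 0]`, where `V` has rows `o, …, μ - 1` and `n` columns, and `B` is `n × n`
(rows `0, …, n - 1`). -/
def applyQ (p : Fin P) (μ n o : ℕ) (V T B : Arr (W p)) : Par P W (Arr (W p)) := do
  let Z ← blank p
  let C : Arr (W p) := fun i j => if o ≤ i ∧ i < o + n then B (i - o) j else Z i j
  let VH ← adj p o μ n V
  let X ← mm p (rect 0 n 0 n) (List.Ico o μ) VH C
  let Y ← mm p (rect 0 n 0 n) (List.Ico 0 n) T X
  let U ← mm p (rect o μ 0 n) (List.Ico 0 n) V Y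
  fill p (rect o μ 0 n) (fun i j => sub p (C i j) (U i j)) Z

/-- Solve `X * U = Y` for the rows `r, …, r' - 1` of `X`, where `U` is `n × n` upper triangular. -/
def rightSolve (p : Fin P) (r r' n : ℕ) (Y U : Arr (W p)) : Par P W (Arr (W p)) := do
  let Z ← blank p
  (List.range n).foldlM (fun X c =>
    fill p (rect r r' c (c + 1)) (fun i j => do
      let s ← dot p (List.range j) (fun k => X i k) (fun k => U k j)
      let d ← sub p (Y i j) s
      div p d (U j j)) X) Z

/-- Row reduction of the `n × n` array `X` that adds the sign `S j` of the `j`-th pivot to that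
pivot before it is used: `X + diag S = L * U`, with `L` unit lower triangular (stored strictly
below the diagonal of the result) and `U` upper triangular (stored on and above the diagonal). -/
def signLU (p : Fin P) (n : ℕ) (X : Arr (W p)) : Par P W (Arr (W p) × (ℕ → W p)) := do
  let z ← zero p
  (List.range n).foldlM (fun (st : Arr (W p) × (ℕ → W p)) j => do
    let (Y, S) := st
    let s ← sgn p (Y j j)
    let d ← add p (Y j j) s
    let Y1 ← fill p (rect (j + 1) n j (j + 1)) (fun i c => div p (Y i c) d) Y
    let Y2 ← fill p (rect (j + 1) n (j + 1) n) (fun i c => do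
      let t ← mul p (Y1 i j) (Y1 j c)
      sub p (Y1 i c) t) Y1
    return (fun i c => if i = j ∧ c = j then d else Y2 i c, Function.update S j s)) (X, fun _ => z)

/-! ### Collectives -/

/-- A distributed array: one local array for each processor. -/
abbrev Dist {P : ℕ} (W : Fin P → Type) : Type := (p : Fin P) → Arr (W p)

/-- Processor `p` sends the addresses `S` of its array to `q`, which overwrites its own. -/
def copyFrom (p q : Fin P) (S : List (ℕ × ℕ)) (X : Dist W) : Par P W (Dist W) := do
  let y ← msg p q S (X p) (X q)
  return Function.update X q y

/-- Processor `p` sends the addresses `S` of its array to `q`, which adds them to its own. -/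
def addFrom (p q : Fin P) (S : List (ℕ × ℕ)) (X : Dist W) : Par P W (Dist W) := do
  let t ← msg p q S (X p) (X q)
  let y ← fill q S (fun i j => add q (X q i j) (t i j)) (X q)
  return Function.update X q y

/-- The addresses of an `I × J` array that are assigned to the processors `lo, …, hi - 1`
when its entries are dealt out to all `P` processors in turn. -/
def share (P I J lo hi : ℕ) : List (ℕ × ℕ) :=
  (rect 0 I 0 J).filter
    (fun a => decide (lo ≤ (a.1 * J + a.2) % P ∧ (a.1 * J + a.2) % P < hi))

variable [NeZero P]

/-- The processor with number `i`. -/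
def proc (i : ℕ) : Fin P := Fin.ofNat P i

/-- Bidirectional-exchange Reduce-Scatter of `I × J` arrays
among the `k` processors from number `lo`. -/
def reduceScatter (I J k lo : ℕ) (X : Dist W) : Par P W (Dist W) :=
  if _h : k ≤ 1 then pure X
  else do
    let h1 := (k + 1) / 2
    let h2 := k / 2
    let X ← (List.range h2).foldlM (fun (X : Dist W) i => do
      let X ← addFrom (proc (lo + i)) (proc (lo + h1 + i)) (share P I J (lo + h1) (lo + k)) X
      addFrom (proc (lo + h1 + i)) (proc (lo + i)) (share P I J lo (lo + h1)) X) X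
    let X ← if h1 = h2 then pure X
      else addFrom (proc (lo + h2)) (proc (lo + k - 1)) (share P I J (lo + h1) (lo + k)) X
    let X ← reduceScatter I J h1 lo X
    reduceScatter I J h2 (lo + h1) X
termination_by k
decreasing_by all_goals omega

/-- Binomial-tree Gather to the processor `lo`. -/
def gather (I J k lo : ℕ) (X : Dist W) : Par P W (Dist W) :=
  if _h : k ≤ 1 then pure X
  else do
    let h1 := (k + 1) / 2
    let h2 := k / 2
    let X ← gather I J h1 lo X
    let X ← gather I J h2 (lo + h1) X
    copyFrom (proc (lo + h1)) (proc lo) (share P I J (lo + h1) (lo + k)) X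
termination_by k
decreasing_by all_goals omega

/-- Binomial-tree Scatter from the processor `lo`. -/
def scatter (I J k lo : ℕ) (X : Dist W) : Par P W (Dist W) :=
  if _h : k ≤ 1 then pure X
  else do
    let h1 := (k + 1) / 2
    let h2 := k / 2
    let X ← copyFrom (proc lo) (proc (lo + h1)) (share P I J (lo + h1) (lo + k)) X
    let X ← scatter I J h1 lo X
    scatter I J h2 (lo + h1) X
termination_by k
decreasing_by all_goals omega

/-- Bidirectional-exchange All-Gather. -/
def allGather (I J k lo : ℕ) (X : Dist W) : Par P W (Dist W) :=
  if _h : k ≤ 1 then pure X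
  else do
    let h1 := (k + 1) / 2
    let h2 := k / 2
    let X ← allGather I J h1 lo X
    let X ← allGather I J h2 (lo + h1) X
    let X ← (List.range h2).foldlM (fun (X : Dist W) i => do
      let X ← copyFrom (proc (lo + i)) (proc (lo + h1 + i)) (share P I J lo (lo + h1)) X
      copyFrom (proc (lo + h1 + i)) (proc (lo + i)) (share P I J (lo + h1) (lo + k)) X) X
    if h1 = h2 then pure X
    else copyFrom (proc (lo + k - 1)) (proc (lo + h2)) (share P I J (lo + h1) (lo + k)) X
termination_by k
decreasing_by all_goals omega

/-- Bidirectional-exchange Reduce to the root: Reduce-Scatter, then Gather. -/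
def reduce (I J : ℕ) (X : Dist W) : Par P W (Dist W) := do
  let X ← reduceScatter I J P 0 X
  gather I J P 0 X

/-- Bidirectional-exchange Broadcast from the root: Scatter, then All-Gather. -/
def broadcast (I J : ℕ) (X : Dist W) : Par P W (Dist W) := do
  let X ← scatter I J P 0 X
  allGather I J P 0 X

/-- Binomial-tree Broadcast of the addresses `S` from the processor `lo`. -/
def treeBroadcast (S : List (ℕ × ℕ)) (k lo : ℕ) (X : Dist W) : Par P W (Dist W) :=
  if _h : k ≤ 1 then pure X
  else do
    let h1 := (k + 1) / 2
    let h2 := k / 2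
    let X ← copyFrom (proc lo) (proc (lo + h1)) S X
    let X ← treeBroadcast S h1 lo X
    treeBroadcast S h2 (lo + h1) X
termination_by k
decreasing_by all_goals omega

/-! ### One-dimensional matrix multiplication

Processor `p` owns `m p` rows of each tall matrix. Only the root (processor `0`) ever finishes rows:
its rows before `o` are inactive. -/

/-- The first active row of processor `p`. -/
def top (o : ℕ) (p : Fin P) : ℕ := if p = 0 then o else 0

/-- `Xᴴ * Y` on the root, for row-distributed `X` (`I` columns) and `Y` (`J` columns). -/
def mulAdj (m : Fin P → ℕ) (o I J : ℕ) (X Y : Dist W) : Par P W (Arr (W 0)) := do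
  let C ← each P (β := fun p => Arr (W p)) (fun p => do
    let XH ← adj p (top o p) (m p) I (X p)
    mm p (rect 0 I 0 J) (List.Ico (top o p) (m p)) XH (Y p))
  let C ← reduce I J C
  return C 0

/-- `X * M`, for row-distributed `X` (`K` columns) and a `K × J` matrix `M` on the root. -/
def mulRoot (m : Fin P → ℕ) (o K J : ℕ) (X : Dist W) (M : Arr (W 0)) : Par P W (Dist W) := do
  let Z ← each P (β := fun p => Arr (W p)) (fun p => blank p)
  let M' ← broadcast K J (Function.update Z 0 M)
  each P (β := fun p => Arr (W p)) (fun p =>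
    mm p (rect (top o p) (m p) 0 J) (List.Ico 0 K) (X p) (M' p))

/-! ### TSQR -/

/-- The Q-factors (in basis-kernel representation) of the reduction tree: in a `node`, processor `p`
has decomposed its R-factor stacked on that of processor `q`. -/
inductive QTree {P : ℕ} (W : Fin P → Type) : Type
  | leaf : QTree W
  | node (p q : Fin P) (V T : Arr (W p)) (l r : QTree W) : QTree W

/-- Upsweep: reduction of the `n × n` R-factors of the `k` processors from number `lo`. -/
def upsweep (n k lo : ℕ) (R : Dist W) : Par P W (Dist W × QTree W) :=
  if _h : k ≤ 1 then pure (R, .leaf)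
  else do
    let h1 := (k + 1) / 2
    let h2 := k / 2
    let (R, l) ← upsweep n h1 lo R
    let (R, r) ← upsweep n h2 (lo + h1) R
    let p : Fin P := proc lo
    let q : Fin P := proc (lo + h1)
    let Z ← blank p
    let Y ← msg q p (tri n) (R q) Z
    let F ← localQR p (2 * n) n 0 (fun i j => if i < n then R p i j else Y (i - n) j)
    return (Function.update R p F.R, .node p q F.V F.T l r)
termination_by k
decreasing_by all_goals omega

/-- Downsweep: application of the tree of Q-factors to the `n × n` blocks `B`. -/
def downsweep (n : ℕ) : QTree W → Dist W → Par P W (Dist W)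
  | .leaf, B => return B
  | .node p q V T l r, B => do
      let C ← applyQ p (2 * n) n 0 V T (B p)
      let D ← msg p q (rect 0 n 0 n) (fun i j => C (n + i) j) (B q)
      let B ← downsweep n l (Function.update (Function.update B p C) q D)
      downsweep n r B

/-- A decomposition in Householder representation: the basis `V` is distributed
by rows, the kernel `T` and the R-factor `R` are on the root. -/
structure DistQR {P : ℕ} [NeZero P] (W : Fin P → Type) where
  V : Dist W
  T : Arr (W 0)
  R : Arr (W 0)

/-- TSQR with reconstruction of the Householder representation, for the active rows
and the first `n` columns of `A`. -/
def tsqr (m : Fin P → ℕ) (n o : ℕ) (A : Dist W) : Par P W (DistQR W) := do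
  let Q0 ← each P (β := fun p => LocalQR (W p)) (fun p => localQR p (m p) n (top o p) (A p))
  let (R', tree) ← upsweep n P 0 (fun p => (Q0 p).R)
  let Z ← each P (β := fun p => Arr (W p)) (fun p => blank p)
  let u ← one 0
  let B ← downsweep n tree (Function.update Z 0 (fun i j => if i = j then u else Z 0 i j))
  let Wm ← each P (β := fun p => Arr (W p)) (fun p =>
    applyQ p (m p) n (top o p) (Q0 p).V (Q0 p).T (B p))
  let (LU, S) ← signLU 0 n (fun i j => Wm 0 (o + i) j)
  let U : Arr (W 0) := fun i j => if i ≤ j then LU i j else Z 0 i j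
  let L : Arr (W 0) := fun i j => if j < i then LU i j else if i = j then u else Z 0 i j
  let LH ← adj 0 0 n n L
  let US ← fill 0 (tri n) (fun i j => do
    let c ← conj 0 (S j)
    mul 0 (U i j) c) (Z 0)
  let T ← rightSolve 0 0 n n US LH
  let R ← fill 0 (tri n) (fun i j => do
    let t ← mul 0 (S i) (R' 0 i j)
    sub 0 (Z 0 i j) t) (Z 0)
  let Up ← treeBroadcast (tri n) P 0 (Function.update Z 0 U)
  let V ← each P (β := fun p => Arr (W p)) (fun p =>
    rightSolve p (if p = 0 then o + n else 0) (m p) n (Wm p) (Up p))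
  return ⟨Function.update V 0 (fun i j => if o ≤ i ∧ i < o + n then L (i - o) j else V 0 i j), T, R⟩

/-! ### 1D-CAQR-EG -/

/-- 1D-CAQR-EG with block size `b`, for the active rows and the first `n` columns of `A`:
the columns are split in half until at most `b` remain, where TSQR is used. (For `b = 0` the
recursion stops as for `b = 1`.) -/
def caqrEG (m : Fin P → ℕ) (b n o : ℕ) (A : Dist W) : Par P W (DistQR W) :=
  if _h : n ≤ b ∨ n ≤ 1 then tsqr m n o A
  else do
    let n1 := n / 2
    let n2 := n - n / 2
    let F ← caqrEG m b n1 o A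
    let A2 : Dist W := fun p i j => A p i (n1 + j)
    let M1 ← mulAdj m o n1 n2 F.V A2
    let TH ← adj 0 0 n1 n1 F.T
    let M2 ← mm 0 (rect 0 n1 0 n2) (List.Ico 0 n1) TH M1
    let VM ← mulRoot m o n1 n2 F.V M2
    let B ← each P (β := fun p => Arr (W p)) (fun p =>
      fill p (rect (top o p) (m p) 0 n2) (fun i j => sub p (A2 p i j) (VM p i j)) (A2 p))
    let G ← caqrEG m b n2 (o + n1) B
    let M3 ← mulAdj m (o + n1) n1 n2 F.V G.V
    let M4 ← mm 0 (rect 0 n1 0 n2) (List.Ico 0 n2) M3 G.T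
    let M5 ← mm 0 (rect 0 n1 0 n2) (List.Ico 0 n1) F.T M4
    let Z ← blank 0
    let M6 ← fill 0 (rect 0 n1 0 n2) (fun i j => sub 0 (Z i j) (M5 i j)) Z
    return ⟨fun p i j => if j < n1 then F.V p i j else G.V p i (j - n1),
      fun i j =>
        if j < n1 then (if i < n1 then F.T i j else Z i j)
        else if i < n1 then M6 i (j - n1) else G.T (i - n1) (j - n1),
      fun i j =>
        if j < n1 then (if i < n1 then F.R i j else Z i j)
        else if i < n1 then B 0 (o + i) (j - n1) else G.R (i - n1) (j - n1)⟩
termination_by n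
decreasing_by all_goals omega

end Programs

/-! ### Data distribution and correctness -/

/-- A balanced distribution of the `m` rows of an `m × n` matrix over `P` processors: processor `p`
owns `rows p` rows, in arbitrary positions, except that the first rows of processor `0`,
the root, are the `n` leading rows. -/
structure Layout (P m n : ℕ) [NeZero P] where
  rows : Fin P → ℕ
  pos : (Σ p : Fin P, Fin (rows p)) ≃ Fin m
  balanced : ∀ p q, rows p ≤ rows q + 1
  leading : n ≤ rows 0
  pos_leading : ∀ i : Fin (rows 0), (i : ℕ) < n → (pos ⟨0, i⟩ : ℕ) = i

/-- The local arrays that initially hold the matrix `A`. -/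
def Layout.load {P m n : ℕ} [NeZero P] (D : Layout P m n) (A : Matrix (Fin m) (Fin n) ℂ) :
    Dist (fun _ : Fin P => ℂ) :=
  fun p i j =>
    if h : i < D.rows p ∧ j < n then A (D.pos ⟨p, ⟨i, h.1⟩⟩) ⟨j, h.2⟩ else 0

/-- The `m × n` matrix that the local arrays hold. -/
def Layout.collect {P m n : ℕ} [NeZero P] (D : Layout P m n) (V : Dist (fun _ : Fin P => ℂ)) :
    Matrix (Fin m) (Fin n) ℂ :=
  Matrix.of fun i j => V (D.pos.symm i).1 (D.pos.symm i).2 j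

/-- The leading `n × n` part of an array. -/
def square (n : ℕ) (X : Arr ℂ) : Matrix (Fin n) (Fin n) ℂ := Matrix.of fun i j => X i j

/-- `(V, T, R)` is a QR decomposition of `A` with the Q-factor in Householder representation:
`V` is unit lower trapezoidal, `T` and `R` are upper triangular, `Q = 1 - V T Vᴴ` is unitary, and
`A = Q [R; 0]`. -/
structure IsHouseholderQR {m n : ℕ} (A V : Matrix (Fin m) (Fin n) ℂ)
    (T R : Matrix (Fin n) (Fin n) ℂ) : Prop where
  basis_diag : ∀ (i : Fin m) (j : Fin n), (i : ℕ) = j → V i j = 1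
  basis_upper : ∀ (i : Fin m) (j : Fin n), (i : ℕ) < j → V i j = 0
  kernel_lower : ∀ i j : Fin n, j < i → T i j = 0
  R_lower : ∀ i j : Fin n, j < i → R i j = 0
  unitary : 1 - V * T * V.conjTranspose ∈ Matrix.unitaryGroup (Fin m) ℂ
  decomposition : A = (1 - V * T * V.conjTranspose) *
    Matrix.of (fun (i : Fin m) (j : Fin n) => if h : (i : ℕ) < n then R ⟨i, h⟩ j else 0)

/-- `b = Θ(n / log P)`, with constants `c₁` and `c₂`; every `b ≥ 1` is admitted if `P = 1`. -/
def IsBlockSize (c₁ c₂ : ℝ) (P n b : ℕ) : Prop :=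
  1 ≤ b ∧ (2 ≤ P →
    c₁ * ((n : ℝ) / Real.logb 2 P) ≤ b ∧ (b : ℝ) ≤ c₂ * ((n : ℝ) / Real.logb 2 P))

end CAQR

/-! Correctness and cost are proved separately, for the same programs.

For correctness the tasks are forgotten: `Par.value` respects sequential composition, so each
routine has a specification that asserts freedom from faults and describes the result. All QR
routines share the predicate `IsHQR`, on matrices whose rows carry heights, so that a local array
and the family of all distributed rows are instances of one notion. Two algebraic facts carry the
argument. `IsHQR.compose`: the product of two factors 1 - V T Vᴴ has the same form, with the
off-diagonal kernel block -T₁ (V₁ᴴ V₂) T₂, and the second factor fixes the rows that are already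
finished; this is the inductive step both of Householder's algorithm and of the recursion of
1D-CAQR-EG. `IsHQR.reconstruct`: if W has orthonormal columns, A = W R, and the leading block of W
plus a diagonal matrix S of signs equals L U, then triangular solves yield a Householder
representation with R-factor -S R. In TSQR the reduction tree supplies matrices Gₚ with Σ Gₚᴴ Gₚ = 1
(`upsweep_spec`), which makes W orthonormal. No division fails: a signed pivot z + z/|z| has modulus
|z| + 1, and Householder's divisor vanishes only for a zero column, where it is replaced by 1.

For the cost, every processor gets a clock that dominates the weights of all paths that can be
continued there (`PathTo.le_clock`). A program is charged by how far it pushes the clocks of its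
processors above a common bound. Charges add in sequence, while programs on disjoint sets of
processors share a single charge (`Bounded.append_disjoint`). Hence a tree pays once per level, and
since the messages of the bidirectional exchanges halve from level to level, a collective on an I ×
J array moves O(I J + P) words in O(log P) messages.

In `cost_caqrEG` the recursion has x splits with x b ≤ 2 n. Their products move O(n² + P x) words
altogether. The TSQR leaves have widths at most b that sum to n, so they move O(n b log P) words.
For b = Θ(n / log P) this gives x = O(log P), n b log P = O(n²) and P x = O(P (log P)²) = O(n²), and
the messages number O((x + 1) log P). The tree operations, O(n² b log P) = O(n³), are absorbed by m
n² / P because n ≤ m / P. -/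

namespace CAQR

/-! ### Results of programs -/

section Value

variable {P : ℕ} {α β : Type}

/-- The result of a program, or `none` after a fault. -/
noncomputable def Par.value (x : Par P (fun _ => ℂ) α) : Option α := x.run.map Prod.fst

/-! ### The monad laws, and runs of sequential compositions. -/

theorem Par.pure_def {W : Fin P → Type} (a : α) : (pure a : Par P W α) = Par.ret a := rfl

theorem Par.bind_def {W : Fin P → Type} (x : Par P W α) (f : α → Par P W β) :
    x >>= f = x.bind f := rfl

theorem Par.bind_assoc' {W : Fin P → Type} {γ : Type} (x : Par P W α) (f : α → Par P W β)
    (g : β → Par P W γ) : (x.bind f).bind g = x.bind fun a => (f a).bind g := by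
  induction x with
  | ret a => rfl
  | op p o k ih => simp only [Par.bind, ih]
  | msg p q S x y k ih => simp only [Par.bind, ih]

theorem Par.bind_ret {W : Fin P → Type} (x : Par P W α) : x.bind Par.ret = x := by
  induction x with
  | ret a => rfl
  | op p o k ih => simp only [Par.bind, ih]
  | msg p q S x y k ih => simp only [Par.bind, ih]

instance {W : Fin P → Type} : LawfulMonad (Par P W) := LawfulMonad.mk'
  (id_map := fun x => Par.bind_ret x)
  (pure_bind := fun _ _ => rfl)
  (bind_assoc := fun x f g => Par.bind_assoc' x f g)

theorem Par.run_bind (x : Par P (fun _ => ℂ) α) (f : α → Par P (fun _ => ℂ) β) :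
    (x >>= f).run = x.run.bind fun r => (f r.1).run.map fun s => (s.1, r.2 ++ s.2) := by
  rw [Par.bind_def]
  induction x with
  | ret a => simp [Par.bind, Par.run]
  | op p o k ih =>
    simp only [Par.bind, Par.run]
    cases o.eval with
    | none => rfl
    | some z =>
      simp only [ih, Option.map_bind, Option.bind_map]
      congr 1
      funext r
      simp [Function.comp_def]
  | msg p q S x y k ih =>
    simp only [Par.bind, Par.run, ih, Option.map_bind, Option.bind_map]
    congr 1
    funext r
    simp [Function.comp_def]

/-! ### Values of operations and of elementary array programs. -/

@[simp] theorem value_pure (a : α) : (pure a : Par P (fun _ => ℂ) α).value = some a := by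
  simp [Par.pure_def, Par.value, Par.run]

-- Forgetting the tasks is a monad morphism to `Option`, so correctness can be proved without any
-- reference to cost.
@[simp] theorem value_bind (x : Par P (fun _ => ℂ) α) (f : α → Par P (fun _ => ℂ) β) :
    (x >>= f).value = x.value.bind fun a => (f a).value := by
  simp [Par.value, Par.run_bind, Option.map_bind, Option.bind_map, Function.comp_def]

@[simp] theorem value_map (g : α → β) (x : Par P (fun _ => ℂ) α) :
    (g <$> x).value = x.value.map g := by
  rw [map_eq_pure_bind, value_bind]
  cases x.value <;> simp

theorem value_op (p : Fin P) (o : Oper ℂ) :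
    (Par.op (W := fun _ => ℂ) p o Par.ret).value = o.eval := by
  simp only [Par.value, Par.run]
  cases o.eval <;> simp

variable (p q : Fin P) (x y c : ℂ)

@[simp] theorem value_zero : (zero (W := fun _ => ℂ) p).value = some 0 := value_op _ _
@[simp] theorem value_one : (one (W := fun _ => ℂ) p).value = some 1 := value_op _ _
@[simp] theorem value_add : (add (W := fun _ => ℂ) p x y).value = some (x + y) := value_op _ _
@[simp] theorem value_sub : (sub (W := fun _ => ℂ) p x y).value = some (x - y) := value_op _ _
@[simp] theorem value_mul : (mul (W := fun _ => ℂ) p x y).value = some (x * y) := value_op _ _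
@[simp] theorem value_conj : (conj (W := fun _ => ℂ) p x).value = some (star x) := value_op _ _
theorem value_div (h : y ≠ 0) : (div (W := fun _ => ℂ) p x y).value = some (x / y) := by
  simp [div, value_op, Oper.eval, h]
theorem value_sqrt (r : ℝ) (h : 0 ≤ r) :
    (sqrt (W := fun _ => ℂ) p (r : ℂ)).value = some ((Real.sqrt r : ℝ) : ℂ) := by
  simp [sqrt, value_op, Oper.eval, h]
open Classical in
@[simp] theorem value_ifz :
    (ifz (W := fun _ => ℂ) p c x y).value = some (if c = 0 then x else y) := by
  simp only [ifz, value_op, Oper.eval]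
  split_ifs <;> rfl
@[simp] theorem value_msg (S : List (ℕ × ℕ)) (X Y : Arr ℂ) :
    (msg (W := fun _ => ℂ) p q S X Y).value = some (overwrite S X Y) := by
  simp [msg, Par.value, Par.run]

@[simp] theorem value_blank : (blank (W := fun _ => ℂ) p).value = some fun _ _ => 0 := by
  simp [blank]

/-- The program for an entry does not read the array that is being filled, so the order of the
addresses and repetitions among them are irrelevant. -/
theorem value_fill (S : List (ℕ × ℕ)) (f : ℕ → ℕ → Par P (fun _ => ℂ) ℂ) (g : ℕ → ℕ → ℂ)
    (Y : Arr ℂ) (h : ∀ i j, (i, j) ∈ S → (f i j).value = some (g i j)) :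
    (fill (W := fun _ => ℂ) p S f Y).value = some (overwrite S g Y) := by
  unfold fill
  induction S generalizing Y with
  | nil =>
    simp only [List.foldlM_nil, value_pure]
    congr 1
  | cons a S ih =>
    rw [List.foldlM_cons, value_bind, value_bind, h a.1 a.2 (by simp)]
    simp only [Option.bind_some, value_pure]
    rw [ih _ fun i j hij => h i j (List.mem_cons_of_mem _ hij)]
    congr 1
    funext i j
    by_cases h1 : (i, j) ∈ S
    · simp [overwrite, h1]
    · by_cases h2 : i = a.1 ∧ j = a.2
      · simp [overwrite, h2]
      · have : (i, j) ≠ a := fun h => h2 ⟨congrArg Prod.fst h, congrArg Prod.snd h⟩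
        simp [overwrite, h1, h2, this]

@[simp] theorem mem_rect {r r' c c' i j : ℕ} :
    (i, j) ∈ rect r r' c c' ↔ (r ≤ i ∧ i < r') ∧ c ≤ j ∧ j < c' := by
  change (i, j) ∈ List.Ico r r' ×ˢ List.Ico c c' ↔ _
  simp

@[simp] theorem mem_tri {n i j : ℕ} : (i, j) ∈ tri n ↔ i ≤ j ∧ j < n := by
  simp [tri]
  omega

@[simp] theorem value_dot (ks : List ℕ) (f g : ℕ → ℂ) :
    (dot (W := fun _ => ℂ) p ks f g).value = some (ks.map fun k => f k * g k).sum := by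
  have (s : ℂ) : (ks.foldlM (m := Par P (fun _ => ℂ)) (fun s k => do
      let t ← mul p (f k) (g k)
      add p s t) s).value = some (s + (ks.map fun k => f k * g k).sum) := by
    induction ks generalizing s with
    | nil => simp
    | cons k ks ih =>
      rw [List.foldlM_cons, value_bind]
      simp [ih, add_assoc]
  simp [dot, this]

theorem sum_map_Ico (a b : ℕ) (f : ℕ → ℂ) :
    ((List.Ico a b).map f).sum = ∑ k ∈ Finset.Ico a b, f k := rfl

theorem sum_map_range (n : ℕ) (f : ℕ → ℂ) :
    ((List.range n).map f).sum = ∑ k ∈ Finset.range n, f k := rfl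

@[simp] theorem value_mm (S : List (ℕ × ℕ)) (a b : ℕ) (X Y : Arr ℂ) :
    (mm (W := fun _ => ℂ) p S (List.Ico a b) X Y).value =
      some (overwrite S (fun i j => ∑ k ∈ Finset.Ico a b, X i k * Y k j) fun _ _ => 0) := by
  simp only [mm, value_bind, value_blank, Option.bind_some]
  exact value_fill _ _ _ _ _ fun i j _ => value_dot _ _ _ _

@[simp] theorem value_adj (r r' n : ℕ) (X : Arr ℂ) :
    (adj (W := fun _ => ℂ) p r r' n X).value =
      some (overwrite (rect 0 n r r') (fun i j => star (X j i)) fun _ _ => 0) := by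
  simp only [adj, value_bind, value_blank, Option.bind_some]
  exact value_fill _ _ _ _ _ fun i j _ => value_conj _ _

/-- `z / |z|`, or `1` if `z = 0`. -/
noncomputable def csgn (z : ℂ) : ℂ := if z = 0 then 1 else z / ‖z‖

@[simp] theorem norm_csgn (z : ℂ) : ‖csgn z‖ = 1 := by
  unfold csgn
  split_ifs with h
  · simp
  · simp [h]

theorem csgn_mul_norm (z : ℂ) : csgn z * ‖z‖ = z := by
  unfold csgn
  split_ifs with h
  · simp [h]
  · rw [div_mul_cancel₀]
    simpa using h

theorem star_csgn_mul (z : ℂ) : star (csgn z) * csgn z = 1 := by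
  have := Complex.conj_mul' (csgn z)
  simpa using this

@[simp] theorem value_sgn (z : ℂ) : (sgn (W := fun _ => ℂ) p z).value = some (csgn z) := by
  have h : z * star z = ((‖z‖ ^ 2 : ℝ) : ℂ) := by
    have := Complex.mul_conj' z
    simpa using this
  simp only [sgn, value_bind, value_one, value_conj, value_mul, Option.bind_some, h,
    value_sqrt p _ (sq_nonneg ‖z‖), Real.sqrt_sq (norm_nonneg z), value_ifz]
  by_cases hz : z = 0
  · simp [hz, value_div, csgn]
  · rw [value_div]
    · simp [hz, csgn]
    · simp [hz]

theorem value_each (k : ℕ) {β : Fin k → Type} (f : (i : Fin k) → Par P (fun _ => ℂ) (β i))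
    (g : (i : Fin k) → β i) (h : ∀ i, (f i).value = some (g i)) :
    (each k f).value = some g := by
  induction k with
  | zero =>
    simp only [each, value_pure]
    congr 1
    funext i
    exact i.elim0
  | succ k ih =>
    simp only [each, value_bind, h 0, Option.bind_some,
      ih (fun i => f i.succ) (fun i => g i.succ) fun i => h i.succ, value_pure]
    congr 1
    exact Fin.cons_self_tail g

end Value

/-! ### Clocks and cost bounds -/

section Clock

variable {P : ℕ} {α β : Type}

/-- Operations, words and messages of a task. -/
def Task.weight (a : Task P) : ℕ × ℕ × ℕ := (a.ops, a.words, a.messages)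

/-- The clocks after a task, where `c p` bounds the weights of all paths that can be continued
by a task of processor `p`. -/
def tick (c : Fin P → ℕ × ℕ × ℕ) : Task P → Fin P → ℕ × ℕ × ℕ
  | .op p => Function.update c p (c p + (1, 0, 0))
  -- The join records that a path through the send can be continued by the matching receive on `q`.
  | .send p q w =>
      Function.update (Function.update c p (c p + (0, w, 1))) q (c q ⊔ (c p + (0, w, 1)))
  | .recv _ q w => Function.update c q (c q + (0, w, 1))

/-- The clocks after a list of tasks. -/
def clock (t : List (Task P)) (c : Fin P → ℕ × ℕ × ℕ) : Fin P → ℕ × ℕ × ℕ := t.foldl tick c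

/-! ### Clocks dominate paths. -/

theorem le_tick (c : Fin P → ℕ × ℕ × ℕ) (a : Task P) : c ≤ tick c a := by
  intro r
  cases a with
  | op p =>
    by_cases h : r = p
    · subst h; simp [tick]
    · simp [tick, h]
  | send p q w =>
    by_cases h : r = q
    · subst h; simp [tick]
    · by_cases h' : r = p
      · subst h'; simp [tick, h]
      · simp [tick, h, h']
  | recv p q w =>
    by_cases h : r = q
    · subst h; simp [tick]
    · simp [tick, h]

theorem tick_proc (c : Fin P → ℕ × ℕ × ℕ) (a : Task P) :
    c a.proc + a.weight ≤ tick c a a.proc := by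
  cases a with
  | op p => simp [tick, Task.weight, Task.proc, Task.ops, Task.words, Task.messages]
  | send p q w =>
    by_cases h : p = q
    · subst h; simp [tick, Task.weight, Task.proc, Task.ops, Task.words, Task.messages]
    · simp [tick, Task.weight, Task.proc, Task.ops, Task.words, Task.messages, h]
  | recv p q w => simp [tick, Task.weight, Task.proc, Task.ops, Task.words, Task.messages]

theorem clock_append (t u : List (Task P)) (c : Fin P → ℕ × ℕ × ℕ) :
    clock (t ++ u) c = clock u (clock t c) := List.foldl_append

theorem le_clock (t : List (Task P)) (c : Fin P → ℕ × ℕ × ℕ) : c ≤ clock t c := by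
  induction t generalizing c with
  | nil => exact le_rfl
  | cons a t ih => exact (le_tick c a).trans (ih _)

theorem clock_take_mono (t : List (Task P)) (c : Fin P → ℕ × ℕ × ℕ) {i j : ℕ} (h : i ≤ j) :
    clock (t.take i) c ≤ clock (t.take j) c := by
  have : t.take j = t.take i ++ (t.take j).drop i := by
    conv_lhs => rw [← List.take_append_drop i (t.take j)]
    rw [List.take_take, min_eq_left h]
  rw [this, clock_append]
  exact le_clock _ _

/-- `w` is the total weight of a path of the dependence DAG that ends at position `j`. -/
inductive PathTo (t : List (Task P)) : ℕ → ℕ × ℕ × ℕ → Prop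
  | single {j : ℕ} {a : Task P} (h : t[j]? = some a) : PathTo t j a.weight
  | step {i j : ℕ} {a : Task P} {w : ℕ × ℕ × ℕ} (hi : PathTo t i w) (e : Edge t i j)
      (h : t[j]? = some a) : PathTo t j (w + a.weight)

theorem clock_take_succ {t : List (Task P)} {j : ℕ} {a : Task P} (h : t[j]? = some a)
    (c : Fin P → ℕ × ℕ × ℕ) : clock (t.take (j + 1)) c = tick (clock (t.take j) c) a := by
  rw [List.take_add_one, h, clock_append]
  rfl

/-- Induction along the path. An edge within one processor is harmless because clocks never
decrease. The second conclusion, at the destination of a send, is what carries the induction across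
a message edge, where the processor changes. -/
theorem PathTo.le_clock {t : List (Task P)} {j : ℕ} {w : ℕ × ℕ × ℕ} (h : PathTo t j w) :
    ∀ a, t[j]? = some a → w ≤ clock (t.take (j + 1)) 0 a.proc ∧
      ∀ p q v, a = Task.send p q v → w ≤ clock (t.take (j + 1)) 0 q := by
  have key (j : ℕ) (a : Task P) (w : ℕ × ℕ × ℕ) (ha : t[j]? = some a)
      (hw : w ≤ clock (t.take j) 0 a.proc) :
      w + a.weight ≤ clock (t.take (j + 1)) 0 a.proc ∧
      ∀ p q v, a = Task.send p q v → w + a.weight ≤ clock (t.take (j + 1)) 0 q := by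
    rw [clock_take_succ ha]
    refine ⟨(add_le_add_left hw _).trans (tick_proc _ a), ?_⟩
    rintro p q v rfl
    simp only [tick, Function.update_self]
    exact le_sup_of_le_right (add_le_add_left hw _)
  induction h with
  | single h =>
    intro a ha
    obtain rfl : _ = a := Option.some.inj (h.symm.trans ha)
    simpa using key _ _ 0 ha (zero_le)
  | @step i j a w hi e h ih =>
    intro b hb
    obtain rfl : a = b := Option.some.inj (h.symm.trans hb)
    apply key _ _ _ hb
    rcases e with ⟨a', b', ha', hb', hij, hproc⟩ | ⟨p, q, v, hp, hq, hij⟩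
    · obtain rfl : a = b' := Option.some.inj (h.symm.trans hb')
      rw [← hproc]
      exact (ih a' ha').1.trans (clock_take_mono t 0 hij _)
    · obtain rfl : a = .recv p q v := Option.some.inj (h.symm.trans hq)
      rw [hij]
      exact (ih _ hp).2 p q v rfl

theorem PathTo.extend {t : List (Task P)} (s : List ℕ) : ∀ {i : ℕ} {w : ℕ × ℕ × ℕ}
    {l : List (Task P)}, PathTo t i w → List.IsChain (Edge t) (i :: s) →
    s.map (fun i => t[i]?) = l.map some →
    ∃ j, PathTo t j (w + (l.map Task.weight).sum) := by
  induction s with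
  | nil =>
    intro i w l h _ hl
    obtain rfl : l = [] := by simpa using hl.symm
    exact ⟨i, by simpa using h⟩
  | cons j s ih =>
    intro i w l h hc hl
    cases l with
    | nil => simp at hl
    | cons a l =>
      simp only [List.map_cons, List.cons.injEq] at hl
      rw [List.isChain_cons_cons] at hc
      obtain ⟨k, hk⟩ := ih (h.step hc.1 hl.1) hc.2 hl.2
      exact ⟨k, by simpa [add_assoc] using hk⟩

theorem IsPath.weight_le {t l : List (Task P)} (h : IsPath t l) {k : ℕ × ℕ × ℕ}
    (hk : ∀ p, clock t 0 p ≤ k) : (l.map Task.weight).sum ≤ k := by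
  obtain ⟨s, hs, hl⟩ := h
  cases s with
  | nil =>
    obtain rfl : l = [] := by simpa using hl.symm
    exact zero_le
  | cons i s =>
    cases l with
    | nil => simp at hl
    | cons a l =>
      simp only [List.map_cons, List.cons.injEq] at hl
      obtain ⟨j, hj⟩ := (PathTo.single hl.1).extend s hs hl.2
      have hex : ∃ b, t[j]? = some b := by
        generalize (a.weight + (l.map Task.weight).sum) = w at hj
        cases hj with
        | single h => exact ⟨_, h⟩
        | step _ _ h => exact ⟨_, h⟩
      obtain ⟨b, hb⟩ := hex
      have h1 := (hj.le_clock b hb).1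
      have h2 := clock_take_mono t 0 (le_max_left (j + 1) t.length) b.proc
      rw [List.take_of_length_le (le_max_right _ _)] at h2
      simpa using (h1.trans h2).trans (hk _)

/-- The tasks `t` involve only processors in `S`, and advance their clocks by at most `k`. -/
def Bounded (S : Set (Fin P)) (t : List (Task P)) (k : ℕ × ℕ × ℕ) : Prop :=
  (∀ c a, (∀ p ∈ S, c p ≤ a) → ∀ p ∈ S, clock t c p ≤ a + k) ∧
    ∀ c, ∀ p ∉ S, clock t c p = c p

/-- The invariant is a common bound on the clocks in `S`, not an advance of each clock from its own
value: messages mix the clocks, so only the common bound survives composition. -/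
theorem Bounded.append {S : Set (Fin P)} {t u : List (Task P)} {k l : ℕ × ℕ × ℕ}
    (h : Bounded S t k) (h' : Bounded S u l) : Bounded S (t ++ u) (k + l) := by
  refine ⟨fun c a hc p hp => ?_, fun c p hp => ?_⟩
  · rw [clock_append, ← add_assoc]
    exact h'.1 _ _ (h.1 c a hc) p hp
  · rw [clock_append, h'.2 _ p hp, h.2 _ p hp]

theorem Bounded.mono {S S' : Set (Fin P)} {t : List (Task P)} {k k' : ℕ × ℕ × ℕ}
    (h : Bounded S t k) (hS : S ⊆ S') (hk : k ≤ k') : Bounded S' t k' := by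
  refine ⟨fun c a hc p hp => ?_, fun c p hp => h.2 c p fun h => hp (hS h)⟩
  by_cases h' : p ∈ S
  · exact (h.1 c a (fun q hq => hc q (hS hq)) p h').trans (by gcongr)
  · rw [h.2 c p h']
    exact (hc p hp).trans le_self_add

/-- All gain from parallelism enters here: the second list neither changes the clocks in `S` nor
needs a bound on them, so both lists advance from the same bound and `k` is charged once. -/
theorem Bounded.append_disjoint {S S' : Set (Fin P)} {t u : List (Task P)} {k : ℕ × ℕ × ℕ}
    (h : Bounded S t k) (h' : Bounded S' u k) (hd : Disjoint S S') :
    Bounded (S ∪ S') (t ++ u) k := by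
  refine ⟨fun c a hc p hp => ?_, fun c p hp => ?_⟩
  · rw [clock_append]
    by_cases hS : p ∈ S
    · rw [h'.2 _ p (Set.disjoint_left.1 hd hS)]
      exact h.1 c a (fun q hq => hc q (Or.inl hq)) p hS
    · have hS' : p ∈ S' := hp.resolve_left hS
      refine h'.1 _ a (fun q hq => ?_) p hS'
      rw [h.2 _ q (Set.disjoint_right.1 hd hq)]
      exact hc q (Or.inr hq)
  · rw [clock_append, h'.2 _ p fun h => hp (Or.inr h), h.2 _ p fun h => hp (Or.inl h)]

theorem Bounded.nil (S : Set (Fin P)) : Bounded S [] 0 :=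
  ⟨fun _ _ hc p hp => by simpa [clock] using hc p hp, fun _ _ _ => rfl⟩

/-- Every execution of `x` involves only processors in `S`, with at most `k.1` operations, `k.2.1`
words and `k.2.2` messages along every path. -/
def Cost (S : Set (Fin P)) (x : Par P (fun _ => ℂ) α) (k : ℕ × ℕ × ℕ) : Prop :=
  ∀ a t, x.run = some (a, t) → Bounded S t k

/-! ### Calculus of cost bounds. -/

theorem run_bind_eq_some {x : Par P (fun _ => ℂ) α} {f : α → Par P (fun _ => ℂ) β} {b : β}
    {t : List (Task P)} (h : (x >>= f).run = some (b, t)) :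
    ∃ a u v, x.run = some (a, u) ∧ (f a).run = some (b, v) ∧ t = u ++ v := by
  rw [Par.run_bind] at h
  simp only [Option.bind_eq_some_iff, Option.map_eq_some_iff, Prod.exists, Prod.mk.injEq] at h
  obtain ⟨a, u, h1, b', v, h2, rfl, rfl⟩ := h
  exact ⟨a, u, v, h1, h2, rfl⟩

variable {S S' : Set (Fin P)} {x : Par P (fun _ => ℂ) α} {f : α → Par P (fun _ => ℂ) β}
  {k l : ℕ × ℕ × ℕ}

theorem Cost.pure (a : α) : Cost S (pure a : Par P (fun _ => ℂ) α) 0 := by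
  rintro b t h
  simp only [Par.pure_def, Par.run, Option.some.injEq, Prod.mk.injEq] at h
  rw [← h.2]
  exact Bounded.nil S

/-- The continuation has to be bounded only at results that really occur. The downsweep needs this,
since its cost depends on the shape of the tree built by the upsweep. -/
theorem Cost.bind_of_value (hx : Cost S x k) (hf : ∀ a, x.value = some a → Cost S (f a) l) :
    Cost S (x >>= f) (k + l) := by
  intro b t h
  obtain ⟨a, u, v, h1, h2, rfl⟩ := run_bind_eq_some h
  exact (hx _ _ h1).append (hf a (by simp [Par.value, h1]) _ _ h2)

theorem Cost.bind (hx : Cost S x k) (hf : ∀ a, Cost S (f a) l) : Cost S (x >>= f) (k + l) :=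
  hx.bind_of_value fun a _ => hf a

theorem Cost.bind_pure (hx : Cost S x k) {g : α → β} :
    Cost S (x >>= fun a => Pure.pure (g a)) k :=
  hx.bind fun _ => Cost.pure _

theorem Cost.mono (hx : Cost S x k) (hS : S ⊆ S') (hk : k ≤ l) : Cost S' x l :=
  fun a t h => (hx a t h).mono hS hk

theorem Cost.le (hx : Cost S x k) (hk : k ≤ l) : Cost S x l := hx.mono subset_rfl hk

theorem Cost.bind_disjoint (hx : Cost S x k) (hf : ∀ a, Cost S' (f a) k) (hd : Disjoint S S') :
    Cost (S ∪ S') (x >>= f) k := by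
  intro b t h
  obtain ⟨a, u, v, h1, h2, rfl⟩ := run_bind_eq_some h
  exact (hx _ _ h1).append_disjoint (hf a _ _ h2) hd

theorem cost_op (p : Fin P) (o : Oper ℂ) :
    Cost {p} (Par.op (W := fun _ => ℂ) p o Par.ret) (1, 0, 0) := by
  intro a t h
  simp only [Par.run] at h
  cases ho : o.eval with
  | none => simp [ho] at h
  | some z =>
    simp only [ho, Option.map_some, Option.some.injEq, Prod.mk.injEq] at h
    rw [← h.2]
    refine ⟨fun c a hc q hq => ?_, fun c q hq => ?_⟩
    · obtain rfl : q = p := hq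
      simpa [clock, tick] using hc q rfl
    · have : q ≠ p := hq
      simp [clock, tick, this]

/-- A path may include both the send and the matching receive, hence the factors 2. -/
theorem cost_msg (p q : Fin P) (A : List (ℕ × ℕ)) (X Y : Arr ℂ) :
    Cost {p, q} (msg (W := fun _ => ℂ) p q A X Y) (0, 2 * A.length, 2) := by
  intro a t h
  simp only [msg, Par.run, Option.map_some, Option.some.injEq, Prod.mk.injEq] at h
  rw [← h.2]
  refine ⟨fun c a hc r hr => ?_, fun c r hr => ?_⟩
  · have hp := hc p (by simp)
    have hq := hc q (by simp)
    have e : ((0, 2 * A.length, 2) : ℕ × ℕ × ℕ) = (0, A.length, 1) + (0, A.length, 1) := by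
      simp [two_mul]
    have h1 : c p + (0, A.length, 1) ≤ a + (0, A.length, 1) := by gcongr
    rw [e, ← add_assoc]
    by_cases hrq : r = q
    · subst hrq
      simp only [clock, List.foldl_cons, List.foldl_nil, tick, Function.update_self]
      gcongr
      exact sup_le (hq.trans le_self_add) h1
    · obtain rfl : r = p := hr.resolve_right hrq
      simp only [clock, List.foldl_cons, List.foldl_nil, tick, Function.update_of_ne hrq,
        Function.update_self]
      exact h1.trans le_self_add
  · simp only [Set.mem_insert_iff, Set.mem_singleton_iff, not_or] at hr
    simp [clock, tick, hr]

theorem cost_foldlM {ι : Type} (L : List ι) {f : α → ι → Par P (fun _ => ℂ) α}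
    (h : ∀ a, ∀ i ∈ L, Cost S (f a i) k) (a : α) : Cost S (L.foldlM f a) (L.length • k) := by
  induction L generalizing a with
  | nil => simpa using Cost.pure a
  | cons i L ih =>
    rw [List.foldlM_cons, List.length_cons, succ_nsmul']
    exact (h a i (by simp)).bind fun b => ih (fun a j hj => h a j (by simp [hj])) b

theorem cost_foldlM_disjoint {f : α → ℕ → Par P (fun _ => ℂ) α} (n : ℕ) (T : ℕ → Set (Fin P))
    (h : ∀ a, ∀ i < n, Cost (T i) (f a i) k)
    (hT : ∀ i < n, ∀ j < n, i ≠ j → Disjoint (T i) (T j)) (a : α) :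
    Cost (⋃ i < n, T i) ((List.range n).foldlM f a) k := by
  induction n with
  | zero => exact (Cost.pure (S := ∅) a).mono (by simp) (zero_le)
  | succ n ih =>
    rw [List.range_succ, List.foldlM_append]
    refine Cost.mono (Cost.bind_disjoint (ih (fun a i hi => h a i (by omega))
      fun i hi j hj => hT i (by omega) j (by omega)) (S' := T n) (fun b => ?_) ?_) ?_ le_rfl
    · simpa using h b n (by omega)
    · simp only [Set.disjoint_iUnion_left]
      exact fun i hi => hT i (by omega) n (by omega) (by omega)
    · intro p hp
      simp only [Set.mem_union, Set.mem_iUnion] at hp ⊢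
      rcases hp with ⟨i, hi, hp⟩ | hp
      · exact ⟨i, by omega, hp⟩
      · exact ⟨n, by omega, hp⟩

theorem cost_each_range (n : ℕ) {β : Fin n → Type} (f : (i : Fin n) → Par P (fun _ => ℂ) (β i))
    (σ : Fin n → Fin P) (hσ : Function.Injective σ) (h : ∀ i, Cost {σ i} (f i) k) :
    Cost (Set.range σ) (each n f) k := by
  induction n with
  | zero => exact (Cost.pure (S := ∅) _).mono (by simp) (zero_le)
  | succ n ih =>
    refine Cost.mono (Cost.bind_disjoint (h 0) (S' := Set.range fun i : Fin n => σ i.succ)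
      (fun a => (ih _ _ (fun i j hij => Fin.succ_injective _ (hσ hij))
        fun i => h i.succ).bind_pure) ?_) ?_ le_rfl
    · simp only [Set.disjoint_singleton_left, Set.mem_range, not_exists]
      exact fun i hi => Fin.succ_ne_zero i (hσ hi)
    · intro p hp
      rcases hp with rfl | ⟨i, rfl⟩
      · exact ⟨0, rfl⟩
      · exact ⟨i.succ, rfl⟩

theorem cost_each {β : Fin P → Type} (f : (i : Fin P) → Par P (fun _ => ℂ) (β i))
    (h : ∀ p, Cost {p} (f p) k) : Cost Set.univ (each P f) k := by
  have := cost_each_range P f id Function.injective_id h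
  rwa [Set.range_id] at this

theorem Cost.costsAtMost (h : Cost Set.univ x k) {a : α} {t : List (Task P)}
    (ht : x.run = some (a, t)) {F N M : ℝ} (hF : (k.1 : ℝ) ≤ F) (hN : (k.2.1 : ℝ) ≤ N)
    (hM : (k.2.2 : ℝ) ≤ M) : CostsAtMost t F N M := by
  intro l hl
  have hc := hl.weight_le (k := k) fun p => by
    simpa using (h a t ht).1 0 0 (fun _ _ => le_rfl) p trivial
  have e : (l.map Task.weight).sum =
      ((l.map Task.ops).sum, (l.map Task.words).sum, (l.map Task.messages).sum) := by
    clear hl hc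
    induction l with
    | nil => rfl
    | cons a l ih => simp [ih, Task.weight]
  rw [e, Prod.le_def, Prod.le_def] at hc
  exact ⟨(Nat.cast_le.2 hc.1).trans hF, (Nat.cast_le.2 hc.2.1).trans hN,
    (Nat.cast_le.2 hc.2.2).trans hM⟩

end Clock

/-! ### Householder representations over an arbitrary set of rows -/

section HouseholderQR

open Matrix

variable {ρ : Type}

/-- The first `n` columns of a family of rows. -/
def tall (n : ℕ) (X : ρ → ℕ → ℂ) : Matrix ρ (Fin n) ℂ := Matrix.of fun i j => X i j

/-- The columns of the identity that belong to the rows of heights `o, …, o + n - 1`. -/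
def embed (h : ρ → ℕ) (o n : ℕ) : Matrix ρ (Fin n) ℂ :=
  Matrix.of fun i j => if h i = o + j then 1 else 0

/-- Two matrices side by side. -/
def cols {k l : ℕ} (A : Matrix ρ (Fin k) ℂ) (B : Matrix ρ (Fin l) ℂ) : Matrix ρ (Fin (k + l)) ℂ :=
  (Matrix.fromCols A B).submatrix id finSumFinEquiv.symm

/-- A block matrix. -/
def blocks {k l : ℕ} (A : Matrix (Fin k) (Fin k) ℂ) (B : Matrix (Fin k) (Fin l) ℂ)
    (C : Matrix (Fin l) (Fin k) ℂ) (D : Matrix (Fin l) (Fin l) ℂ) :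
    Matrix (Fin (k + l)) (Fin (k + l)) ℂ :=
  (Matrix.fromBlocks A B C D).submatrix finSumFinEquiv.symm finSumFinEquiv.symm

/-! ### Block matrices and columns of the identity. -/

theorem tall_eq_cols (k l : ℕ) (X A B : ρ → ℕ → ℂ) (hA : ∀ i, ∀ j < k, X i j = A i j)
    (hB : ∀ i, ∀ j < l, X i (k + j) = B i j) :
    tall (k + l) X = cols (tall k A) (tall l B) := by
  ext i j
  refine Fin.addCases (fun j => ?_) (fun j => ?_) j <;> simp [tall, cols, *]

theorem square_eq_blocks (k l : ℕ) (A B C D : Arr ℂ) (X : Arr ℂ)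
    (hA : ∀ i < k, ∀ j < k, X i j = A i j) (hB : ∀ i < k, ∀ j < l, X i (k + j) = B i j)
    (hC : ∀ i < l, ∀ j < k, X (k + i) j = C i j) (hD : ∀ i < l, ∀ j < l, X (k + i) (k + j) = D i j) :
    square (k + l) X = blocks (square k A) (Matrix.of fun i j => B i j)
      (Matrix.of fun i j => C i j) (square l D) := by
  ext i j
  refine Fin.addCases (fun j => ?_) (fun j => ?_) j <;>
  refine Fin.addCases (fun i => ?_) (fun i => ?_) i <;> simp [square, blocks, *]

theorem cols_mul_blocks {k l : ℕ} (V : Matrix ρ (Fin k) ℂ) (V' : Matrix ρ (Fin l) ℂ)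
    (A : Matrix (Fin k) (Fin k) ℂ) (B : Matrix (Fin k) (Fin l) ℂ)
    (C : Matrix (Fin l) (Fin k) ℂ) (D : Matrix (Fin l) (Fin l) ℂ) :
    cols V V' * blocks A B C D = cols (V * A + V' * C) (V * B + V' * D) := by
  simp only [cols, blocks, Matrix.submatrix_mul_equiv, Matrix.fromCols_mul_fromBlocks]

theorem cols_mul_conjTranspose {k l : ℕ} (V U : Matrix ρ (Fin k) ℂ) (V' U' : Matrix ρ (Fin l) ℂ) :
    cols V V' * (cols U U')ᴴ = V * Uᴴ + V' * U'ᴴ := by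
  simp only [cols, Matrix.conjTranspose_submatrix, Matrix.submatrix_mul_equiv,
    Matrix.conjTranspose_fromCols_eq_fromRows_conjTranspose, Matrix.fromCols_mul_fromRows]
  rfl

theorem embed_add (h : ρ → ℕ) (o k l : ℕ) :
    embed h o (k + l) = cols (embed h o k) (embed h (o + k) l) := by
  ext i j
  refine Fin.addCases (fun j => ?_) (fun j => ?_) j <;> simp [cols, embed, add_assoc]

theorem embed_mul_apply_of_eq {κ : Type} (h : ρ → ℕ) (o n : ℕ) (B : Matrix (Fin n) κ ℂ)
    {i : ρ} (a : Fin n) (hi : h i = o + a) (j : κ) : (embed h o n * B) i j = B a j := by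
  rw [Matrix.mul_apply, Finset.sum_eq_single a]
  · simp [embed, hi]
  · intro b _ hb
    have : ¬ h i = o + b := fun h => hb (Fin.ext (by omega))
    simp [embed, this]
  · simp

theorem embed_mul_apply_of_ne {κ : Type} (h : ρ → ℕ) (o n : ℕ) (B : Matrix (Fin n) κ ℂ)
    {i : ρ} (hi : ∀ a : Fin n, h i ≠ o + a) (j : κ) : (embed h o n * B) i j = 0 := by
  rw [Matrix.mul_apply]
  exact Finset.sum_eq_zero fun a _ => by simp [embed, hi a]

section

variable [DecidableEq ρ]

/-- The projection to the rows of height at least `o`. -/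
def mask (h : ρ → ℕ) (o : ℕ) : Matrix ρ ρ ℂ := Matrix.diagonal fun i => if o ≤ h i then 1 else 0

theorem mask_conjTranspose (h : ρ → ℕ) (o : ℕ) : (mask h o)ᴴ = mask h o := by
  rw [mask, Matrix.diagonal_conjTranspose]
  congr 1
  funext i
  by_cases h : o ≤ h i <;> simp [h]

end

variable [Fintype ρ]

theorem mul_cols {k l : ℕ} (M : Matrix ρ ρ ℂ) (V : Matrix ρ (Fin k) ℂ) (V' : Matrix ρ (Fin l) ℂ) :
    M * cols V V' = cols (M * V) (M * V') := by
  ext i j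
  refine Fin.addCases (fun j => ?_) (fun j => ?_) j <;> simp [cols, Matrix.mul_apply]

theorem embed_conjTranspose_mul_apply {h : ρ → ℕ} {o n : ℕ} {κ : Type} (hh : ∀ j < n, ∃! i, h i = o + j)
    (B : Matrix ρ κ ℂ) {i : ρ} (a : Fin n) (hi : h i = o + a) (j : κ) :
    ((embed h o n)ᴴ * B) a j = B i j := by
  rw [Matrix.mul_apply, Finset.sum_eq_single i]
  · simp [embed, hi]
  · intro i' _ hi'
    have : ¬ h i' = o + a := fun h' => hi' ((hh a a.2).unique h' hi)
    simp [embed, this]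
  · simp

theorem embed_conjTranspose_mul_embed {h : ρ → ℕ} {o n : ℕ} (hh : ∀ j < n, ∃! i, h i = o + j) :
    (embed h o n)ᴴ * embed h o n = 1 := by
  ext a b
  obtain ⟨i, hi, -⟩ := hh a a.2
  rw [embed_conjTranspose_mul_apply hh _ a hi]
  have hi' : h i = o + a := hi
  simp [embed, hi', Matrix.one_apply, Fin.ext_iff]

variable [DecidableEq ρ] {h : ρ → ℕ} {o n : ℕ}

/-- `(V, T, R)` is a QR decomposition in Householder representation of the rows of `A` of
height at least `o`. -/
structure IsHQR (h : ρ → ℕ) (o n : ℕ) (A V : Matrix ρ (Fin n) ℂ) (T R : Matrix (Fin n) (Fin n) ℂ) :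
    Prop where
  basis_upper : ∀ i (j : Fin n), h i < o + j → V i j = 0
  basis_diag : ∀ i (j : Fin n), h i = o + j → V i j = 1
  kernel_lower : ∀ i j : Fin n, j < i → T i j = 0
  R_lower : ∀ i j : Fin n, j < i → R i j = 0
  unitary : 1 - V * T * Vᴴ ∈ Matrix.unitaryGroup ρ ℂ
  dec : mask h o * A = (1 - V * T * Vᴴ) * (embed h o n * R)

/-! ### Composition and reconstruction of Householder representations. -/

theorem mask_mul_apply {κ : Type} (h : ρ → ℕ) (o : ℕ) (B : Matrix ρ κ ℂ) (i : ρ) (j : κ) :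
    (mask h o * B) i j = if o ≤ h i then B i j else 0 := by
  simp [mask, Matrix.diagonal_mul]

theorem mask_mul_of_upper {V : Matrix ρ (Fin n) ℂ} (hV : ∀ i (j : Fin n), h i < o + j → V i j = 0) :
    mask h o * V = V := by
  ext i j
  rw [mask_mul_apply]
  split_ifs with hi
  · rfl
  · exact (hV i j (by omega)).symm

theorem conjTranspose_mul_mask_of_upper {V : Matrix ρ (Fin n) ℂ}
    (hV : ∀ i (j : Fin n), h i < o + j → V i j = 0) : Vᴴ * mask h o = Vᴴ := by
  rw [← mask_conjTranspose, ← Matrix.conjTranspose_mul, mask_mul_of_upper hV]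

/-- Expanding (1 - V₁ T₁ V₁ᴴ) (1 - V₂ T₂ V₂ᴴ) produces the block kernel. On the active rows `B` is
the first factor's adjoint applied to `A₂`. Its first `k` active rows are final, because the second
factor acts as the identity on them, and the second decomposition treats the others. -/
theorem IsHQR.compose {k l : ℕ} {A₁ V₁ : Matrix ρ (Fin k) ℂ} {T₁ R₁ : Matrix (Fin k) (Fin k) ℂ}
    {A₂ B V₂ : Matrix ρ (Fin l) ℂ} {T₂ R₂ : Matrix (Fin l) (Fin l) ℂ} {B₁₂ : Matrix (Fin k) (Fin l) ℂ}
    (H₁ : IsHQR h o k A₁ V₁ T₁ R₁) (H₂ : IsHQR h (o + k) l B V₂ T₂ R₂)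
    (hB : mask h o * B = mask h o * (A₂ - V₁ * (T₁ᴴ * (V₁ᴴ * A₂))))
    (hB₁₂ : ∀ i (a : Fin k) j, h i = o + a → B i j = B₁₂ a j) :
    IsHQR h o (k + l) (cols A₁ A₂) (cols V₁ V₂) (blocks T₁ (-(T₁ * (V₁ᴴ * V₂ * T₂))) 0 T₂)
      (blocks R₁ B₁₂ 0 R₂) := by
  have hQ : 1 - cols V₁ V₂ * blocks T₁ (-(T₁ * (V₁ᴴ * V₂ * T₂))) 0 T₂ * (cols V₁ V₂)ᴴ =
      (1 - V₁ * T₁ * V₁ᴴ) * (1 - V₂ * T₂ * V₂ᴴ) := by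
    rw [cols_mul_blocks, cols_mul_conjTranspose]
    simp only [Matrix.mul_zero, add_zero, Matrix.mul_neg, Matrix.sub_mul, Matrix.mul_sub,
      Matrix.one_mul, Matrix.mul_one, Matrix.add_mul, Matrix.neg_mul, Matrix.mul_assoc]
    abel
  refine ⟨?_, ?_, ?_, ?_, ?_, ?_⟩
  · intro i j
    refine Fin.addCases (fun j => ?_) (fun j => ?_) j
    · intro hi
      simpa [cols] using H₁.basis_upper i j (by simpa using hi)
    · intro hi
      simpa [cols] using H₂.basis_upper i j (by simpa [add_assoc] using hi)
  · intro i j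
    refine Fin.addCases (fun j => ?_) (fun j => ?_) j
    · intro hi
      simpa [cols] using H₁.basis_diag i j (by simpa using hi)
    · intro hi
      simpa [cols] using H₂.basis_diag i j (by simpa [add_assoc] using hi)
  · intro i j
    refine Fin.addCases (fun j => ?_) (fun j => ?_) j <;>
    refine Fin.addCases (fun i => ?_) (fun i => ?_) i <;> intro hij
    · simpa [blocks] using H₁.kernel_lower i j (Fin.lt_def.2 (Fin.lt_def.1 hij))
    · simp [blocks]
    · simp [Fin.lt_def] at hij
      omega
    · simpa [blocks] using H₂.kernel_lower i j (by simpa using hij)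
  · intro i j
    refine Fin.addCases (fun j => ?_) (fun j => ?_) j <;>
    refine Fin.addCases (fun i => ?_) (fun i => ?_) i <;> intro hij
    · simpa [blocks] using H₁.R_lower i j (Fin.lt_def.2 (Fin.lt_def.1 hij))
    · simp [blocks]
    · simp [Fin.lt_def] at hij
      omega
    · simpa [blocks] using H₂.R_lower i j (by simpa using hij)
  · rw [hQ]
    exact mul_mem H₁.unitary H₂.unitary
  -- `V₂` vanishes at the heights o, …, o + k - 1, so the second reflection fixes the corresponding
  -- unit vectors.
  · have hE : (1 - V₂ * T₂ * V₂ᴴ) * embed h o k = embed h o k := by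
      have : V₂ᴴ * embed h o k = 0 := by
        ext a j
        rw [Matrix.mul_apply]
        refine Finset.sum_eq_zero fun i _ => ?_
        by_cases hi : h i = o + j
        · rw [Matrix.conjTranspose_apply, H₂.basis_upper i a (by omega)]
          simp
        · simp [embed, hi]
      rw [Matrix.sub_mul, Matrix.one_mul, Matrix.mul_assoc, this, Matrix.mul_zero, sub_zero]
    -- The active rows split into the `k` rows that are now finished and those of height at least `o
    -- + k`.
    have hB' : embed h o k * B₁₂ + mask h (o + k) * B = mask h o * B := by
      ext i j
      rw [Matrix.add_apply, mask_mul_apply, mask_mul_apply]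
      by_cases h1 : o ≤ h i
      · by_cases h2 : o + k ≤ h i
        · rw [embed_mul_apply_of_ne h o k B₁₂ (fun a => by omega)]
          simp [h1, h2]
        · rw [embed_mul_apply_of_eq h o k B₁₂ ⟨h i - o, by omega⟩ (by simp; omega),
            hB₁₂ i ⟨h i - o, by omega⟩ j (by simp; omega)]
          simp [h1, h2]
      · rw [embed_mul_apply_of_ne h o k B₁₂ (fun a => by omega)]
        have h2 : ¬ o + k ≤ h i := by omega
        simp [h1, h2]
    -- `V₁` vanishes below height `o`, so the projection absorbs it on either side.
    have hcomm : (1 - V₁ * T₁ * V₁ᴴ) * mask h o = mask h o * (1 - V₁ * T₁ * V₁ᴴ) := by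
      rw [Matrix.sub_mul, Matrix.mul_sub, Matrix.mul_assoc (V₁ * T₁),
        conjTranspose_mul_mask_of_upper H₁.basis_upper, ← Matrix.mul_assoc, ← Matrix.mul_assoc,
        mask_mul_of_upper H₁.basis_upper, Matrix.one_mul, Matrix.mul_one]
    have hQA : A₂ - V₁ * (T₁ᴴ * (V₁ᴴ * A₂)) = (1 - V₁ * T₁ * V₁ᴴ)ᴴ * A₂ := by
      simp only [Matrix.conjTranspose_sub, Matrix.conjTranspose_mul, Matrix.conjTranspose_one,
        Matrix.conjTranspose_conjTranspose, Matrix.sub_mul, Matrix.one_mul, Matrix.mul_assoc]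
    have hU : (1 - V₁ * T₁ * V₁ᴴ) * (1 - V₁ * T₁ * V₁ᴴ)ᴴ = 1 :=
      Matrix.mem_unitaryGroup_iff.1 H₁.unitary
    rw [hQ, embed_add, cols_mul_blocks, mul_cols, mul_cols, Matrix.mul_zero, add_zero]
    have d₁ := H₁.dec
    have d₂ := H₂.dec
    generalize 1 - V₂ * T₂ * V₂ᴴ = Q₂ at *
    generalize 1 - V₁ * T₁ * V₁ᴴ = Q₁ at *
    congr 1
    · rw [d₁, Matrix.mul_assoc, ← Matrix.mul_assoc Q₂, hE]
    · rw [Matrix.mul_assoc, Matrix.mul_add, ← d₂, ← Matrix.mul_assoc Q₂, hE, hB',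
        hB, hQA, ← Matrix.mul_assoc, hcomm, Matrix.mul_assoc, ← Matrix.mul_assoc _ _ A₂, hU,
        Matrix.one_mul]

theorem isHQR_zero (h : ρ → ℕ) (o : ℕ) (A V : Matrix ρ (Fin 0) ℂ) (T R : Matrix (Fin 0) (Fin 0) ℂ) :
    IsHQR h o 0 A V T R :=
  ⟨fun _ j => j.elim0, fun _ j => j.elim0, fun _ j => j.elim0, fun _ j => j.elim0,
    by simp [Subsingleton.elim V 0], by ext _ j; exact j.elim0⟩

/-- With Q = 1 - V T Vᴴ, Qᴴ Q - 1 = -V (T + Tᴴ - Tᴴ Vᴴ V T) Vᴴ, so unitarity reduces to an n × n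
identity. -/
theorem one_sub_mem_unitaryGroup {V : Matrix ρ (Fin n) ℂ} {T : Matrix (Fin n) (Fin n) ℂ}
    (hT : Tᴴ * (Vᴴ * V) * T = T + Tᴴ) : 1 - V * T * Vᴴ ∈ Matrix.unitaryGroup ρ ℂ := by
  rw [Matrix.mem_unitaryGroup_iff']
  have : star (1 - V * T * Vᴴ) * (1 - V * T * Vᴴ) =
      1 - V * (T + Tᴴ) * Vᴴ + V * (Tᴴ * (Vᴴ * V) * T) * Vᴴ := by
    simp only [Matrix.star_eq_conjTranspose, Matrix.conjTranspose_sub, Matrix.conjTranspose_mul,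
      Matrix.conjTranspose_one, Matrix.conjTranspose_conjTranspose, Matrix.sub_mul, Matrix.mul_sub,
      Matrix.one_mul, Matrix.mul_one, Matrix.mul_add, Matrix.add_mul, Matrix.mul_assoc]
    abel
  rw [this, hT, sub_add_cancel]

/-- The Householder reconstruction: a matrix `W` with orthonormal columns and the LU factorization
of its sign-modified leading block give a Householder representation. -/
theorem IsHQR.reconstruct {A W V : Matrix ρ (Fin n) ℂ} {R L U T : Matrix (Fin n) (Fin n) ℂ}
    {S : Fin n → ℂ} (hh : ∀ j < n, ∃! i, h i = o + j)
    (hA : mask h o * A = W * R) (hW : Wᴴ * W = 1)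
    (hS : ∀ j, star (S j) * S j = 1)
    (hLU : (embed h o n)ᴴ * W + Matrix.diagonal S = L * U)
    (hLup : ∀ i j, i < j → L i j = 0) (hLdiag : ∀ i, L i i = 1)
    (hVU : V * U = W + embed h o n * Matrix.diagonal S)
    (hVL : ∀ i (a : Fin n) j, h i = o + a → V i j = L a j)
    (hVup : ∀ i j, h i < o → V i j = 0)
    (hT : T * Lᴴ = U * (Matrix.diagonal S)ᴴ) (hTlow : ∀ i j, j < i → T i j = 0)
    (hR : ∀ i j, j < i → R i j = 0) :
    IsHQR h o n A V T (-(Matrix.diagonal S * R)) := by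
  have hE := embed_conjTranspose_mul_embed hh
  have hSS : (Matrix.diagonal S)ᴴ * Matrix.diagonal S = 1 := by
    rw [Matrix.diagonal_conjTranspose, Matrix.diagonal_mul_diagonal, ← Matrix.diagonal_one]
    exact congrArg _ (funext hS)
  have hEV : (embed h o n)ᴴ * V = L := by
    ext a j
    obtain ⟨i, hi, -⟩ := hh a a.2
    rw [embed_conjTranspose_mul_apply hh _ a hi, hVL i a j hi]
  have hLunit : IsUnit L := by
    rw [Matrix.isUnit_iff_isUnit_det, Matrix.det_of_isLowerTriangular (M := L) fun i j hij => hLup i j hij]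
    simp [hLdiag]
  generalize hE' : embed h o n = E at *
  have hRl : ∀ i j : Fin n, j < i → (-(Matrix.diagonal S * R)) i j = 0 := by
    intro i j hij
    simp [Matrix.diagonal_mul, hR i j hij]
  generalize Matrix.diagonal S = D at *
  have hDD : D * Dᴴ = 1 := mul_eq_one_comm.1 hSS
  have hU : U = T * Lᴴ * D := by rw [hT, Matrix.mul_assoc, hSS, Matrix.mul_one]
  have hG : IsUnit (Dᴴ * L) := (IsUnit.of_mul_eq_one D hSS).mul hLunit
  -- Expand the Gram matrix of V U = W + E D, where Eᴴ W = L U - D. Since W and E have orthonormal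
  -- columns and D is unitary, the identity matrices cancel.
  have hM : Uᴴ * (Vᴴ * V) * U = Uᴴ * Lᴴ * D + Dᴴ * L * U := by
    have h1 : Uᴴ * (Vᴴ * V) * U = (V * U)ᴴ * (V * U) := by
      simp only [Matrix.conjTranspose_mul, Matrix.mul_assoc]
    have h2 : Eᴴ * W = L * U - D := eq_sub_of_add_eq hLU
    have h3 : Wᴴ * E = Uᴴ * Lᴴ - Dᴴ := by
      have := congrArg Matrix.conjTranspose h2
      simpa using this
    have h4 : (W + E * D)ᴴ * (W + E * D) =
        Wᴴ * W + Wᴴ * E * D + Dᴴ * (Eᴴ * W) + Dᴴ * (Eᴴ * E) * D := by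
      simp only [Matrix.conjTranspose_add, Matrix.conjTranspose_mul, Matrix.add_mul, Matrix.mul_add,
        Matrix.mul_assoc]
      abel
    rw [h1, hVU, h4, h2, h3, hE, hW, Matrix.mul_one, Matrix.sub_mul, Matrix.mul_sub, hSS,
      Matrix.mul_assoc Dᴴ L U]
    abel
  -- Substituting U = T Lᴴ D into `hM` gives the wanted identity multiplied by Dᴴ L on the left and
  -- by its adjoint on the right; both are invertible.
  have hTT : Tᴴ * (Vᴴ * V) * T = T + Tᴴ := by
    have h1 : (Dᴴ * L) * (Tᴴ * (Vᴴ * V) * T) * (Dᴴ * L)ᴴ = (Dᴴ * L) * (T + Tᴴ) * (Dᴴ * L)ᴴ := by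
      have e := hM
      rw [hU] at e
      simp only [Matrix.conjTranspose_mul, Matrix.conjTranspose_conjTranspose, Matrix.mul_assoc,
        Matrix.mul_add, Matrix.add_mul] at e ⊢
      rw [e]
      abel
    have hG' : IsUnit (Dᴴ * L)ᴴ := hG.star
    exact hG.mul_left_cancel (hG'.mul_right_cancel h1)
  refine ⟨?_, ?_, hTlow, hRl, ?_, ?_⟩
  · intro i j hi
    by_cases ho : h i < o
    · exact hVup i j ho
    · rw [hVL i ⟨h i - o, by omega⟩ j (by simp; omega)]
      exact hLup _ _ (by rw [Fin.lt_def]; simp; omega)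
  · intro i j hi
    rw [hVL i j j hi, hLdiag]
  · exact one_sub_mem_unitaryGroup hTT
  · rw [hE', hA]
    -- Indeed V T Vᴴ E = V T Lᴴ = V U Dᴴ = W Dᴴ + E. This is where the minus sign of the R-factor -D
    -- R originates.
    have h1 : (1 - V * T * Vᴴ) * E = -(W * Dᴴ) := by
      have hVE : Vᴴ * E = Lᴴ := by
        have := congrArg Matrix.conjTranspose hEV
        simpa using this
      rw [Matrix.sub_mul, Matrix.one_mul, Matrix.mul_assoc, hVE, Matrix.mul_assoc, hT,
        ← Matrix.mul_assoc, hVU, Matrix.add_mul, Matrix.mul_assoc E, hDD, Matrix.mul_one]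
      abel
    rw [← Matrix.mul_assoc, h1, Matrix.neg_mul, Matrix.mul_neg, neg_neg, Matrix.mul_assoc W,
      ← Matrix.mul_assoc Dᴴ, hSS, Matrix.one_mul]

/-- A single Householder reflector. -/
theorem isHQR_reflector {a v : ρ → ℂ} {τ β : ℂ}
    (hup : ∀ i, h i < o → v i = 0) (hdiag : ∀ i, h i = o → v i = 1)
    (hτ : τ * ∑ i, star (v i) * v i = 2) (hτ' : star τ = τ)
    (hdec : ∀ i, o ≤ h i → a i - τ * (∑ i, star (v i) * a i) * v i = if h i = o then β else 0) :
    IsHQR h o 1 (Matrix.of fun i _ => a i) (Matrix.of fun i _ => v i) (Matrix.of fun _ _ => τ)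
      (Matrix.of fun _ _ => β) := by
  set V : Matrix ρ (Fin 1) ℂ := Matrix.of fun i _ => v i with hV
  set T : Matrix (Fin 1) (Fin 1) ℂ := Matrix.of fun _ _ => τ with hT
  have hVup : ∀ i (j : Fin 1), h i < o + j → V i j = 0 := fun i j hi => hup i (by omega)
  have hTT : Tᴴ * (Vᴴ * V) * T = T + Tᴴ := by
    ext i j
    simp only [Matrix.mul_apply, Matrix.conjTranspose_apply, Matrix.add_apply, hV, hT,
      Matrix.of_apply, Finset.univ_unique, Finset.sum_singleton, hτ']
    rw [hτ]
    ring
  have hQ := one_sub_mem_unitaryGroup hTT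
  refine ⟨hVup, fun i j hi => hdiag i (by omega), fun i j hij => by omega, fun i j hij => by omega,
    hQ, ?_⟩
  have hU : (1 - V * T * Vᴴ) * (1 - V * T * Vᴴ)ᴴ = 1 := Matrix.mem_unitaryGroup_iff.1 hQ
  -- As Q is unitary, it suffices to check the decomposition in the form Qᴴ A = E β, which is `hdec`
  -- row by row.
  have : embed h o 1 * (Matrix.of fun _ _ => β : Matrix (Fin 1) (Fin 1) ℂ) =
      (1 - V * T * Vᴴ)ᴴ * (mask h o * Matrix.of fun i (_ : Fin 1) => a i) := by
    have e : (1 - V * T * Vᴴ)ᴴ * (mask h o * Matrix.of fun i (_ : Fin 1) => a i) =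
        mask h o * (Matrix.of fun i _ => a i) - V * (Tᴴ * (Vᴴ * Matrix.of fun i _ => a i)) := by
      simp only [Matrix.conjTranspose_sub, Matrix.conjTranspose_mul, Matrix.conjTranspose_one,
        Matrix.conjTranspose_conjTranspose, Matrix.sub_mul, Matrix.one_mul, Matrix.mul_assoc]
      rw [← Matrix.mul_assoc Vᴴ (mask h o), conjTranspose_mul_mask_of_upper hVup]
    rw [e]
    ext i j
    rw [Matrix.sub_apply, mask_mul_apply]
    simp only [Matrix.mul_apply, Matrix.conjTranspose_apply, hV, hT,
      Matrix.of_apply, Finset.univ_unique, Finset.sum_singleton, hτ', embed]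
    by_cases ho : o ≤ h i
    · have := hdec i ho
      simp only [ho, if_true]
      rw [mul_comm (v i), this]
      simp
    · have : h i ≠ o := by omega
      simp [ho, this, hup i (by omega)]
  rw [this, ← Matrix.mul_assoc, hU, Matrix.one_mul]

end HouseholderQR

/-! ### Results of the local programs -/

section Local

open Matrix

variable {P : ℕ} (p : Fin P)

theorem overwrite_apply (S : List (ℕ × ℕ)) (X Y : Arr ℂ) (i j : ℕ) :
    overwrite S X Y i j = if (i, j) ∈ S then X i j else Y i j := rfl

theorem value_bind_of {α β : Type} {x : Par P (fun _ => ℂ) α} {a : α} (h : x.value = some a)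
    (f : α → Par P (fun _ => ℂ) β) : (x >>= f).value = (f a).value := by
  rw [value_bind, h, Option.bind_some]

theorem sum_fin_eq_sum_Ico {o μ : ℕ} (f : ℕ → ℂ) (hf : ∀ i < o, f i = 0) :
    ∑ i : Fin μ, f i = ∑ i ∈ Finset.Ico o μ, f i := by
  rw [Fin.sum_univ_eq_sum_range, Finset.range_eq_Ico]
  symm
  apply Finset.sum_subset
  · intro i hi
    simp only [Finset.mem_Ico] at hi ⊢
    omega
  · intro i hi hi'
    simp only [Finset.mem_Ico] at hi hi'
    exact hf i (by omega)

theorem sum_star_mul_self (S : Finset ℕ) (f : ℕ → ℂ) :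
    ∑ i ∈ S, star (f i) * f i = ((∑ i ∈ S, ‖f i‖ ^ 2 : ℝ) : ℂ) := by
  push_cast
  exact Finset.sum_congr rfl fun i _ => Complex.conj_mul' (f i)

/-- The algebra of a Householder reflector. -/
theorem reflector_aux {o μ : ℕ} (ho : o < μ) (a v : ℕ → ℂ) (N s d den vv : ℂ)
    (hN : N * N = ∑ i ∈ Finset.Ico o μ, star (a i) * a i) (hNs : star N = N)
    (hss : star s * s = 1) (hsa : star s * a o = star (a o) * s) (hd : d = a o + s * N)
    (hd0 : d = 0 → ∀ i ∈ Finset.Ico o μ, a i = 0) (hden : den = if d = 0 then 1 else d)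
    (hv : ∀ i ∈ Finset.Ico o μ, v i = if i = o then 1 else a i / den)
    (hvv : vv = ∑ i ∈ Finset.Ico o μ, star (v i) * v i) (hvv0 : vv ≠ 0) :
    ∀ i ∈ Finset.Ico o μ,
      a i - 2 / vv * (∑ i ∈ Finset.Ico o μ, star (v i) * a i) * v i = if i = o then -(s * N) else 0 := by
  have ho' : o ∈ Finset.Ico o μ := by simp [ho]
  -- If `d` vanishes then the whole column does, and every reflector maps it to zero.
  by_cases h0 : d = 0
  · have ha := hd0 h0
    have hN0 : N = 0 := by
      rw [← mul_self_eq_zero, hN]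
      exact Finset.sum_eq_zero fun i hi => by simp [ha i hi]
    intro i hi
    rw [Finset.sum_eq_zero fun i hi => by simp [ha i hi], ha i hi, hN0]
    simp
  · have hden' : den = d := by simp [hden, h0]
    -- Scaled by `d`, the vector `v` becomes the unnormalized Householder vector, the column plus s
    -- N at row `o`. The remaining computation can then avoid divisions by `d`.
    have hvd : ∀ i ∈ Finset.Ico o μ, v i * d = a i + if i = o then s * N else 0 := by
      intro i hi
      rw [hv i hi, hden']
      split_ifs with h
      · rw [h, hd, one_mul]
      · rw [div_mul_cancel₀ _ h0, add_zero]
    have hsum : ∀ w : ℕ → ℂ, star d * ∑ i ∈ Finset.Ico o μ, star (v i) * w i =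
        (∑ i ∈ Finset.Ico o μ, star (a i) * w i) + star s * N * w o := by
      intro w
      have : ∀ i ∈ Finset.Ico o μ, star d * (star (v i) * w i) =
          star (a i) * w i + if i = o then star s * N * w o else 0 := by
        intro i hi
        have := congrArg star (hvd i hi)
        rw [star_mul'] at this
        rw [← mul_assoc, mul_comm (star d), this, star_add, add_mul]
        split_ifs with h
        · rw [star_mul', hNs, h]
        · simp
      rw [Finset.mul_sum, Finset.sum_congr rfl this, Finset.sum_add_distrib,
        Finset.sum_ite_eq' _ _ _, if_pos ho']
    have h1 : star d * ∑ i ∈ Finset.Ico o μ, star (v i) * a i = N * N + star s * N * a o := by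
      rw [hsum, hN]
    have h2 : star d * vv * d = 2 * (N * N + star s * N * a o) := by
      have h3 : ∑ i ∈ Finset.Ico o μ, star (a i) * (v i * d) = N * N + star (a o) * (s * N) := by
        rw [Finset.sum_congr rfl fun i hi => by rw [hvd i hi, mul_add, mul_ite, mul_zero],
          Finset.sum_add_distrib, Finset.sum_ite_eq' _ _ _, if_pos ho', hN]
      have h4 : v o * d = a o + s * N := by simpa using hvd o ho'
      have h5 : star d * vv * d = star d * ∑ i ∈ Finset.Ico o μ, star (v i) * (v i * d) := by
        rw [hvv, mul_assoc, Finset.sum_mul]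
        congr 1
        exact Finset.sum_congr rfl fun i _ => by ring
      rw [h5, hsum, h3, h4]
      linear_combination N * N * hss - N * hsa
    -- So the reflection subtracts d v from the column, and by `hvd` only -s N at row `o` is left.
    have h3 : 2 / vv * ∑ i ∈ Finset.Ico o μ, star (v i) * a i = d := by
      have hsd : star d ≠ 0 := by simpa using h0
      rw [div_mul_eq_mul_div, div_eq_iff hvv0]
      apply mul_left_cancel₀ hsd
      linear_combination 2 * h1 - h2
    intro i hi
    rw [h3, mul_comm, hvd i hi]
    split_ifs <;> ring

/-- Freedom from faults: the square root is taken of a sum of squared moduli, `den` is replaced by 1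
when it would vanish, and the squared norm of `v` is at least 1 because its entry at row `o` is 1.
The phase of `a o` is factored out of d = s (|a o| + N) to see that d = 0 forces N = 0, that is, a
zero column. -/
theorem house_spec {μ o : ℕ} (ho : o < μ) (a : ℕ → ℂ) :
    ∃ v τ β, (house (W := fun _ => ℂ) p μ o a).value = some (v, τ, β) ∧ (∀ i < o, v i = 0) ∧
      v o = 1 ∧ τ * ∑ i ∈ Finset.Ico o μ, star (v i) * v i = 2 ∧ star τ = τ ∧
      ∀ i ∈ Finset.Ico o μ, a i - τ * (∑ i ∈ Finset.Ico o μ, star (v i) * a i) * v i =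
        if i = o then β else 0 := by
  set N2 : ℝ := ∑ i ∈ Finset.Ico o μ, ‖a i‖ ^ 2 with hN2
  have hN20 : 0 ≤ N2 := Finset.sum_nonneg fun i _ => sq_nonneg _
  set N : ℂ := ((Real.sqrt N2 : ℝ) : ℂ) with hN
  set s := csgn (a o) with hs
  set d := a o + s * N with hd
  set den := if d = 0 then (1 : ℂ) else d with hden
  set v : ℕ → ℂ := fun i => if (o + 1 ≤ i ∧ i < μ) then a i / den else if i = o then 1 else 0 with hv
  set vv := ∑ i ∈ Finset.Ico o μ, star (v i) * v i with hvv
  have hden0 : den ≠ 0 := by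
    rw [hden]
    split_ifs with h
    · exact one_ne_zero
    · exact h
  have ho' : o ∈ Finset.Ico o μ := by simp [ho]
  have hvo : v o = 1 := by simp [hv]
  have hvv0 : vv ≠ 0 := by
    rw [hvv, sum_star_mul_self]
    have : (1 : ℝ) ≤ ∑ i ∈ Finset.Ico o μ, ‖v i‖ ^ 2 := by
      calc (1 : ℝ) = ‖v o‖ ^ 2 := by simp [hvo]
        _ ≤ _ := Finset.single_le_sum (f := fun i => ‖v i‖ ^ 2) (fun i _ => sq_nonneg _) ho'
    have h2 : (∑ i ∈ Finset.Ico o μ, ‖v i‖ ^ 2 : ℝ) ≠ 0 := by linarith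
    exact_mod_cast h2
  have hNN : N * N = ∑ i ∈ Finset.Ico o μ, star (a i) * a i := by
    rw [sum_star_mul_self, ← Complex.ofReal_mul, Real.mul_self_sqrt hN20]
  refine ⟨v, 2 / vv, 0 - s * N, ?_, ?_, hvo, div_mul_cancel₀ _ hvv0, ?_, ?_⟩
  · rw [house, value_bind_of (value_zero p), value_bind_of (value_one p),
      value_bind_of (value_adj p o μ 1 _), value_bind_of (value_dot p _ _ _), sum_map_Ico]
    have e1 : ∑ k ∈ Finset.Ico o μ,
        overwrite (rect 0 1 o μ) (fun i j => star (a j)) (fun _ _ => 0) 0 k * a k = (N2 : ℂ) := by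
      rw [hN2, ← sum_star_mul_self]
      refine Finset.sum_congr rfl fun i hi => ?_
      simp only [Finset.mem_Ico] at hi
      simp [overwrite_apply, hi]
    rw [e1, value_bind_of (value_sqrt p _ hN20), value_bind_of (value_sgn p _),
      value_bind_of (value_mul p _ _), value_bind_of (value_add p _ _),
      value_bind_of (value_ifz p _ _ _),
      value_bind_of (value_fill p _ _ (fun i _ => a i / den) _ fun i j _ => value_div p _ _ hden0),
      value_bind_of (value_adj p o μ 1 _), value_bind_of (value_dot p _ _ _), sum_map_Ico]
    have e2 : (fun i => overwrite (rect (o + 1) μ 0 1) (fun i _ => a i / den)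
        (fun i _ => if i = o then (1 : ℂ) else 0) i 0) = v := by
      funext i
      simp [overwrite_apply, hv]
    have e2' : ∀ i, overwrite (rect (o + 1) μ 0 1) (fun i _ => a i / den)
        (fun i _ => if i = o then (1 : ℂ) else 0) i 0 = v i := fun i => congrFun e2 i
    have e3 : ∑ k ∈ Finset.Ico o μ, overwrite (rect 0 1 o μ) (fun i j => star
        (overwrite (rect (o + 1) μ 0 1) (fun i _ => a i / den)
        (fun i _ => if i = o then (1 : ℂ) else 0) j i)) (fun _ _ => 0) 0 k *
        overwrite (rect (o + 1) μ 0 1) (fun i _ => a i / den)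
        (fun i _ => if i = o then (1 : ℂ) else 0) k 0 = vv := by
      refine Finset.sum_congr rfl fun i hi => ?_
      rw [e2', overwrite_apply, e2', if_pos]
      simp only [Finset.mem_Ico] at hi
      simp [hi]
    rw [e3, value_bind_of (value_add p _ _), value_bind_of (value_div p _ _ hvv0),
      value_bind_of (value_sub p _ _), value_pure, e2, one_add_one_eq_two]
  · intro i hi
    have h1 : ¬ (o + 1 ≤ i ∧ i < μ) := by omega
    have h2 : i ≠ o := by omega
    change (if _ then _ else _) = _
    rw [if_neg h1, if_neg h2]
  · rw [hvv, sum_star_mul_self]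
    simp
  · rw [zero_sub]
    refine reflector_aux ho a v N s d den vv hNN ?_ (star_csgn_mul _) ?_ hd ?_ hden ?_ hvv hvv0
    · exact Complex.conj_ofReal _
    · rw [← csgn_mul_norm (a o)]
      simp only [star_mul', ← hs]
      have : star ((‖a o‖ : ℝ) : ℂ) = ‖a o‖ := Complex.conj_ofReal _
      rw [this]
      ring
    · intro h0
      have h1 : s * ((‖a o‖ : ℂ) + N) = 0 := by
        rw [mul_add, csgn_mul_norm, ← hd, h0]
      have hs0 : s ≠ 0 := by
        have : ‖s‖ = 1 := norm_csgn _
        intro h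
        simp [h] at this
      have h2 : ‖a o‖ + Real.sqrt N2 = 0 := by
        have := (mul_eq_zero.1 h1).resolve_left hs0
        rw [hN] at this
        exact_mod_cast this
      have h3 : Real.sqrt N2 = 0 := by
        have := Real.sqrt_nonneg N2
        have := norm_nonneg (a o)
        linarith
      have h4 : N2 = 0 := (Real.sqrt_eq_zero hN20).1 h3
      intro i hi
      have := (Finset.sum_eq_zero_iff_of_nonneg fun i _ => sq_nonneg ‖a i‖).1 h4 i hi
      simpa using this
    · intro i hi
      simp only [Finset.mem_Ico] at hi
      by_cases h : i = o
      · simp [hv, h]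
      · have : o + 1 ≤ i ∧ i < μ := by omega
        change (if _ then _ else _) = _
        rw [if_pos this, if_neg h]

/-- One step is `IsHQR.compose` with a first block of width 1: a reflector, followed by the
decomposition of the remaining columns from row `o + 1` on. The kernel of the reflector is real, so
its adjoint can be dropped from the update. -/
theorem localQR_spec (μ ν : ℕ) : ∀ (o : ℕ) (A : Arr ℂ), o + ν ≤ μ →
    ∃ F, (localQR (W := fun _ => ℂ) p μ ν o A).value = some F ∧
      IsHQR (Fin.val : Fin μ → ℕ) o ν (tall ν fun i => A i) (tall ν fun i => F.V i) (square ν F.T)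
        (square ν F.R) := by
  induction ν with
  | zero =>
    intro o A _
    refine ⟨⟨fun _ _ => 0, fun _ _ => 0, fun _ _ => 0⟩, ?_, isHQR_zero _ _ _ _ _ _⟩
    rw [localQR, value_bind_of (value_blank p), value_pure]
  | succ ν ih =>
    intro o A hμ
    obtain ⟨v, τ, β, hval, hup, hvo, hτ, hτs, hdec⟩ := house_spec p (show o < μ by omega) fun i => A i 0
    set w : Arr ℂ := fun _ j => ∑ k ∈ Finset.Ico o μ, star (v k) * A k (j + 1) with hw
    set B : Arr ℂ := overwrite (rect o μ 0 ν) (fun i j => A i (j + 1) - v i * (τ * w 0 j))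
      fun i j => A i (j + 1) with hB
    obtain ⟨F, hF, H₂⟩ := ih (o + 1) B (by omega)
    set y : Arr ℂ := fun _ j => ∑ k ∈ Finset.Ico (o + 1) μ, star (v k) * F.V k j with hy
    set y' : Arr ℂ := fun _ j => ∑ k ∈ Finset.Ico 0 ν, y 0 k * F.T k j with hy'
    set t : Arr ℂ := overwrite (rect 0 1 0 ν) (fun _ j => 0 - τ * y' 0 j) fun _ _ => 0 with ht
    refine ⟨⟨fun i j => if j = 0 then v i else F.V i (j - 1),
        fun i j => if i = 0 then (if j = 0 then τ else t 0 (j - 1))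
          else if j = 0 then 0 else F.T (i - 1) (j - 1),
        fun i j => if i = 0 then (if j = 0 then β else B o (j - 1))
          else if j = 0 then 0 else F.R (i - 1) (j - 1)⟩, ?_, ?_⟩
    · rw [localQR, value_bind_of (value_blank p), value_bind_of hval]
      dsimp only
      rw [value_bind_of (value_adj p o μ 1 _), value_bind_of (value_mm p _ _ _ _ _),
        value_bind_of (value_fill p _ _ (fun i j => τ * w 0 j) _ ?_),
        value_bind_of (value_fill p _ _ (fun i j => A i (j + 1) - v i * (τ * w 0 j)) _ ?_),
        value_bind_of hF, value_bind_of (value_mm p _ _ _ _ _),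
        value_bind_of (value_mm p _ _ _ _ _),
        value_bind_of (value_fill p _ _ (fun i j => 0 - τ * y' 0 j) _ ?_), value_pure]
      · intro i j hij
        simp only [mem_rect] at hij
        rw [value_bind_of (value_mul p _ _), value_sub, overwrite_apply, if_pos (by simpa using hij)]
        refine congrArg (fun z => some (0 - τ * z)) (Finset.sum_congr rfl fun k hk => ?_)
        simp only [Finset.mem_Ico] at hk
        rw [overwrite_apply, if_pos (by simp; omega)]
        refine congrArg (· * F.T k j) (Finset.sum_congr rfl fun l hl => ?_)
        simp only [Finset.mem_Ico] at hl
        rw [overwrite_apply, if_pos (by simp; omega)]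
      · intro i j hij
        simp only [mem_rect] at hij
        rw [value_bind_of (value_mul p _ _), value_sub, overwrite_apply, if_pos (by simp; omega)]
      · intro i j hij
        simp only [mem_rect] at hij
        rw [value_mul, overwrite_apply, if_pos (by simp; omega)]
        refine congrArg (fun z => some (τ * z)) (Finset.sum_congr rfl fun l hl => ?_)
        simp only [Finset.mem_Ico] at hl
        rw [overwrite_apply, if_pos (by simp; omega)]
    · have H₁ : IsHQR (Fin.val : Fin μ → ℕ) o 1 (Matrix.of fun i _ => A i 0)
          (Matrix.of fun i _ => v i) (Matrix.of fun _ _ => τ) (Matrix.of fun _ _ => β) := by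
        refine isHQR_reflector (fun i hi => hup i hi) (fun i hi => by rw [hi, hvo]) ?_ hτs ?_
        · rw [sum_fin_eq_sum_Ico (fun i => star (v i) * v i) fun i hi => by simp [hup i hi]]
          exact hτ
        · intro i hi
          rw [sum_fin_eq_sum_Ico (fun i => star (v i) * A i 0) fun i hi => by simp [hup i hi]]
          exact hdec i (by simp [hi])
      have hsum : ∀ j, ∑ i : Fin μ, star (v i) * A i (j + 1) = w 0 j := fun j =>
        sum_fin_eq_sum_Ico (fun i => star (v i) * A i (j + 1)) fun i hi => by simp [hup i hi]
      have hsum' : ∀ j < ν, ∑ i : Fin μ, star (v i) * F.V i j = y 0 j := fun j hj => by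
        refine sum_fin_eq_sum_Ico (fun i => star (v i) * F.V i j) fun i hi => ?_
        have := H₂.basis_upper ⟨i, by omega⟩ ⟨j, hj⟩ (by simp; omega)
        simp only [tall, Matrix.of_apply] at this
        rw [this, mul_zero]
      have H := H₁.compose (A₂ := tall ν fun (i : Fin μ) j => A i (j + 1))
        (B₁₂ := Matrix.of fun _ j => B o j) H₂ ?_ ?_
      · rw [Nat.add_comm ν 1]
        convert H using 1
        · refine tall_eq_cols 1 ν _ (fun (i : Fin μ) _ => A i 0) (fun (i : Fin μ) j => A i (j + 1))
            (fun i j hj => ?_) fun i j hj => ?_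
          · rw [show j = 0 by omega]
          · rw [add_comm]
        · refine tall_eq_cols 1 ν _ (fun (i : Fin μ) _ => v i) (fun (i : Fin μ) => F.V i)
            (fun i j hj => ?_) fun i j hj => ?_
          · simp [show j = 0 by omega]
          · simp
        · rw [square_eq_blocks 1 ν (fun _ _ => τ) (fun _ j => t 0 j) (fun _ _ => 0) F.T]
          · congr 1
            ext i j
            simp only [Matrix.neg_apply, Matrix.mul_apply, Matrix.of_apply, Finset.univ_unique,
              Finset.sum_singleton, Matrix.conjTranspose_apply, tall, square, ht]
            rw [overwrite_apply, if_pos (by simp), zero_sub]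
            congr 2
            rw [hy']
            dsimp only
            rw [← sum_fin_eq_sum_Ico (fun k => y 0 k * F.T k j) (by simp)]
            exact Finset.sum_congr rfl fun k _ => by rw [hsum' k k.2]
          · intro i hi j hj
            simp [show i = 0 by omega, show j = 0 by omega]
          · intro i hi j hj
            simp [show i = 0 by omega]
          · intro i hi j hj
            simp [show j = 0 by omega]
          · intro i hi j hj
            simp
        · rw [square_eq_blocks 1 ν (fun _ _ => β) (fun _ j => B o j) (fun _ _ => 0) F.R]
          · rfl
          · intro i hi j hj
            simp [show i = 0 by omega, show j = 0 by omega]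
          · intro i hi j hj
            simp [show i = 0 by omega]
          · intro i hi j hj
            simp [show j = 0 by omega]
          · intro i hi j hj
            simp
      · ext i j
        rw [mask_mul_apply, mask_mul_apply]
        split_ifs with hi
        · simp only [Matrix.sub_apply, Matrix.mul_apply, Matrix.of_apply, Finset.univ_unique,
            Finset.sum_singleton, Matrix.conjTranspose_apply, tall, hτs, hsum, hB]
          rw [overwrite_apply, if_pos (by simp [hi])]
        · rfl
      · intro i a j hi
        simp [tall, hi]

/-- The result of `applyQ`. -/
theorem applyQ_spec {μ n o : ℕ} (V T B : Arr ℂ) (hV : ∀ i < o, ∀ j < n, V i j = 0) :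
    ∃ X, (applyQ (W := fun _ => ℂ) p μ n o V T B).value = some X ∧
      tall n (fun i : Fin μ => X i) =
        (1 - tall n (fun i : Fin μ => V i) * square n T * (tall n fun i : Fin μ => V i)ᴴ) *
          (embed (Fin.val : Fin μ → ℕ) o n * square n B) := by
  set C : Arr ℂ := fun i j => if o ≤ i ∧ i < o + n then B (i - o) j else 0 with hC
  refine ⟨overwrite (rect o μ 0 n) (fun i j => C i j - ∑ k ∈ Finset.Ico 0 n, V i k *
    ∑ l ∈ Finset.Ico 0 n, T k l * ∑ i ∈ Finset.Ico o μ, star (V i l) * C i j) fun _ _ => 0, ?_, ?_⟩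
  · rw [applyQ, value_bind_of (value_blank p)]
    dsimp only
    rw [value_bind_of (value_adj p o μ n _), value_bind_of (value_mm p _ _ _ _ _),
      value_bind_of (value_mm p _ _ _ _ _), value_bind_of (value_mm p _ _ _ _ _)]
    refine value_fill p _ _ _ _ fun i j hij => ?_
    simp only [mem_rect] at hij
    rw [value_sub, overwrite_apply, if_pos (show (i, j) ∈ rect o μ 0 n by simpa using hij)]
    refine congrArg (fun z => some (C i j - z)) (Finset.sum_congr rfl fun k hk => ?_)
    simp only [Finset.mem_Ico] at hk
    rw [overwrite_apply, if_pos (by simp; omega)]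
    refine congrArg (V i k * ·) (Finset.sum_congr rfl fun l hl => ?_)
    simp only [Finset.mem_Ico] at hl
    rw [overwrite_apply, if_pos (by simp; omega)]
    refine congrArg (T k l * ·) (Finset.sum_congr rfl fun r hr => ?_)
    simp only [Finset.mem_Ico] at hr
    rw [overwrite_apply, if_pos (by simp; omega)]
  · have hEB : embed (Fin.val : Fin μ → ℕ) o n * square n B = tall n fun i : Fin μ => C i := by
      ext i j
      by_cases hi : o ≤ (i : ℕ) ∧ (i : ℕ) < o + n
      · rw [embed_mul_apply_of_eq _ o n _ ⟨i - o, by omega⟩ (by simp; omega)]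
        simp [square, tall, hC, hi]
      · rw [embed_mul_apply_of_ne _ o n _ fun a => by omega]
        simp [tall, hC, hi]
    rw [hEB, Matrix.sub_mul, Matrix.one_mul, Matrix.mul_assoc, Matrix.mul_assoc]
    ext i j
    simp only [Matrix.sub_apply, Matrix.mul_apply, Matrix.conjTranspose_apply, tall, square,
      Matrix.of_apply]
    rw [overwrite_apply]
    by_cases hi : o ≤ (i : ℕ)
    · rw [if_pos (by simp [hi])]
      congr 1
      rw [← sum_fin_eq_sum_Ico (fun k => V i k * ∑ l ∈ Finset.Ico 0 n, T k l *
        ∑ i ∈ Finset.Ico o μ, star (V i l) * C i j) (by simp)]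
      refine Finset.sum_congr rfl fun k _ => congrArg (V i k * ·) ?_
      rw [← sum_fin_eq_sum_Ico (fun l => T k l * ∑ i ∈ Finset.Ico o μ, star (V i l) * C i j)
        (by simp)]
      refine Finset.sum_congr rfl fun l _ => congrArg (T k l * ·) ?_
      rw [← sum_fin_eq_sum_Ico (fun i => star (V i l) * C i j) fun i hi => by simp [hV i hi l]]
    · rw [if_neg (by simp [hi])]
      have : ∀ k : Fin n, V i k = 0 := fun k => hV i (by omega) k k.2
      simp [this, hC, hi]

/-- The result of `rightSolve`. -/
theorem rightSolve_spec {r r' n : ℕ} (Y U : Arr ℂ) (hU : ∀ j < n, U j j ≠ 0) :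
    ∃ X, (rightSolve (W := fun _ => ℂ) p r r' n Y U).value = some X ∧
      (∀ i, r ≤ i → i < r' → ∀ j < n, ∑ k ∈ Finset.range (j + 1), X i k * U k j = Y i j) ∧
      ∀ i, ¬ (r ≤ i ∧ i < r') → ∀ j, X i j = 0 := by
  rw [rightSolve, value_bind_of (value_blank p)]
  induction n with
  | zero => exact ⟨fun _ _ => 0, by simp, by simp, by simp⟩
  | succ n ih =>
    obtain ⟨X, hX, h1, h2⟩ := ih fun j hj => hU j (by omega)
    have hn := hU n (by omega)
    set g : Arr ℂ := fun i j => (Y i j - ∑ k ∈ Finset.range j, X i k * U k j) / U j j with hg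
    refine ⟨overwrite (rect r r' n (n + 1)) g X, ?_, ?_, ?_⟩
    · rw [List.range_succ, List.foldlM_append, value_bind_of hX, List.foldlM_cons]
      simp only [List.foldlM_nil, bind_pure]
      refine value_fill p _ _ _ _ fun i j hij => ?_
      simp only [mem_rect] at hij
      obtain rfl : j = n := by omega
      rw [value_bind_of (value_dot p _ _ _), value_bind_of (value_sub p _ _), value_div p _ _ hn,
        sum_map_range]
    · intro i hi hi' j hj
      by_cases hjn : j = n
      · subst hjn
        rw [Finset.sum_range_succ, overwrite_apply, if_pos (by simp [hi, hi'])]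
        rw [Finset.sum_congr rfl fun k hk => by
          rw [overwrite_apply, if_neg (by simp at hk ⊢; omega)]]
        simp only [hg]
        rw [div_mul_cancel₀ _ hn]
        ring
      · rw [← h1 i hi hi' j (by omega)]
        refine Finset.sum_congr rfl fun k hk => ?_
        rw [overwrite_apply, if_neg (by simp at hk ⊢; omega)]
    · intro i hi j
      rw [overwrite_apply, if_neg (by simp; omega), h2 i hi j]

/-- The state of `signLU` after `t` columns. -/
structure SignLUState (n : ℕ) (X : Arr ℂ) (t : ℕ) (Y : Arr ℂ) (S : ℕ → ℂ) : Prop where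
  sign : ∀ j < t, star (S j) * S j = 1
  pivot : ∀ j < t, Y j j ≠ 0
  done : ∀ a < n, ∀ b < n, min a b < t → X a b + (if a = b then S a else 0) =
    (∑ k ∈ Finset.range (min a b), Y a k * Y k b) + (if a ≤ b then Y a b else Y a b * Y b b)
  rest : ∀ a < n, ∀ b < n, t ≤ min a b → X a b = (∑ k ∈ Finset.range t, Y a k * Y k b) + Y a b

/-- Entries whose row or column index is below `t` already belong to the final factors, while the
others form the current Schur complement. Adding the sign to the pivot just before it is used
changes the factored matrix only at that diagonal entry, so the result factors X + diag S. -/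
theorem SignLUState.step {n t : ℕ} {X Y : Arr ℂ} {S : ℕ → ℂ} (H : SignLUState n X t Y S)
    (ht : t < n) {s d : ℂ} (hs : star s * s = 1) (hd : d = Y t t + s) (hd0 : d ≠ 0) {Y' : Arr ℂ}
    (h1 : Y' t t = d) (h2 : ∀ i, t < i → i < n → Y' i t = Y i t / d)
    (h3 : ∀ i, t < i → i < n → ∀ c, t < c → c < n → Y' i c = Y i c - Y i t / d * Y t c)
    (h4 : ∀ i c, i < t ∨ c < t ∨ (i = t ∧ t < c) → Y' i c = Y i c) :
    SignLUState n X (t + 1) Y' (Function.update S t s) := by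
  have hsum : ∀ a b, ∑ k ∈ Finset.range t, Y' a k * Y' k b = ∑ k ∈ Finset.range t, Y a k * Y k b := by
    intro a b
    refine Finset.sum_congr rfl fun k hk => ?_
    have hk := Finset.mem_range.1 hk
    rw [h4 a k (by omega), h4 k b (by omega)]
  refine ⟨?_, ?_, ?_, ?_⟩
  · intro j hj
    by_cases h : j = t
    · subst h; simpa using hs
    · simpa [h] using H.sign j (by omega)
  · intro j hj
    by_cases h : j = t
    · subst h; rwa [h1]
    · rw [h4 j j (by omega)]
      exact H.pivot j (by omega)
  · intro a ha b hb hab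
    by_cases h : min a b < t
    · have hS : (if a = b then Function.update S t s a else 0) = if a = b then S a else 0 := by
        split_ifs with e
        · rw [Function.update_of_ne (by omega)]
        · rfl
      rw [hS, H.done a ha b hb h]
      congr 1
      · refine Finset.sum_congr rfl fun k hk => ?_
        have hk := Finset.mem_range.1 hk
        rw [h4 a k (by omega), h4 k b (by omega)]
      · rw [h4 a b (by omega)]
        split_ifs
        · rfl
        · rw [h4 b b (by omega)]
    · have hm : min a b = t := by omega
      rw [hm, hsum, H.rest a ha b hb (by omega)]
      rcases lt_trichotomy a b with hlt | rfl | hlt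
      · obtain rfl : a = t := by omega
        rw [if_neg hlt.ne, if_pos hlt.le, h4 a b (by omega)]
        ring
      · obtain rfl : a = t := by omega
        rw [if_pos rfl, if_pos le_rfl, h1, hd, Function.update_self]
        ring
      · obtain rfl : b = t := by omega
        rw [if_neg hlt.ne', if_neg (by omega), h1, h2 a hlt ha, div_mul_cancel₀ _ hd0]
        ring
  · intro a ha b hb hab
    rw [Finset.sum_range_succ, hsum, H.rest a ha b hb (by omega), h2 a (by omega) ha,
      h4 t b (by omega), h3 a (by omega) ha b (by omega) hb]
    ring

/-- The sign points in the direction of z, so the modulus of the sum is |z| + 1. The sign-modified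
elimination therefore succeeds on every matrix, without any appeal to orthonormal columns. -/
theorem add_csgn_ne_zero (z : ℂ) : z + csgn z ≠ 0 := by
  have h : z + csgn z = csgn z * ((‖z‖ + 1 : ℝ) : ℂ) := by
    push_cast
    rw [mul_add, csgn_mul_norm, mul_one]
  rw [h]
  refine mul_ne_zero (fun h => ?_) ?_
  · have := norm_csgn z
    simp [h] at this
  · have : ‖z‖ + 1 ≠ 0 := by positivity
    exact_mod_cast this

/-- The result of `signLU`. -/
theorem signLU_spec (n : ℕ) (X : Arr ℂ) :
    ∃ Y S, (signLU (W := fun _ => ℂ) p n X).value = some (Y, S) ∧ SignLUState n X n Y S := by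
  rw [signLU, value_bind_of (value_zero p)]
  suffices H : ∀ t ≤ n, ∃ Y S, ((List.range t).foldlM
      (fun (st : Arr ℂ × (ℕ → ℂ)) j => do
        let (Y, S) := st
        let s ← sgn (W := fun _ => ℂ) p (Y j j)
        let d ← add p (Y j j) s
        let Y1 ← fill p (rect (j + 1) n j (j + 1)) (fun i c => div p (Y i c) d) Y
        let Y2 ← fill p (rect (j + 1) n (j + 1) n) (fun i c => do
          let t ← mul p (Y1 i j) (Y1 j c)
          sub p (Y1 i c) t) Y1
        return (fun i c => if i = j ∧ c = j then d else Y2 i c, Function.update S j s))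
        (X, fun _ => (0 : ℂ))).value = some (Y, S) ∧ SignLUState n X t Y S by
    exact H n le_rfl
  intro t
  induction t with
  | zero =>
    intro _
    exact ⟨X, fun _ => 0, by simp, by simp, by simp, by simp, by simp⟩
  | succ t ih =>
    intro ht
    obtain ⟨Y, S, hY, H⟩ := ih (by omega)
    set s := csgn (Y t t) with hs
    set d := Y t t + s with hd
    have hd0 : d ≠ 0 := add_csgn_ne_zero _
    set Y1 : Arr ℂ := overwrite (rect (t + 1) n t (t + 1)) (fun i c => Y i c / d) Y with hY1
    set Y2 : Arr ℂ := overwrite (rect (t + 1) n (t + 1) n) (fun i c => Y1 i c - Y1 i t * Y1 t c) Y1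
      with hY2
    refine ⟨fun i c => if i = t ∧ c = t then d else Y2 i c, Function.update S t s, ?_, ?_⟩
    · rw [List.range_succ, List.foldlM_append, value_bind_of hY, List.foldlM_cons]
      simp only [List.foldlM_nil, bind_pure]
      rw [value_bind_of (value_sgn p _), value_bind_of (value_add p _ _),
        value_bind_of (value_fill p _ _ (fun i c => Y i c / d) _ fun i c _ => value_div p _ _ hd0),
        value_bind_of (value_fill p _ _ (fun i c => Y1 i c - Y1 i t * Y1 t c) _ fun i c _ => by
          rw [value_bind_of (value_mul p _ _), value_sub]), value_pure]
    · have e1 : ∀ i, t < i → i < n → Y1 i t = Y i t / d := fun i hi hi' => by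
        rw [hY1, overwrite_apply, if_pos (by simp; omega)]
      have e2 : ∀ i c, (i ≤ t ∨ c ≠ t) → Y1 i c = Y i c := fun i c h => by
        rw [hY1, overwrite_apply, if_neg (by simp; omega)]
      refine H.step ht (star_csgn_mul _) hd hd0 (by simp) ?_ ?_ ?_
      · intro i hi hi'
        rw [if_neg (by omega), hY2, overwrite_apply, if_neg (by simp), e1 i hi hi']
      · intro i hi hi' c hc hc'
        rw [if_neg (by omega), hY2, overwrite_apply, if_pos (by simp; omega), e1 i hi hi',
          e2 t c (by omega), e2 i c (by omega)]
      · intro i c h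
        rw [if_neg (by omega), hY2, overwrite_apply, if_neg (by simp; omega), e2 i c (by omega)]

end Local

/-! ### Costs of the local programs -/

section LocalCost

variable {P : ℕ} {p : Fin P} {α β : Type}

/-- At most `a` operations, all on processor `p`. -/
def LocalCost (p : Fin P) (x : Par P (fun _ => ℂ) α) (a : ℕ) : Prop := Cost {p} x (a, 0, 0)

theorem LocalCost.bind {x : Par P (fun _ => ℂ) α} {f : α → Par P (fun _ => ℂ) β} {a b : ℕ}
    (hx : LocalCost p x a) (hf : ∀ y, LocalCost p (f y) b) : LocalCost p (x >>= f) (a + b) := by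
  have := Cost.bind hx hf
  unfold LocalCost
  simpa using this

theorem LocalCost.pure (y : α) : LocalCost p (pure y) 0 := Cost.pure y

theorem LocalCost.le {x : Par P (fun _ => ℂ) α} {a b : ℕ} (hx : LocalCost p x a) (h : a ≤ b) :
    LocalCost p x b := Cost.le hx (by simpa [Prod.le_def] using h)

theorem localCost_op (o : Oper ℂ) : LocalCost p (Par.op (W := fun _ => ℂ) p o Par.ret) 1 :=
  cost_op p o

theorem localCost_foldlM {ι : Type} (L : List ι) {f : α → ι → Par P (fun _ => ℂ) α} {c : ℕ}
    (h : ∀ a, ∀ i ∈ L, LocalCost p (f a i) c) (a : α) :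
    LocalCost p (L.foldlM f a) (L.length * c) := by
  have := cost_foldlM L h a
  unfold LocalCost
  simpa using this

theorem localCost_fill (S : List (ℕ × ℕ)) {f : ℕ → ℕ → Par P (fun _ => ℂ) ℂ} {c : ℕ}
    (h : ∀ i j, (i, j) ∈ S → LocalCost p (f i j) c) (Y : Arr ℂ) :
    LocalCost p (fill p S f Y) (S.length * c) :=
  localCost_foldlM S (fun _ i hi => (LocalCost.bind (h i.1 i.2 hi) fun _ => LocalCost.pure _)) Y

theorem localCost_dot (ks : List ℕ) (f g : ℕ → ℂ) :
    LocalCost p (dot (W := fun _ => ℂ) p ks f g) (1 + ks.length * 2) :=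
  LocalCost.bind (localCost_op _) fun _ => localCost_foldlM ks (c := 2)
    (fun _ _ _ => LocalCost.bind (localCost_op _) fun _ => localCost_op _) _

theorem localCost_mm (S : List (ℕ × ℕ)) (ks : List ℕ) (X Y : Arr ℂ) :
    LocalCost p (mm (W := fun _ => ℂ) p S ks X Y) (1 + S.length * (1 + ks.length * 2)) :=
  LocalCost.bind (LocalCost.bind (localCost_op _) fun _ => LocalCost.pure _) fun _ =>
    localCost_fill S (fun _ _ _ => localCost_dot ks _ _) _

theorem localCost_blank : LocalCost p (blank (W := fun _ => ℂ) p) 1 :=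
  LocalCost.bind (localCost_op _) fun _ => LocalCost.pure _

theorem length_rect (r r' c c' : ℕ) : (rect r r' c c').length = (r' - r) * (c' - c) := by
  exact (List.length_product _ _).trans (by simp)

theorem length_tri_le (n : ℕ) : (tri n).length ≤ n * n := by
  unfold tri
  refine (List.length_filter_le _ _).trans ?_
  simp [length_rect]

theorem localCost_adj (r r' c : ℕ) (X : Arr ℂ) :
    LocalCost p (adj (W := fun _ => ℂ) p r r' c X) (1 + c * (r' - r)) := by
  refine LocalCost.le (LocalCost.bind localCost_blank fun _ =>
    localCost_fill _ (fun _ _ _ => localCost_op _) _) ?_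
  simp [length_rect]

theorem localCost_sgn (z : ℂ) : LocalCost p (sgn (W := fun _ => ℂ) p z) 7 :=
  LocalCost.bind (localCost_op _) fun _ => LocalCost.bind (localCost_op _) fun _ =>
  LocalCost.bind (localCost_op _) fun _ => LocalCost.bind (localCost_op _) fun _ =>
  LocalCost.bind (localCost_op _) fun _ => LocalCost.bind (localCost_op _) fun _ => localCost_op _

theorem localCost_house {μ : ℕ} (hμ : 1 ≤ μ) (o : ℕ) (a : ℕ → ℂ) :
    LocalCost p (house (W := fun _ => ℂ) p μ o a) (30 * μ) := by
  refine LocalCost.le (LocalCost.bind (localCost_op _) fun _ => LocalCost.bind (localCost_op _) fun _ =>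
    LocalCost.bind (localCost_adj _ _ _ _) fun _ => LocalCost.bind (localCost_dot _ _ _) fun _ =>
    LocalCost.bind (localCost_op _) fun _ => LocalCost.bind (localCost_sgn _) fun _ =>
    LocalCost.bind (localCost_op _) fun _ => LocalCost.bind (localCost_op _) fun _ =>
    LocalCost.bind (localCost_op _) fun _ =>
    LocalCost.bind (localCost_fill _ (fun _ _ _ => localCost_op _) _) fun _ =>
    LocalCost.bind (localCost_adj _ _ _ _) fun _ => LocalCost.bind (localCost_dot _ _ _) fun _ =>
    LocalCost.bind (localCost_op _) fun _ => LocalCost.bind (localCost_op _) fun _ =>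
    LocalCost.bind (localCost_op _) fun _ => LocalCost.pure _) ?_
  simp only [length_rect, List.Ico.length]
  omega

theorem localCost_localQR {μ : ℕ} (hμ : 1 ≤ μ) (ν : ℕ) : ∀ (o : ℕ) (A : Arr ℂ), ν ≤ μ →
    LocalCost p (localQR (W := fun _ => ℂ) p μ ν o A) (1 + 40 * μ * ν ^ 2) := by
  induction ν with
  | zero =>
    intro o A _
    exact LocalCost.bind localCost_blank fun _ => LocalCost.pure _
  | succ ν ih =>
    intro o A hν
    refine LocalCost.le (LocalCost.bind localCost_blank fun _ =>
      LocalCost.bind (localCost_house hμ o _) fun ⟨_, _, _⟩ =>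
      LocalCost.bind (localCost_adj _ _ _ _) fun _ => LocalCost.bind (localCost_mm _ _ _ _) fun _ =>
      LocalCost.bind (localCost_fill _ (fun _ _ _ => localCost_op _) _) fun _ =>
      LocalCost.bind (localCost_fill _ (fun _ _ _ => LocalCost.bind (localCost_op _) fun _ =>
        localCost_op _) _) fun _ =>
      LocalCost.bind (ih (o + 1) _ (by omega)) fun _ =>
      LocalCost.bind (localCost_mm _ _ _ _) fun _ => LocalCost.bind (localCost_mm _ _ _ _) fun _ =>
      LocalCost.bind (localCost_fill _ (fun _ _ _ => LocalCost.bind (localCost_op _) fun _ =>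
        localCost_op _) _) fun _ => LocalCost.pure _) ?_
    simp only [length_rect, List.Ico.length]
    have h1 : μ - o ≤ μ := Nat.sub_le _ _
    have h2 : μ - (o + 1) ≤ μ := Nat.sub_le _ _
    generalize μ - o = d at *
    generalize μ - (o + 1) = e at *
    have h3 : ν * d ≤ ν * μ := Nat.mul_le_mul_left _ h1
    have h4 : ν * e ≤ ν * μ := Nat.mul_le_mul_left _ h2
    have h5 : ν * ν ≤ ν * μ := Nat.mul_le_mul_left _ (by omega)
    have h6 : ν * 1 ≤ ν * μ := Nat.mul_le_mul_left _ hμ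
    -- The increment 80 ν μ + 40 μ of the bound pays for the reflector, its application to the ν
    -- other columns and the new row of the kernel.
    have e1 : 40 * μ * (ν + 1) ^ 2 = 40 * μ * ν ^ 2 + 80 * (ν * μ) + 40 * μ := by ring
    rw [e1]
    simp only [Nat.sub_zero, one_mul, Nat.mul_add]
    have e2 : d * ν = ν * d := mul_comm _ _
    have e3 : ν * (d * 2) = 2 * (ν * d) := by ring
    have e4 : ν * (e * 2) = 2 * (ν * e) := by ring
    have e5 : ν * (ν * 2) = 2 * (ν * ν) := by ring
    rw [e2, e3, e4, e5]
    omega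

theorem localCost_applyQ {μ n : ℕ} (hn : 1 ≤ n) (hμ : n ≤ μ) (o : ℕ) (V T B : Arr ℂ) :
    LocalCost p (applyQ (W := fun _ => ℂ) p μ n o V T B) (20 * μ * n ^ 2) := by
  refine LocalCost.le (LocalCost.bind localCost_blank fun _ =>
    LocalCost.bind (localCost_adj _ _ _ _) fun _ => LocalCost.bind (localCost_mm _ _ _ _) fun _ =>
    LocalCost.bind (localCost_mm _ _ _ _) fun _ => LocalCost.bind (localCost_mm _ _ _ _) fun _ =>
    localCost_fill _ (fun _ _ _ => localCost_op _) _) ?_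
  simp only [length_rect, List.Ico.length, Nat.sub_zero]
  have h1 : μ - o ≤ μ := Nat.sub_le _ _
  generalize μ - o = d at *
  have h0 : 1 * 1 ≤ μ * n ^ 2 := Nat.mul_le_mul (by omega) (Nat.one_le_pow _ _ hn)
  have h2 : n * d ≤ μ * n ^ 2 := by
    rw [mul_comm]
    exact Nat.mul_le_mul h1 (by nlinarith)
  have h3 : n * n * d ≤ μ * n ^ 2 := by
    rw [mul_comm, ← sq]
    exact Nat.mul_le_mul_right _ h1
  have h4 : n * n * n ≤ μ * n ^ 2 := by
    rw [mul_comm, ← sq]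
    exact Nat.mul_le_mul_right _ hμ
  have h5 : n * n ≤ μ * n ^ 2 := by
    rw [← sq]
    exact Nat.le_mul_of_pos_left _ (by omega)
  have e1 : n * n * (1 + d * 2) = n * n + 2 * (n * n * d) := by ring
  have e2 : n * n * (1 + n * 2) = n * n + 2 * (n * n * n) := by ring
  have e3 : d * n * (1 + n * 2) = n * d + 2 * (n * n * d) := by ring
  have e4 : d * n * 1 = n * d := by ring
  have e5 : 20 * μ * n ^ 2 = 20 * (μ * n ^ 2) := by ring
  rw [e1, e2, e3, e4, e5]
  omega

theorem localCost_rightSolve {μ n : ℕ} (hn : 1 ≤ n) (hμ : 1 ≤ μ) {r r' : ℕ} (hr : r' - r ≤ μ)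
    (Y U : Arr ℂ) : LocalCost p (rightSolve (W := fun _ => ℂ) p r r' n Y U) (6 * μ * n ^ 2) := by
  refine LocalCost.le (LocalCost.bind localCost_blank fun _ =>
    localCost_foldlM (c := μ * (3 + 2 * n)) _ (fun X j hj => ?_) _) ?_
  · refine LocalCost.le (localCost_fill _ (c := 3 + 2 * n) (fun i k hk =>
      LocalCost.le (LocalCost.bind (localCost_dot _ _ _) fun _ =>
      LocalCost.bind (localCost_op _) fun _ => localCost_op _) ?_) _) ?_
    · simp only [List.length_range]
      simp only [mem_rect] at hk
      have := List.mem_range.1 hj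
      omega
    · simp only [length_rect]
      gcongr
      calc (r' - r) * (j + 1 - j) = r' - r := by simp
        _ ≤ μ := hr
  · simp only [List.length_range]
    have h1 : 1 ≤ μ * n := Nat.mul_pos (by omega) (by omega)
    nlinarith

theorem localCost_signLU {n : ℕ} (hn : 1 ≤ n) (X : Arr ℂ) :
    LocalCost p (signLU (W := fun _ => ℂ) p n X) (12 * n ^ 3) := by
  refine LocalCost.le (LocalCost.bind (localCost_op _) fun _ =>
    localCost_foldlM (c := 8 + n + 2 * n ^ 2) _ (fun ⟨Y, S⟩ j hj => ?_) _) ?_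
  · simp only [List.length_range]
    have h1 : n ≤ n ^ 3 := Nat.le_self_pow (by norm_num) _
    have h2 : n ^ 2 ≤ n ^ 3 := Nat.pow_le_pow_right hn (by norm_num)
    have e : n * (8 + n + 2 * n ^ 2) = 8 * n + n ^ 2 + 2 * n ^ 3 := by ring
    rw [e]
    omega
  · refine LocalCost.le (LocalCost.bind (localCost_sgn _) fun _ =>
      LocalCost.bind (localCost_op _) fun _ =>
      LocalCost.bind (localCost_fill _ (fun _ _ _ => localCost_op _) _) fun _ =>
      LocalCost.bind (localCost_fill _ (fun _ _ _ => LocalCost.bind (localCost_op _) fun _ =>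
        localCost_op _) _) fun _ => LocalCost.pure _) ?_
    simp only [length_rect]
    have h1 : n - (j + 1) ≤ n := Nat.sub_le _ _
    generalize n - (j + 1) = d at *
    have h2 : d * d ≤ n ^ 2 := by rw [sq]; exact Nat.mul_le_mul h1 h1
    have h3 : j + 1 - j = 1 := by omega
    rw [h3]
    omega

end LocalCost

/-! ### Costs of the collectives -/

section Collectives

variable {P : ℕ} {α β γ : Type}

/-- The shape of one level of a recursion: two calls on disjoint groups, charged once, and then a
joint step that uses both results. -/
theorem Cost.bind_disjoint_bind {S S' T : Set (Fin P)} {x : Par P (fun _ => ℂ) α}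
    {f : α → Par P (fun _ => ℂ) β} {g : α → β → Par P (fun _ => ℂ) γ} {k l : ℕ × ℕ × ℕ}
    (hx : Cost S x k) (hf : ∀ a, Cost S' (f a) k) (hg : ∀ a b, Cost T (g a b) l)
    (hd : Disjoint S S') (hS : S ⊆ T) (hS' : S' ⊆ T) :
    Cost T (x >>= fun a => f a >>= g a) (k + l) := by
  have := ((hx.bind_disjoint (fun a => (hf a).bind_pure (g := fun b => (a, b))) hd).mono
    (Set.union_subset hS hS') le_rfl).bind (f := fun c => g c.1 c.2) fun c => hg c.1 c.2
  simpa only [bind_assoc, pure_bind] using this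

theorem Cost.ite_bind {S : Set (Fin P)} {c : Prop} [Decidable c] {x y : Par P (fun _ => ℂ) α}
    {f : α → Par P (fun _ => ℂ) β} {k : ℕ × ℕ × ℕ} (h : Cost S ((if c then x else y) >>= f) k) :
    Cost S (if c then x >>= f else y >>= f) k := by
  split_ifs at h ⊢ <;> exact h

theorem cost_copyFrom (p q : Fin P) (S : List (ℕ × ℕ)) (X : Dist fun _ : Fin P => ℂ) :
    Cost {p, q} (copyFrom p q S X) (0, 2 * S.length, 2) :=
  (cost_msg p q S _ _).bind_pure

theorem cost_addFrom (p q : Fin P) (S : List (ℕ × ℕ)) (X : Dist fun _ : Fin P => ℂ) :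
    Cost {p, q} (addFrom p q S X) (S.length, 2 * S.length, 2) := by
  refine Cost.le ((cost_msg p q S _ _).bind fun _ => Cost.bind_pure
    (Cost.mono (localCost_fill (p := q) S (fun _ _ _ => localCost_op _) _) (by simp) le_rfl)) ?_
  simp

/-- The processors with numbers `lo, …, lo + k - 1`. -/
def group (P lo k : ℕ) : Set (Fin P) := {p | lo ≤ (p : ℕ) ∧ (p : ℕ) < lo + k}

theorem group_disjoint (lo h k : ℕ) : Disjoint (group P lo h) (group P (lo + h) k) := by
  rw [Set.disjoint_left]
  rintro p ⟨-, h⟩ ⟨h', -⟩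
  omega

theorem group_subset {lo k lo' k' : ℕ} (h : lo' ≤ lo) (h' : lo + k ≤ lo' + k') :
    group P lo k ⊆ group P lo' k' := by
  rintro p ⟨h1, h2⟩
  exact ⟨by omega, by omega⟩

theorem group_zero : group P 0 P = Set.univ := by
  ext p
  simp [group]

theorem mem_share {I J lo hi i j : ℕ} : (i, j) ∈ share P I J lo hi ↔
    i < I ∧ j < J ∧ lo ≤ (i * J + j) % P ∧ (i * J + j) % P < hi := by
  simp [share, and_assoc]

/-- The remainder modulo P of the linear index i J + j is the owner and the quotient is the slot;
the pair determines the entry, and there are at most I J / P + 1 slots. -/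
theorem length_share_le (I J lo hi : ℕ) :
    (share P I J lo hi).length ≤ (hi - lo) * (I * J / P + 1) := by
  have hnd : (share P I J lo hi).Nodup :=
    List.Nodup.filter _ ((List.Ico.nodup _ _).product (List.Ico.nodup _ _))
  rw [← List.toFinset_card_of_nodup hnd]
  calc (share P I J lo hi).toFinset.card
      ≤ (Finset.Ico lo hi ×ˢ Finset.range (I * J / P + 1)).card := by
        refine Finset.card_le_card_of_injOn
          (fun a => ((a.1 * J + a.2) % P, (a.1 * J + a.2) / P)) ?_ ?_
        · rintro ⟨i, j⟩ h
          have h := mem_share.1 (List.mem_toFinset.1 h)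
          have h1 : i * J + j ≤ I * J := by
            calc i * J + j ≤ i * J + J := by omega
              _ = (i + 1) * J := by ring
              _ ≤ I * J := Nat.mul_le_mul_right _ h.1
          have h2 : (i * J + j) / P ≤ I * J / P := Nat.div_le_div_right h1
          simp only [Finset.coe_product, Set.mem_prod, Finset.coe_Ico, Set.mem_Ico,
            Finset.coe_range, Set.mem_Iio]
          exact ⟨⟨h.2.2.1, h.2.2.2⟩, by omega⟩
        · rintro ⟨i, j⟩ h ⟨i', j'⟩ h' e
          have h := mem_share.1 (List.mem_toFinset.1 h)
          have h' := mem_share.1 (List.mem_toFinset.1 h')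
          simp only [Prod.mk.injEq] at e
          have e1 : i * J + j = i' * J + j' := by
            rw [← Nat.div_add_mod (i * J + j) P, ← Nat.div_add_mod (i' * J + j') P, e.1, e.2]
          have e2 : i = i' := by
            have h1 : (j + J * i) / J = i := by
              rw [Nat.add_mul_div_left _ _ (by omega), Nat.div_eq_of_lt h.2.1, zero_add]
            have h2 : (j' + J * i') / J = i' := by
              rw [Nat.add_mul_div_left _ _ (by omega), Nat.div_eq_of_lt h'.2.1, zero_add]
            rw [← h1, ← h2, add_comm, mul_comm, e1, add_comm, mul_comm]
          subst e2
          have : j = j' := by omega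
          rw [this]
    _ = (hi - lo) * (I * J / P + 1) := by simp

theorem clog_half {k : ℕ} (hk : ¬ k ≤ 1) : Nat.clog 2 k = Nat.clog 2 ((k + 1) / 2) + 1 :=
  Nat.clog_of_two_le one_lt_two (by omega)

theorem clog_half' (k : ℕ) : Nat.clog 2 (k / 2) ≤ Nat.clog 2 ((k + 1) / 2) :=
  Nat.clog_mono_right 2 (by omega)

/-- Rounding each processor's share up costs at most P extra words in total. This is the origin of
the term P in the bounds for the collectives. -/
theorem pred_mul_le (P I J : ℕ) : (P - 1) * (I * J / P + 1) ≤ I * J + P := by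
  calc (P - 1) * (I * J / P + 1) ≤ P * (I * J / P + 1) := Nat.mul_le_mul_right _ (Nat.sub_le _ _)
    _ = P * (I * J / P) + P := by ring
    _ ≤ I * J + P := by exact Nat.add_le_add_right (Nat.mul_div_le _ _) _

variable [NeZero P]

theorem proc_val {i : ℕ} (h : i < P) : ((proc i : Fin P) : ℕ) = i := by
  simp [proc, Fin.ofNat, Nat.mod_eq_of_lt h]

theorem proc_eq_iff {i j : ℕ} (h : i < P) (h' : j < P) : (proc i : Fin P) = proc j ↔ i = j := by
  rw [Fin.ext_iff, proc_val h, proc_val h']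

theorem proc_fin (p : Fin P) : proc (p : ℕ) = p := Fin.ext (proc_val p.2)

theorem proc_mem_group {i lo k : ℕ} (hi : i < P) (h : lo ≤ i) (h' : i < lo + k) :
    (proc i : Fin P) ∈ group P lo k := by
  simp only [group, Set.mem_ofPred_eq, proc_val hi]
  exact ⟨h, h'⟩

theorem pair_subset_group {i j lo k : ℕ} (hk : lo + k ≤ P) (hi : lo ≤ i ∧ i < lo + k)
    (hj : lo ≤ j ∧ j < lo + k) : ({proc i, proc j} : Set (Fin P)) ⊆ group P lo k := by
  rintro p (rfl | rfl)
  · exact proc_mem_group (by omega) hi.1 hi.2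
  · exact proc_mem_group (by omega) hj.1 hj.2

/-- The pairs are disjoint, so the loop is charged as a single exchange although its tasks are
listed one pair after the other. -/
theorem cost_exchange {k lo h₁ h₂ : ℕ} (h₂h₁ : h₂ ≤ h₁) (hk : h₁ + h₂ = k) (hP : lo + k ≤ P)
    {f : Dist (fun _ : Fin P => ℂ) → ℕ → Par P (fun _ => ℂ) (Dist fun _ : Fin P => ℂ)}
    {c : ℕ × ℕ × ℕ} (h : ∀ X i, Cost {proc (lo + i), proc (lo + h₁ + i)} (f X i) c)
    (X : Dist fun _ : Fin P => ℂ) : Cost (group P lo k) ((List.range h₂).foldlM f X) c := by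
  refine Cost.mono (cost_foldlM_disjoint h₂ (fun i => {proc (lo + i), proc (lo + h₁ + i)})
    (fun X i _ => h X i) ?_ X) ?_ le_rfl
  · intro i hi j hj hij
    rw [Set.disjoint_left]
    rintro p (rfl | rfl) (h | h)
    all_goals
      have := (proc_eq_iff (by omega) (by omega)).1 h
      omega
  · refine Set.iUnion₂_subset fun i hi => pair_subset_group hP ?_ ?_ <;> omega

/-- A level exchanges O(k) shares of at most I J / P + 1 words each. The halves then work in
parallel and k halves, so the words form a geometric series. The factor k - 1 is chosen to vanish
for a single processor. The 6 messages per level are a send and a receive for each of the two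
transfers of a pair and for the transfer from the unpaired processor. -/
theorem cost_reduceScatter (I J k : ℕ) : ∀ (lo : ℕ) (X : Dist fun _ : Fin P => ℂ), lo + k ≤ P →
    Cost (group P lo k) (reduceScatter I J k lo X) (8 * (k - 1) * (I * J / P + 1),
      16 * (k - 1) * (I * J / P + 1), 6 * Nat.clog 2 k) := by
  induction k using Nat.strong_induction_on with
  | _ k ih =>
    intro lo X hP
    rw [reduceScatter]
    split_ifs with hk
    · exact (Cost.pure X).le (zero_le)
    · set q := I * J / P + 1 with hq
      have l₁ : (share P I J lo (lo + (k + 1) / 2)).length ≤ (k + 1) / 2 * q := by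
        simpa using length_share_le I J lo (lo + (k + 1) / 2)
      have l₂ : (share P I J (lo + (k + 1) / 2) (lo + k)).length ≤ k / 2 * q := by
        refine (length_share_le I J _ _).trans (Nat.mul_le_mul_right _ ?_)
        omega
      have hex (X : Dist fun _ : Fin P => ℂ) := cost_exchange (show k / 2 ≤ (k + 1) / 2 by omega)
        (show (k + 1) / 2 + k / 2 = k by omega) hP (fun X i =>
        (cost_addFrom (proc (lo + i)) (proc (lo + (k + 1) / 2 + i))
          (share P I J (lo + (k + 1) / 2) (lo + k)) X).bind fun X =>
        ((cost_addFrom (proc (lo + (k + 1) / 2 + i)) (proc (lo + i))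
          (share P I J lo (lo + (k + 1) / 2)) X).mono (Set.pair_comm _ _).subset le_rfl)) X
      have hextra (X : Dist fun _ : Fin P => ℂ) : Cost (group P lo k)
          (if (k + 1) / 2 = k / 2 then pure X else addFrom (proc (lo + k / 2)) (proc (lo + k - 1))
            (share P I J (lo + (k + 1) / 2) (lo + k)) X) (k / 2 * q, 2 * (k / 2 * q), 2) := by
        split_ifs
        · exact (Cost.pure X).le (zero_le)
        · refine (cost_addFrom _ _ _ _).mono (pair_subset_group hP (by omega) (by omega)) ?_
          simp only [Prod.mk_le_mk]
          omega
      refine Cost.le ((hex X).bind fun X => Cost.ite_bind ((hextra X).bind fun X =>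
        ((ih ((k + 1) / 2) (by omega) lo X (by omega)).bind_disjoint
          (fun X => (ih (k / 2) (by omega) (lo + (k + 1) / 2) X (by omega)).le ?_)
          (group_disjoint _ _ _)).mono
          (Set.union_subset (group_subset le_rfl (by omega)) (group_subset (by omega) (by omega)))
          le_rfl)) ?_
      · simp only [Prod.mk_le_mk]
        refine ⟨?_, ?_, ?_⟩
        · gcongr; omega
        · gcongr; omega
        · have := clog_half' k
          omega
      · simp only [Prod.mk_add_mk, Prod.mk_le_mk]
        rw [clog_half hk]
        -- The recursion for the number of shares: the exchange in both directions, the transfer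
        -- from the unpaired processor, and the larger half.
        have a1 : (2 * ((k + 1) / 2) + 4 * (k / 2) + 16 * ((k + 1) / 2 - 1)) * q
            ≤ 16 * (k - 1) * q := Nat.mul_le_mul_right _ (by omega)
        have a2 : (2 * ((k + 1) / 2) + 4 * (k / 2) + 16 * ((k + 1) / 2 - 1)) * q =
            2 * ((k + 1) / 2 * q) + 4 * (k / 2 * q) + 16 * ((k + 1) / 2 - 1) * q := by ring
        have a3 : 16 * ((k + 1) / 2 - 1) * q = 2 * (8 * ((k + 1) / 2 - 1) * q) := by ring
        have a4 : 16 * (k - 1) * q = 2 * (8 * (k - 1) * q) := by ring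
        generalize (k + 1) / 2 * q = u at *
        generalize k / 2 * q = v at *
        generalize 8 * ((k + 1) / 2 - 1) * q = w at *
        generalize 8 * (k - 1) * q = z at *
        omega

theorem cost_gather (I J k : ℕ) : ∀ (lo : ℕ) (X : Dist fun _ : Fin P => ℂ), lo + k ≤ P →
    Cost (group P lo k) (gather I J k lo X)
      (0, 4 * (k - 1) * (I * J / P + 1), 2 * Nat.clog 2 k) := by
  induction k using Nat.strong_induction_on with
  | _ k ih =>
    intro lo X hP
    rw [gather]
    split_ifs with hk
    · exact (Cost.pure X).le (zero_le)
    · set q := I * J / P + 1 with hq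
      have l₂ : (share P I J (lo + (k + 1) / 2) (lo + k)).length ≤ k / 2 * q := by
        refine (length_share_le I J _ _).trans (Nat.mul_le_mul_right _ ?_)
        omega
      refine Cost.le (Cost.bind_disjoint_bind (ih ((k + 1) / 2) (by omega) lo X (by omega))
          (fun X => (ih (k / 2) (by omega) (lo + (k + 1) / 2) X (by omega)).le ?_)
          (fun _ X => (cost_copyFrom _ _ _ X).mono
            (pair_subset_group hP (by omega) (by omega)) le_rfl)
          (group_disjoint _ _ _) (group_subset le_rfl (by omega))
          (group_subset (by omega) (by omega))) ?_
      · simp only [Prod.mk_le_mk]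
        refine ⟨le_rfl, ?_, ?_⟩
        · gcongr; omega
        · have := clog_half' k
          omega
      · simp only [Prod.mk_add_mk, Prod.mk_le_mk]
        rw [clog_half hk]
        have a1 : (2 * (k / 2) + 4 * ((k + 1) / 2 - 1)) * q
            ≤ 4 * (k - 1) * q := Nat.mul_le_mul_right _ (by omega)
        have a2 : (2 * (k / 2) + 4 * ((k + 1) / 2 - 1)) * q =
            2 * (k / 2 * q) + 4 * ((k + 1) / 2 - 1) * q := by ring
        omega

theorem cost_scatter (I J k : ℕ) : ∀ (lo : ℕ) (X : Dist fun _ : Fin P => ℂ), lo + k ≤ P →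
    Cost (group P lo k) (scatter I J k lo X)
      (0, 4 * (k - 1) * (I * J / P + 1), 2 * Nat.clog 2 k) := by
  induction k using Nat.strong_induction_on with
  | _ k ih =>
    intro lo X hP
    rw [scatter]
    split_ifs with hk
    · exact (Cost.pure X).le (zero_le)
    · set q := I * J / P + 1 with hq
      have l₂ : (share P I J (lo + (k + 1) / 2) (lo + k)).length ≤ k / 2 * q := by
        refine (length_share_le I J _ _).trans (Nat.mul_le_mul_right _ ?_)
        omega
      refine Cost.le (((cost_copyFrom _ _ _ X).mono
          (pair_subset_group hP (by omega) (by omega)) le_rfl).bind fun X =>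
        ((ih ((k + 1) / 2) (by omega) lo X (by omega)).bind_disjoint
          (fun X => (ih (k / 2) (by omega) (lo + (k + 1) / 2) X (by omega)).le ?_)
          (group_disjoint _ _ _)).mono
          (Set.union_subset (group_subset le_rfl (by omega)) (group_subset (by omega) (by omega)))
          le_rfl) ?_
      · simp only [Prod.mk_le_mk]
        refine ⟨le_rfl, ?_, ?_⟩
        · gcongr; omega
        · have := clog_half' k
          omega
      · simp only [Prod.mk_add_mk, Prod.mk_le_mk]
        rw [clog_half hk]
        have a1 : (2 * (k / 2) + 4 * ((k + 1) / 2 - 1)) * q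
            ≤ 4 * (k - 1) * q := Nat.mul_le_mul_right _ (by omega)
        have a2 : (2 * (k / 2) + 4 * ((k + 1) / 2 - 1)) * q =
            2 * (k / 2 * q) + 4 * ((k + 1) / 2 - 1) * q := by ring
        omega

theorem cost_allGather (I J k : ℕ) : ∀ (lo : ℕ) (X : Dist fun _ : Fin P => ℂ), lo + k ≤ P →
    Cost (group P lo k) (allGather I J k lo X)
      (0, 16 * (k - 1) * (I * J / P + 1), 6 * Nat.clog 2 k) := by
  induction k using Nat.strong_induction_on with
  | _ k ih =>
    intro lo X hP
    rw [allGather]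
    split_ifs with hk
    · exact (Cost.pure X).le (zero_le)
    · set q := I * J / P + 1 with hq
      have l₁ : (share P I J lo (lo + (k + 1) / 2)).length ≤ (k + 1) / 2 * q := by
        simpa using length_share_le I J lo (lo + (k + 1) / 2)
      have l₂ : (share P I J (lo + (k + 1) / 2) (lo + k)).length ≤ k / 2 * q := by
        refine (length_share_le I J _ _).trans (Nat.mul_le_mul_right _ ?_)
        omega
      have hex (X : Dist fun _ : Fin P => ℂ) := cost_exchange (show k / 2 ≤ (k + 1) / 2 by omega)
        (show (k + 1) / 2 + k / 2 = k by omega) hP (fun X i =>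
        (cost_copyFrom (proc (lo + i)) (proc (lo + (k + 1) / 2 + i))
          (share P I J lo (lo + (k + 1) / 2)) X).bind fun X =>
        ((cost_copyFrom (proc (lo + (k + 1) / 2 + i)) (proc (lo + i))
          (share P I J (lo + (k + 1) / 2) (lo + k)) X).mono (Set.pair_comm _ _).subset le_rfl)) X
      have hextra (X : Dist fun _ : Fin P => ℂ) : Cost (group P lo k)
          (if (k + 1) / 2 = k / 2 then pure X else copyFrom (proc (lo + k - 1)) (proc (lo + k / 2))
            (share P I J (lo + (k + 1) / 2) (lo + k)) X) (0, 2 * (k / 2 * q), 2) := by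
        split_ifs
        · exact (Cost.pure X).le (zero_le)
        · refine (cost_copyFrom _ _ _ _).mono (pair_subset_group hP (by omega) (by omega)) ?_
          simp only [Prod.mk_le_mk]
          omega
      refine Cost.le (Cost.bind_disjoint_bind (ih ((k + 1) / 2) (by omega) lo X (by omega))
          (fun X => (ih (k / 2) (by omega) (lo + (k + 1) / 2) X (by omega)).le ?_)
          (fun _ X => (hex X).bind fun X => hextra X)
          (group_disjoint _ _ _) (group_subset le_rfl (by omega))
          (group_subset (by omega) (by omega))) ?_
      · simp only [Prod.mk_le_mk]
        refine ⟨le_rfl, ?_, ?_⟩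
        · gcongr; omega
        · have := clog_half' k
          omega
      · simp only [Prod.mk_add_mk, Prod.mk_le_mk]
        rw [clog_half hk]
        have a1 : (2 * ((k + 1) / 2) + 4 * (k / 2) + 16 * ((k + 1) / 2 - 1)) * q
            ≤ 16 * (k - 1) * q := Nat.mul_le_mul_right _ (by omega)
        have a2 : (2 * ((k + 1) / 2) + 4 * (k / 2) + 16 * ((k + 1) / 2 - 1)) * q =
            2 * ((k + 1) / 2 * q) + 4 * (k / 2 * q) + 16 * ((k + 1) / 2 - 1) * q := by ring
        omega

theorem cost_treeBroadcast (S : List (ℕ × ℕ)) (k : ℕ) :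
    ∀ (lo : ℕ) (X : Dist fun _ : Fin P => ℂ), lo + k ≤ P →
    Cost (group P lo k) (treeBroadcast S k lo X)
      (0, 2 * S.length * Nat.clog 2 k, 2 * Nat.clog 2 k) := by
  induction k using Nat.strong_induction_on with
  | _ k ih =>
    intro lo X hP
    rw [treeBroadcast]
    split_ifs with hk
    · exact (Cost.pure X).le (zero_le)
    · refine Cost.le (((cost_copyFrom _ _ _ X).mono
          (pair_subset_group hP (by omega) (by omega)) le_rfl).bind fun X =>
        ((ih ((k + 1) / 2) (by omega) lo X (by omega)).bind_disjoint
          (fun X => (ih (k / 2) (by omega) (lo + (k + 1) / 2) X (by omega)).le ?_)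
          (group_disjoint _ _ _)).mono
          (Set.union_subset (group_subset le_rfl (by omega)) (group_subset (by omega) (by omega)))
          le_rfl) ?_
      · simp only [Prod.mk_le_mk]
        have := clog_half' k
        refine ⟨le_rfl, by gcongr, by gcongr⟩
      · simp only [Prod.mk_add_mk, Prod.mk_le_mk]
        rw [clog_half hk]
        refine ⟨le_rfl, le_of_eq ?_, le_of_eq ?_⟩ <;> ring

theorem cost_reduce (I J : ℕ) (X : Dist fun _ : Fin P => ℂ) :
    Cost Set.univ (reduce I J X) (8 * (I * J + P), 20 * (I * J + P), 8 * Nat.clog 2 P) := by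
  rw [← group_zero]
  refine Cost.le ((cost_reduceScatter I J P 0 X (by simp)).bind fun X =>
    cost_gather I J P 0 X (by simp)) ?_
  simp only [Prod.mk_add_mk, Prod.mk_le_mk, mul_assoc]
  have := pred_mul_le P I J
  omega

theorem cost_broadcast (I J : ℕ) (X : Dist fun _ : Fin P => ℂ) :
    Cost Set.univ (broadcast I J X) (0, 20 * (I * J + P), 8 * Nat.clog 2 P) := by
  rw [← group_zero]
  refine Cost.le ((cost_scatter I J P 0 X (by simp)).bind fun X =>
    cost_allGather I J P 0 X (by simp)) ?_
  simp only [Prod.mk_add_mk, Prod.mk_le_mk, mul_assoc]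
  have := pred_mul_le P I J
  omega

end Collectives

/-! ### Results of the collectives -/

section CollectiveValues

variable {P : ℕ}

@[simp] theorem value_copyFrom (p q : Fin P) (S : List (ℕ × ℕ)) (X : Dist fun _ : Fin P => ℂ) :
    (copyFrom p q S X).value = some (Function.update X q (overwrite S (X p) (X q))) := by
  rw [copyFrom, value_bind_of (value_msg p q S _ _), value_pure]

theorem value_addFrom (p q : Fin P) (S : List (ℕ × ℕ)) (X : Dist fun _ : Fin P => ℂ) :
    (addFrom p q S X).value =
      some (Function.update X q (overwrite S (fun i j => X q i j + X p i j) (X q))) := by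
  rw [addFrom, value_bind_of (value_msg p q S _ _), value_bind_of (value_fill q S _
    (fun i j => X q i j + X p i j) _ fun i j hij => by
      rw [value_add, overwrite_apply, if_pos hij]), value_pure]

theorem value_foldlM_range {α : Type} (n : ℕ) (f : α → ℕ → Par P (fun _ => ℂ) α)
    (Inv : ℕ → α → Prop) (a : α) (h0 : Inv 0 a)
    (h : ∀ i < n, ∀ a, Inv i a → ∃ b, (f a i).value = some b ∧ Inv (i + 1) b) :
    ∃ b, ((List.range n).foldlM f a).value = some b ∧ Inv n b := by
  induction n with
  | zero => exact ⟨a, by simp, h0⟩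
  | succ n ih =>
    obtain ⟨b, hb, hI⟩ := ih fun i hi => h i (by omega)
    obtain ⟨c, hc, hI'⟩ := h n (by omega) b hI
    refine ⟨c, ?_, hI'⟩
    rw [List.range_succ, List.foldlM_append, value_bind_of hb, List.foldlM_cons]
    simpa using hc

/-- `Y` agrees with `M` at the addresses `S`. -/
def Agree (M : Arr ℂ) (S : List (ℕ × ℕ)) (Y : Arr ℂ) : Prop := ∀ i j, (i, j) ∈ S → Y i j = M i j

/-- Every processor knows in `Y` all entries of `M` that it knows in `X`. -/
def Learns (M : Arr ℂ) (X Y : Dist fun _ : Fin P => ℂ) : Prop :=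
  ∀ r S, Agree M S (X r) → Agree M S (Y r)

theorem Learns.trans {M : Arr ℂ} {X Y Z : Dist fun _ : Fin P => ℂ} (h : Learns M X Y)
    (h' : Learns M Y Z) : Learns M X Z := fun r S hX => h' r S (h r S hX)

/-- Overwriting with correct entries of `M` never destroys correct entries. Knowledge of `M` only
grows, so the copying collectives need no account of what remains unchanged. -/
theorem copyFrom_learns {M : Arr ℂ} {p q : Fin P} {S : List (ℕ × ℕ)}
    {X : Dist fun _ : Fin P => ℂ} (h : Agree M S (X p)) :
    ∃ Y, (copyFrom p q S X).value = some Y ∧ Learns M X Y ∧ Agree M S (Y q) := by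
  refine ⟨_, value_copyFrom p q S X, fun r T hT i j hij => ?_, fun i j hij => ?_⟩
  · by_cases hr : r = q
    · subst hr
      rw [Function.update_self, overwrite_apply]
      split_ifs with hS
      · exact h i j hS
      · exact hT i j hij
    · rw [Function.update_of_ne hr]
      exact hT i j hij
  · rw [Function.update_self, overwrite_apply, if_pos hij]
    exact h i j hij

theorem Agree.share_mono {M Y : Arr ℂ} {I J lo hi lo' hi' : ℕ}
    (h : Agree M (share P I J lo hi) Y) (h1 : lo ≤ lo') (h2 : hi' ≤ hi) :
    Agree M (share P I J lo' hi') Y := fun i j hij => h i j (by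
  rw [mem_share] at hij ⊢
  exact ⟨hij.1, hij.2.1, h1.trans hij.2.2.1, hij.2.2.2.trans_le h2⟩)

theorem Agree.share_union {M Y : Arr ℂ} {I J lo mid hi : ℕ}
    (h : Agree M (share P I J lo mid) Y) (h' : Agree M (share P I J mid hi) Y) :
    Agree M (share P I J lo hi) Y := fun i j hij => by
  rw [mem_share] at hij
  by_cases hm : (i * J + j) % P < mid
  · exact h i j (mem_share.2 ⟨hij.1, hij.2.1, hij.2.2.1, hm⟩)
  · exact h' i j (mem_share.2 ⟨hij.1, hij.2.1, not_lt.1 hm, hij.2.2.2⟩)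

variable [NeZero P]

/-! ### The copying collectives, followed by the reductions. -/

theorem gather_spec (M : Arr ℂ) (I J k : ℕ) : ∀ (lo : ℕ) (X : Dist fun _ : Fin P => ℂ), 1 ≤ k →
    (∀ i < k, Agree M (share P I J (lo + i) (lo + i + 1)) (X (proc (lo + i)))) →
    ∃ Y, (gather I J k lo X).value = some Y ∧ Learns M X Y ∧
      Agree M (share P I J lo (lo + k)) (Y (proc lo)) := by
  induction k using Nat.strong_induction_on with
  | _ k ih =>
    intro lo X hk1 hX
    rw [gather]
    split_ifs with hk
    · obtain rfl : k = 1 := by omega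
      exact ⟨X, value_pure X, fun _ _ h => h, by simpa using hX 0 (by omega)⟩
    · obtain ⟨Y, hY, hL, hA⟩ := ih ((k + 1) / 2) (by omega) lo X (by omega)
        fun i hi => hX i (by omega)
      obtain ⟨Z, hZ, hL', hA'⟩ := ih (k / 2) (by omega) (lo + (k + 1) / 2) Y (by omega)
        fun i hi => hL _ _ (by
          have := hX ((k + 1) / 2 + i) (by omega)
          rwa [← add_assoc] at this)
      have e : lo + (k + 1) / 2 + k / 2 = lo + k := by omega
      rw [e] at hA'
      obtain ⟨U, hU, hL'', hA''⟩ := copyFrom_learns (q := proc lo) hA'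
      exact ⟨U, by rw [value_bind_of hY, value_bind_of hZ, hU], (hL.trans hL').trans hL'',
        (hL'' _ _ (hL' _ _ hA)).share_union hA''⟩

theorem scatter_spec (M : Arr ℂ) (I J k : ℕ) : ∀ (lo : ℕ) (X : Dist fun _ : Fin P => ℂ), 1 ≤ k →
    Agree M (share P I J lo (lo + k)) (X (proc lo)) →
    ∃ Y, (scatter I J k lo X).value = some Y ∧ Learns M X Y ∧
      ∀ i < k, Agree M (share P I J (lo + i) (lo + i + 1)) (Y (proc (lo + i))) := by
  induction k using Nat.strong_induction_on with
  | _ k ih =>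
    intro lo X hk1 hX
    rw [scatter]
    split_ifs with hk
    · obtain rfl : k = 1 := by omega
      refine ⟨X, value_pure X, fun _ _ h => h, fun i hi => ?_⟩
      obtain rfl : i = 0 := by omega
      simpa using hX
    · obtain ⟨Y, hY, hL, hA⟩ := copyFrom_learns (q := proc (lo + (k + 1) / 2))
        (hX.share_mono (show lo ≤ lo + (k + 1) / 2 by omega) le_rfl)
      obtain ⟨Z, hZ, hL', hA'⟩ := ih ((k + 1) / 2) (by omega) lo Y (by omega)
        ((hL _ _ hX).share_mono le_rfl (by omega))
      obtain ⟨U, hU, hL'', hA''⟩ := ih (k / 2) (by omega) (lo + (k + 1) / 2) Z (by omega)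
        ((hL' _ _ hA).share_mono le_rfl (by omega))
      refine ⟨U, by rw [value_bind_of hY, value_bind_of hZ, hU], (hL.trans hL').trans hL'',
        fun i hi => ?_⟩
      by_cases h : i < (k + 1) / 2
      · exact hL'' _ _ (hA' i h)
      · have := hA'' (i - (k + 1) / 2) (by omega)
        rwa [show lo + (k + 1) / 2 + (i - (k + 1) / 2) = lo + i by omega] at this

theorem allGather_spec (M : Arr ℂ) (I J k : ℕ) : ∀ (lo : ℕ) (X : Dist fun _ : Fin P => ℂ), 1 ≤ k →
    (∀ i < k, Agree M (share P I J (lo + i) (lo + i + 1)) (X (proc (lo + i)))) →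
    ∃ Y, (allGather I J k lo X).value = some Y ∧ Learns M X Y ∧
      ∀ i < k, Agree M (share P I J lo (lo + k)) (Y (proc (lo + i))) := by
  induction k using Nat.strong_induction_on with
  | _ k ih =>
    intro lo X hk1 hX
    rw [allGather]
    split_ifs with hk
    · obtain rfl : k = 1 := by omega
      refine ⟨X, value_pure X, fun _ _ h => h, fun i hi => ?_⟩
      obtain rfl : i = 0 := by omega
      simpa using hX 0 hi
    · obtain ⟨Y, hY, hL, hA⟩ := ih ((k + 1) / 2) (by omega) lo X (by omega)
        fun i hi => hX i (by omega)
      obtain ⟨Z, hZ, hL', hA'⟩ := ih (k / 2) (by omega) (lo + (k + 1) / 2) Y (by omega)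
        fun i hi => hL _ _ (by
          have := hX ((k + 1) / 2 + i) (by omega)
          rwa [← add_assoc] at this)
      have e : lo + (k + 1) / 2 + k / 2 = lo + k := by omega
      rw [e] at hA'
      obtain ⟨U, hU, hLU, hAU⟩ := value_foldlM_range (k / 2) (fun X i => do
          let X ← copyFrom (proc (lo + i)) (proc (lo + (k + 1) / 2 + i))
            (share P I J lo (lo + (k + 1) / 2)) X
          copyFrom (proc (lo + (k + 1) / 2 + i)) (proc (lo + i))
            (share P I J (lo + (k + 1) / 2) (lo + k)) X)
        (fun t (U : Dist fun _ : Fin P => ℂ) => Learns M Z U ∧ ∀ i < t,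
          Agree M (share P I J lo (lo + (k + 1) / 2)) (U (proc (lo + (k + 1) / 2 + i))) ∧
          Agree M (share P I J (lo + (k + 1) / 2) (lo + k)) (U (proc (lo + i)))) Z
        ⟨fun _ _ h => h, by simp⟩ (fun i hi U hU => by
          obtain ⟨U', h1, h2, h3⟩ := copyFrom_learns (q := proc (lo + (k + 1) / 2 + i))
            (hU.1 _ _ (hL' _ _ (hA i (by omega))))
          obtain ⟨U'', h4, h5, h6⟩ := copyFrom_learns (q := proc (lo + i))
            (h2 _ _ (hU.1 _ _ (hA' i (by omega))))
          refine ⟨U'', by rw [value_bind_of h1, h4], (hU.1.trans h2).trans h5, fun j hj => ?_⟩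
          by_cases hji : j = i
          · subst hji
            exact ⟨h5 _ _ h3, h6⟩
          · have := hU.2 j (by omega)
            exact ⟨h5 _ _ (h2 _ _ this.1), h5 _ _ (h2 _ _ this.2)⟩)
      rw [value_bind_of hY, value_bind_of hZ, value_bind_of hU]
      -- Three kinds of processors: paired ones of the first half, the one of the first half left
      -- unpaired when k is odd (i = k / 2), and those of the second half, all of which are paired.
      have final {U' : Dist fun _ : Fin P => ℂ} (h : Learns M U U')
          (hlast : (k + 1) / 2 ≠ k / 2 →
            Agree M (share P I J (lo + (k + 1) / 2) (lo + k)) (U' (proc (lo + k / 2)))) (i : ℕ)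
          (hi : i < k) : Agree M (share P I J lo (lo + k)) (U' (proc (lo + i))) := by
        by_cases h1 : i < k / 2
        · exact (h _ _ (hLU _ _ (hL' _ _ (hA i (by omega))))).share_union (h _ _ (hAU i h1).2)
        · by_cases h2 : i < (k + 1) / 2
          · obtain rfl : i = k / 2 := by omega
            exact (h _ _ (hLU _ _ (hL' _ _ (hA _ h2)))).share_union (hlast (by omega))
          · obtain ⟨j, rfl⟩ : ∃ j, i = (k + 1) / 2 + j := ⟨i - (k + 1) / 2, by omega⟩
            rw [← add_assoc]
            exact (h _ _ (hAU j (by omega)).1).share_union (h _ _ (hLU _ _ (hA' j (by omega))))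
      split_ifs with hh
      · exact ⟨U, value_pure U, (hL.trans hL').trans hLU,
          final (fun _ _ h => h) fun h => absurd hh h⟩
      · have hlast := hA' (k / 2 - 1) (by omega)
        rw [show lo + (k + 1) / 2 + (k / 2 - 1) = lo + k - 1 by omega] at hlast
        obtain ⟨U', h1, h2, h3⟩ := copyFrom_learns (q := proc (lo + k / 2)) (hLU _ _ hlast)
        exact ⟨U', h1, ((hL.trans hL').trans hLU).trans h2, final h2 fun _ => h3⟩

theorem treeBroadcast_spec (M : Arr ℂ) (S : List (ℕ × ℕ)) (k : ℕ) :
    ∀ (lo : ℕ) (X : Dist fun _ : Fin P => ℂ), 1 ≤ k → Agree M S (X (proc lo)) →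
    ∃ Y, (treeBroadcast S k lo X).value = some Y ∧ Learns M X Y ∧
      ∀ i < k, Agree M S (Y (proc (lo + i))) := by
  induction k using Nat.strong_induction_on with
  | _ k ih =>
    intro lo X hk1 hX
    rw [treeBroadcast]
    split_ifs with hk
    · obtain rfl : k = 1 := by omega
      refine ⟨X, value_pure X, fun _ _ h => h, fun i hi => ?_⟩
      obtain rfl : i = 0 := by omega
      simpa using hX
    · obtain ⟨Y, hY, hL, hA⟩ := copyFrom_learns (q := proc (lo + (k + 1) / 2)) hX
      obtain ⟨Z, hZ, hL', hA'⟩ := ih ((k + 1) / 2) (by omega) lo Y (by omega) (hL _ _ hX)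
      obtain ⟨U, hU, hL'', hA''⟩ := ih (k / 2) (by omega) (lo + (k + 1) / 2) Z (by omega)
        (hL' _ _ hA)
      refine ⟨U, by rw [value_bind_of hY, value_bind_of hZ, hU], (hL.trans hL').trans hL'',
        fun i hi => ?_⟩
      by_cases h : i < (k + 1) / 2
      · exact hL'' _ _ (hA' i h)
      · have := hA'' (i - (k + 1) / 2) (by omega)
        rwa [show lo + (k + 1) / 2 + (i - (k + 1) / 2) = lo + i by omega] at this

theorem mem_share_all {I J i j : ℕ} : (i, j) ∈ share P I J 0 (0 + P) ↔ i < I ∧ j < J := by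
  rw [mem_share]
  have := Nat.mod_lt (i * J + j) (NeZero.pos P)
  constructor
  · rintro ⟨h1, h2, -⟩
    exact ⟨h1, h2⟩
  · rintro ⟨h1, h2⟩
    exact ⟨h1, h2, Nat.zero_le _, by omega⟩

theorem proc_zero : (proc 0 : Fin P) = 0 := by
  apply Fin.ext
  rw [proc_val (NeZero.pos P)]
  rfl

theorem broadcast_spec (M : Arr ℂ) (I J : ℕ) (X : Dist fun _ : Fin P => ℂ)
    (hX : ∀ i < I, ∀ j < J, X 0 i j = M i j) :
    ∃ Y, (broadcast I J X).value = some Y ∧ ∀ p, ∀ i < I, ∀ j < J, Y p i j = M i j := by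
  have hP : 1 ≤ P := NeZero.pos P
  obtain ⟨Y, hY, -, hA⟩ := scatter_spec M I J P 0 X hP fun i j hij => by
    rw [proc_zero]
    rw [mem_share_all] at hij
    exact hX i hij.1 j hij.2
  obtain ⟨Z, hZ, -, hA'⟩ := allGather_spec M I J P 0 Y hP hA
  refine ⟨Z, by rw [broadcast, value_bind_of hY, hZ], fun p i hi j hj => ?_⟩
  have := hA' p p.2 i j (mem_share_all.2 ⟨hi, hj⟩)
  rwa [zero_add, proc_fin] at this

/-- The effect of the exchange between both halves of a group in a Reduce-Scatter. -/
theorem reduceExchange_spec (I J lo h₁ h₂ : ℕ) (h₂h₁ : h₂ ≤ h₁) (hP : lo + (h₁ + h₂) ≤ P)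
    (X : Dist fun _ : Fin P => ℂ) :
    ∃ Y, ((List.range h₂).foldlM (fun (X : Dist fun _ : Fin P => ℂ) i => do
        let X ← addFrom (proc (lo + i)) (proc (lo + h₁ + i))
          (share P I J (lo + h₁) (lo + (h₁ + h₂))) X
        addFrom (proc (lo + h₁ + i)) (proc (lo + i)) (share P I J lo (lo + h₁)) X) X).value =
      some Y ∧
      (∀ r, (∀ i < h₂, r ≠ proc (lo + i) ∧ r ≠ proc (lo + h₁ + i)) → Y r = X r) ∧
      ∀ i < h₂, (∀ a b, (a, b) ∈ share P I J lo (lo + h₁) →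
          Y (proc (lo + i)) a b = X (proc (lo + i)) a b + X (proc (lo + h₁ + i)) a b) ∧
        ∀ a b, (a, b) ∈ share P I J (lo + h₁) (lo + (h₁ + h₂)) →
          Y (proc (lo + h₁ + i)) a b = X (proc (lo + i)) a b + X (proc (lo + h₁ + i)) a b := by
  refine value_foldlM_range h₂ _ (fun t (Y : Dist fun _ : Fin P => ℂ) =>
      (∀ r, (∀ i < t, r ≠ proc (lo + i) ∧ r ≠ proc (lo + h₁ + i)) → Y r = X r) ∧
      ∀ i < t, (∀ a b, (a, b) ∈ share P I J lo (lo + h₁) →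
          Y (proc (lo + i)) a b = X (proc (lo + i)) a b + X (proc (lo + h₁ + i)) a b) ∧
        ∀ a b, (a, b) ∈ share P I J (lo + h₁) (lo + (h₁ + h₂)) →
          Y (proc (lo + h₁ + i)) a b = X (proc (lo + i)) a b + X (proc (lo + h₁ + i)) a b) X
    ⟨fun _ _ => rfl, by simp⟩ fun t ht Y hY => ?_
  have hne {i j : ℕ} (hi : i < h₁ + h₂) (hj : j < h₁ + h₂) (hij : i ≠ j) :
      (proc (lo + i) : Fin P) ≠ proc (lo + j) := fun h => hij (by
    have := (proc_eq_iff (by omega) (by omega)).1 h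
    omega)
  have hp : Y (proc (lo + t)) = X (proc (lo + t)) := hY.1 _ fun i hi => by
    rw [add_assoc]
    exact ⟨hne (by omega) (by omega) (by omega), hne (by omega) (by omega) (by omega)⟩
  have hq : Y (proc (lo + h₁ + t)) = X (proc (lo + h₁ + t)) := hY.1 _ fun i hi => by
    rw [add_assoc, add_assoc]
    exact ⟨hne (by omega) (by omega) (by omega), hne (by omega) (by omega) (by omega)⟩
  have hpq : (proc (lo + t) : Fin P) ≠ proc (lo + h₁ + t) := by
    rw [add_assoc]
    exact hne (by omega) (by omega) (by omega)
  refine ⟨_, by rw [value_bind_of (value_addFrom _ _ _ _), value_addFrom], ?_, ?_⟩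
  · intro r hr
    rw [Function.update_of_ne (hr t (by omega)).1, Function.update_of_ne (hr t (by omega)).2]
    exact hY.1 r fun i hi => hr i (by omega)
  · intro i hi
    by_cases hit : i = t
    · subst hit
      refine ⟨fun a b hab => ?_, fun a b hab => ?_⟩
      -- The first transfer altered the partner only on the share of the second half, so what it
      -- sends back on the share of the first half is still original.
      · rw [Function.update_self, overwrite_apply, if_pos hab, Function.update_of_ne hpq,
          Function.update_self, overwrite_apply, if_neg, hp, hq]
        rw [mem_share] at hab ⊢
        omega
      · rw [Function.update_of_ne hpq.symm, Function.update_self, overwrite_apply, if_pos hab, hp, hq]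
        exact add_comm _ _
    · have h1 : (proc (lo + i) : Fin P) ≠ proc (lo + t) := hne (by omega) (by omega) hit
      have h2 : (proc (lo + i) : Fin P) ≠ proc (lo + h₁ + t) := by
        rw [add_assoc]
        exact hne (by omega) (by omega) (by omega)
      have h3 : (proc (lo + h₁ + i) : Fin P) ≠ proc (lo + t) := by
        rw [add_assoc]
        exact hne (by omega) (by omega) (by omega)
      have h4 : (proc (lo + h₁ + i) : Fin P) ≠ proc (lo + h₁ + t) := by
        rw [add_assoc, add_assoc]
        exact hne (by omega) (by omega) (by omega)
      rw [Function.update_of_ne h1, Function.update_of_ne h2, Function.update_of_ne h3,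
        Function.update_of_ne h4]
      exact hY.2 i (by omega)

theorem not_mem_group_iff {r : Fin P} {lo k : ℕ} (hP : lo + k ≤ P) :
    r ∉ group P lo k ↔ ∀ i < k, r ≠ proc (lo + i) := by
  constructor
  · rintro h i hi rfl
    exact h (proc_mem_group (by omega) (by omega) (by omega))
  · intro h hr
    have h1 := hr.1
    have h2 := hr.2
    refine h (r - lo) (by omega) ?_
    rw [Nat.add_sub_cancel' h1, proc_fin]

/-- The exchange preserves totals: on the share of either half, the sum over that half's processors
afterwards equals the sum over the whole group before. Each recursive call leaves the other half
alone, hence both can rely on this state. -/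
theorem reduceScatter_spec (I J k : ℕ) : ∀ (lo : ℕ) (X : Dist fun _ : Fin P => ℂ), 1 ≤ k →
    lo + k ≤ P → ∃ Y, (reduceScatter I J k lo X).value = some Y ∧
      (∀ r ∉ group P lo k, Y r = X r) ∧
      ∀ i < k, ∀ a b, (a, b) ∈ share P I J (lo + i) (lo + i + 1) →
        Y (proc (lo + i)) a b = ∑ s ∈ Finset.range k, X (proc (lo + s)) a b := by
  induction k using Nat.strong_induction_on with
  | _ k ih =>
    intro lo X hk1 hP
    rw [reduceScatter]
    split_ifs with hk
    · obtain rfl : k = 1 := by omega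
      refine ⟨X, value_pure X, fun _ _ => rfl, fun i hi a b _ => ?_⟩
      obtain rfl : i = 0 := by omega
      simp
    · obtain ⟨h₁, hh₁⟩ : ∃ h₁, h₁ = (k + 1) / 2 := ⟨_, rfl⟩
      obtain ⟨h₂, hh₂⟩ : ∃ h₂, h₂ = k / 2 := ⟨_, rfl⟩
      rw [← hh₁, ← hh₂]
      obtain rfl : k = h₁ + h₂ := by omega
      obtain ⟨Y, hY, hYo, hYs⟩ := reduceExchange_spec I J lo h₁ h₂ (by omega) hP X
      rw [value_bind_of hY]
      -- the state after the exchange with the unpaired processor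
      have step : ∃ Z, (if h₁ = h₂ then pure Y else
          addFrom (proc (lo + h₂)) (proc (lo + (h₁ + h₂) - 1))
            (share P I J (lo + h₁) (lo + (h₁ + h₂))) Y).value = some Z ∧
          (∀ r ∉ group P lo (h₁ + h₂), Z r = X r) ∧
          (∀ a b, (a, b) ∈ share P I J lo (lo + h₁) →
            ∑ s ∈ Finset.range h₁, Z (proc (lo + s)) a b =
              ∑ s ∈ Finset.range (h₁ + h₂), X (proc (lo + s)) a b) ∧
          ∀ a b, (a, b) ∈ share P I J (lo + h₁) (lo + (h₁ + h₂)) →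
            ∑ s ∈ Finset.range h₂, Z (proc (lo + h₁ + s)) a b =
              ∑ s ∈ Finset.range (h₁ + h₂), X (proc (lo + s)) a b := by
        have hout : ∀ r ∉ group P lo (h₁ + h₂), Y r = X r := fun r hr => by
          rw [not_mem_group_iff hP] at hr
          refine hYo r fun i hi => ⟨hr i (by omega), ?_⟩
          rw [add_assoc]
          exact hr _ (by omega)
        split_ifs with heq
        · refine ⟨Y, value_pure Y, hout, fun a b hab => ?_, fun a b hab => ?_⟩
          · rw [Finset.sum_range_add, heq, ← Finset.sum_add_distrib]
            refine Finset.sum_congr rfl fun s hs => ?_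
            rw [(hYs s (Finset.mem_range.1 hs)).1 a b hab, ← add_assoc, ← heq]
          · rw [Finset.sum_range_add, ← heq, ← Finset.sum_add_distrib]
            refine Finset.sum_congr rfl fun s hs => ?_
            have hs := Finset.mem_range.1 hs
            rw [(hYs s (by omega)).2 a b hab, ← add_assoc]
        -- For odd k the unpaired processor `lo + h₂` keeps its own entries of the first share and
        -- adds its entries of the second share to those of the last processor.
        · obtain rfl : h₁ = h₂ + 1 := by omega
          have hmid : Y (proc (lo + h₂)) = X (proc (lo + h₂)) := by
            refine hYo _ fun i hi => ⟨fun h => ?_, fun h => ?_⟩ <;>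
            · have := (proc_eq_iff (by omega) (by omega)).1 h
              omega
          have hlast : lo + (h₂ + 1 + h₂) - 1 = lo + (h₂ + 1) + (h₂ - 1) := by omega
          rw [hlast]
          obtain ⟨Z, hZ⟩ : ∃ Z, (addFrom (proc (lo + h₂)) (proc (lo + (h₂ + 1) + (h₂ - 1)))
              (share P I J (lo + (h₂ + 1)) (lo + (h₂ + 1 + h₂))) Y).value = some Z := ⟨_, value_addFrom _ _ _ _⟩
          have hZ' := hZ
          rw [value_addFrom, Option.some_inj] at hZ'
          have hne : ∀ r, r ≠ proc (lo + (h₂ + 1) + (h₂ - 1)) → Z r = Y r := fun r hr => by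
            rw [← hZ', Function.update_of_ne hr]
          refine ⟨Z, hZ, fun r hr => ?_, fun a b hab => ?_, fun a b hab => ?_⟩
          · rw [hne, hout r hr]
            rw [not_mem_group_iff hP] at hr
            rw [add_assoc]
            exact hr _ (by omega)
          · have e : ∀ s ∈ Finset.range h₂, Z (proc (lo + s)) a b =
                X (proc (lo + s)) a b + X (proc (lo + (h₂ + 1 + s))) a b := fun s hs => by
              have hs := Finset.mem_range.1 hs
              rw [hne _ (fun h => by
                have := (proc_eq_iff (by omega) (by omega)).1 h
                omega), (hYs s hs).1 a b hab, ← add_assoc lo (h₂ + 1) s]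
            rw [Finset.sum_range_add _ (h₂ + 1) h₂, Finset.sum_range_succ, Finset.sum_range_succ,
              hne _ (fun h => by
                have := (proc_eq_iff (by omega) (by omega)).1 h
                omega), hmid, Finset.sum_congr rfl e, Finset.sum_add_distrib]
            ring
          · obtain ⟨g, rfl⟩ : ∃ g, h₂ = g + 1 := ⟨h₂ - 1, by omega⟩
            rw [Nat.add_sub_cancel] at *
            have e : ∀ s ∈ Finset.range g, Z (proc (lo + (g + 1 + 1) + s)) a b =
                X (proc (lo + s)) a b + X (proc (lo + (g + 1 + 1 + s))) a b := fun s hs => by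
              have hs := Finset.mem_range.1 hs
              rw [hne _ (fun h => by
                have := (proc_eq_iff (by omega) (by omega)).1 h
                omega), (hYs s (by omega)).2 a b hab, ← add_assoc lo (g + 1 + 1) s]
            have e' : Z (proc (lo + (g + 1 + 1) + g)) a b =
                X (proc (lo + g)) a b + X (proc (lo + (g + 1 + 1 + g))) a b +
                  X (proc (lo + (g + 1))) a b := by
              rw [← hZ', Function.update_self, overwrite_apply, if_pos hab, hmid,
                (hYs g (by omega)).2 a b hab, ← add_assoc lo (g + 1 + 1)]
            rw [Finset.sum_range_add _ (g + 1 + 1) (g + 1)]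
            simp only [Finset.sum_range_succ _ g, Finset.sum_range_succ _ (g + 1)]
            rw [Finset.sum_congr rfl e, e', Finset.sum_add_distrib]
            ring
      obtain ⟨Z, hZ, hZo, hZ₁, hZ₂⟩ := step
      obtain ⟨U, hU, hUo, hUs⟩ := ih h₁ (by omega) lo Z (by omega) (by omega)
      obtain ⟨V, hV, hVo, hVs⟩ := ih h₂ (by omega) (lo + h₁) U (by omega) (by omega)
      have hrest : (do
          let X ← reduceScatter I J h₁ lo Z
          reduceScatter I J h₂ (lo + h₁) X).value = some V := by rw [value_bind_of hU, hV]
      refine ⟨V, ?_, fun r hr => ?_, fun i hi a b hab => ?_⟩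
      · split_ifs at hZ ⊢ with heq
        · rw [value_bind_of hZ]
          exact hrest
        · rw [value_bind_of hZ]
          exact hrest
      · rw [hVo r fun h => hr (group_subset (by omega) (by omega) h),
          hUo r fun h => hr (group_subset (by omega) (by omega) h), hZo r hr]
      · by_cases h : i < h₁
        · rw [hVo _ (by
            rw [not_mem_group_iff (by omega)]
            intro j hj h
            have := (proc_eq_iff (by omega) (by omega)).1 h
            omega), hUs i h a b hab, hZ₁ a b]
          rw [mem_share] at hab ⊢
          omega
        · obtain ⟨j, rfl⟩ : ∃ j, i = h₁ + j := ⟨i - h₁, by omega⟩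
          rw [← add_assoc] at hab ⊢
          rw [hVs j (by omega) a b hab, ← hZ₂ a b]
          · refine Finset.sum_congr rfl fun s hs => ?_
            have hs := Finset.mem_range.1 hs
            rw [hUo]
            rw [not_mem_group_iff (by omega)]
            intro j hj h
            have := (proc_eq_iff (by omega) (by omega)).1 h
            omega
          · rw [mem_share] at hab ⊢
            omega

theorem reduce_spec (I J : ℕ) (X : Dist fun _ : Fin P => ℂ) :
    ∃ Y, (reduce I J X).value = some Y ∧ ∀ a < I, ∀ b < J, Y 0 a b = ∑ p, X p a b := by
  have hP : 1 ≤ P := NeZero.pos P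
  obtain ⟨Y, hY, -, hYs⟩ := reduceScatter_spec I J P 0 X hP (by simp)
  have hsum (a b : ℕ) : ∑ s ∈ Finset.range P, X (proc (0 + s)) a b = ∑ p, X p a b := by
    rw [Finset.sum_range]
    exact Finset.sum_congr rfl fun p _ => by rw [zero_add, proc_fin]
  obtain ⟨Z, hZ, -, hA⟩ := gather_spec (fun a b => ∑ p, X p a b) I J P 0 Y hP
    fun i hi a b hab => by rw [hYs i hi a b hab, hsum]
  refine ⟨Z, by rw [reduce, value_bind_of hY, hZ], fun a ha b hb => ?_⟩
  have := hA a b (mem_share_all.2 ⟨ha, hb⟩)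
  rwa [proc_zero] at this

end CollectiveValues

/-! ### Cost of TSQR -/

section TSQRCost

variable {P : ℕ} {α : Type}

theorem LocalCost.cost {p : Fin P} {S : Set (Fin P)} {x : Par P (fun _ => ℂ) α} {a : ℕ}
    (h : LocalCost p x a) (hp : p ∈ S) : Cost S x (a, 0, 0) :=
  Cost.mono h (Set.singleton_subset_iff.2 hp) le_rfl

variable [NeZero P]

/-- The subtrees work in parallel, so a level is charged only one message with a triangle and one
decomposition of a 2n × n array; the latter, of cost 1 + 80 n³, and the stored zero fit into 82 n³.
-/
theorem cost_upsweep {n : ℕ} (hn : 1 ≤ n) (k : ℕ) :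
    ∀ (lo : ℕ) (R : Dist fun _ : Fin P => ℂ), lo + k ≤ P →
    Cost (group P lo k) (upsweep n k lo R)
      (82 * n ^ 3 * Nat.clog 2 k, 2 * n ^ 2 * Nat.clog 2 k, 2 * Nat.clog 2 k) := by
  induction k using Nat.strong_induction_on with
  | _ k ih =>
    intro lo R hP
    rw [upsweep]
    split_ifs with hk
    · exact (Cost.pure _).le (zero_le)
    · have hp : (proc lo : Fin P) ∈ group P lo k :=
        proc_mem_group (by omega) le_rfl (by omega)
      refine Cost.le (Cost.bind_disjoint_bind (ih ((k + 1) / 2) (by omega) lo R (by omega))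
          (fun X => (ih (k / 2) (by omega) (lo + (k + 1) / 2) X.1 (by omega)).le ?_)
          (fun ⟨_, _⟩ ⟨_, _⟩ => (localCost_blank.cost hp).bind fun _ =>
            ((cost_msg _ _ _ _ _).mono (pair_subset_group hP (by omega) (by omega)) le_rfl).bind
              fun _ => ((localCost_localQR (by omega) n 0 _ (by omega)).cost hp).bind_pure)
          (group_disjoint _ _ _) (group_subset le_rfl (by omega))
          (group_subset (by omega) (by omega))) ?_
      · simp only [Prod.mk_le_mk]
        have := clog_half' k
        refine ⟨by gcongr, by gcongr, by gcongr⟩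
      · simp only [Prod.mk_add_mk, Prod.mk_le_mk]
        rw [clog_half hk]
        have h1 := length_tri_le n
        have h2 : 1 ≤ n ^ 3 := Nat.one_le_pow _ _ hn
        have e : 40 * (2 * n) * n ^ 2 = 80 * n ^ 3 := by ring
        rw [e]
        refine ⟨?_, ?_, ?_⟩ <;> nlinarith

/-- The tree is a run-time value. That it came out of an upsweep over the same group is what bounds
its depth and places its halves on disjoint processors. -/
theorem cost_downsweep {n : ℕ} (hn : 1 ≤ n) (k : ℕ) :
    ∀ (lo : ℕ) (R R' : Dist fun _ : Fin P => ℂ) (t : QTree fun _ : Fin P => ℂ), lo + k ≤ P →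
    (upsweep n k lo R).value = some (R', t) → ∀ B, Cost (group P lo k) (downsweep n t B)
      (40 * n ^ 3 * Nat.clog 2 k, 2 * n ^ 2 * Nat.clog 2 k, 2 * Nat.clog 2 k) := by
  induction k using Nat.strong_induction_on with
  | _ k ih =>
    intro lo R R' t hP h B
    rw [upsweep] at h
    split_ifs at h with hk
    · rw [value_pure] at h
      simp only [Option.some.injEq, Prod.mk.injEq] at h
      rw [← h.2]
      exact (Cost.pure _).le (zero_le)
    · simp only [value_bind, Option.bind_eq_some_iff, value_pure, Option.some.injEq,
        Prod.mk.injEq, Prod.exists] at h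
      obtain ⟨R₁, l, h₁, R₂, r, h₂, _, _, _, _, F, _, _, rfl⟩ := h
      have hp : (proc lo : Fin P) ∈ group P lo k :=
        proc_mem_group (by omega) le_rfl (by omega)
      rw [downsweep]
      refine Cost.le (((localCost_applyQ hn (by omega) _ _ _ _).cost hp).bind fun _ =>
        ((cost_msg _ _ _ _ _).mono (pair_subset_group hP (by omega) (by omega)) le_rfl).bind
          fun _ => ((ih ((k + 1) / 2) (by omega) lo R _ _ (by omega) h₁ _).bind_disjoint
            (fun B => (ih (k / 2) (by omega) (lo + (k + 1) / 2) _ _ _ (by omega) h₂ B).le ?_)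
            (group_disjoint _ _ _)).mono
            (Set.union_subset (group_subset le_rfl (by omega)) (group_subset (by omega) (by omega)))
            le_rfl) ?_
      · simp only [Prod.mk_le_mk]
        have := clog_half' k
        refine ⟨by gcongr, by gcongr, by gcongr⟩
      · simp only [Prod.mk_add_mk, Prod.mk_le_mk, length_rect, Nat.sub_zero]
        rw [clog_half hk]
        refine ⟨le_of_eq ?_, le_of_eq ?_, le_of_eq ?_⟩ <;> ring

theorem cost_tsqr {m : Fin P → ℕ} {n μ : ℕ} (hn : 1 ≤ n) (hm : ∀ p, n ≤ m p) (hμ : ∀ p, m p ≤ μ)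
    (o : ℕ) (A : Dist fun _ : Fin P => ℂ) :
    Cost Set.univ (tsqr m n o A) (100 * μ * n ^ 2 + 130 * n ^ 3 * Nat.clog 2 P,
      6 * n ^ 2 * Nat.clog 2 P, 6 * Nat.clog 2 P) := by
  have h0 : (0 : Fin P) ∈ (Set.univ : Set (Fin P)) := trivial
  have hnμ : n ≤ μ := (hm 0).trans (hμ 0)
  have hup (R : Dist fun _ : Fin P => ℂ) := cost_upsweep hn P 0 R (by simp)
  have hdown {R R' : Dist fun _ : Fin P => ℂ} {t} := cost_downsweep hn P 0 R R' t (by simp)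
  have htree (S : List (ℕ × ℕ)) (X : Dist fun _ : Fin P => ℂ) :=
    cost_treeBroadcast S P 0 X (by simp)
  rw [group_zero] at hup hdown htree
  have hQR : Cost Set.univ (each P (β := fun _ => LocalQR ℂ)
      fun p => localQR p (m p) n (top o p) (A p)) (1 + 40 * μ * n ^ 2, 0, 0) :=
    cost_each _ fun p => (localCost_localQR (hn.trans (hm p)) n _ _ (hm p)).le (by
      gcongr
      exact hμ p)
  have hW (F : Fin P → LocalQR ℂ) (B : Dist fun _ : Fin P => ℂ) :
      Cost Set.univ (each P (β := fun _ => Arr ℂ)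
        fun p => applyQ p (m p) n (top o p) (F p).V (F p).T (B p)) (20 * μ * n ^ 2, 0, 0) :=
    cost_each _ fun p => (localCost_applyQ hn (hm p) _ _ _ _).le (by
      gcongr
      exact hμ p)
  have hT (Y U : Arr ℂ) : Cost Set.univ (rightSolve (0 : Fin P) 0 n n Y U) (6 * n * n ^ 2, 0, 0) :=
    (localCost_rightSolve hn hn (by simp) Y U).cost h0
  have hV (W U : Dist fun _ : Fin P => ℂ) : Cost Set.univ (each P (β := fun _ => Arr ℂ)
      fun p => rightSolve p (if p = 0 then o + n else 0) (m p) n (W p) (U p))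
      (6 * μ * n ^ 2, 0, 0) :=
    cost_each _ fun p =>
      localCost_rightSolve hn (hn.trans hnμ) ((Nat.sub_le _ _).trans (hμ p)) _ _
  rw [tsqr]
  refine Cost.le (hQR.bind fun _ => (hup _).bind_of_value fun ⟨_, _⟩ hv =>
    (cost_each (k := (1, 0, 0)) _ fun p => localCost_blank).bind fun _ =>
    ((localCost_op _).cost h0).bind fun _ => (hdown hv _).bind fun _ =>
    (hW _ _).bind fun _ => ((localCost_signLU hn _).cost h0).bind fun ⟨_, _⟩ =>
    ((localCost_adj _ _ _ _).cost h0).bind fun _ =>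
    ((localCost_fill _ (fun _ _ _ => (localCost_op _).bind fun _ => localCost_op _) _).cost
      h0).bind fun _ => (hT _ _).bind fun _ =>
    ((localCost_fill _ (fun _ _ _ => (localCost_op _).bind fun _ => localCost_op _) _).cost
      h0).bind fun _ => (htree _ _).bind fun _ => (hV _ _).bind_pure) ?_
  · simp only [Prod.mk_add_mk, Prod.mk_le_mk, Nat.sub_zero]
    have h1 := length_tri_le n
    have h2 : n ^ 2 ≤ μ * n ^ 2 := Nat.le_mul_of_pos_left _ (by omega)
    have h3 : n ^ 3 ≤ μ * n ^ 2 := by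
      rw [pow_succ, mul_comm]
      exact Nat.mul_le_mul_right _ hnμ
    have h4 : 1 ≤ n ^ 2 := Nat.one_le_pow _ _ hn
    have h5 : (tri n).length * Nat.clog 2 P ≤ n * n * Nat.clog 2 P := Nat.mul_le_mul_right _ h1
    have h6 := Nat.zero_le (n ^ 3 * Nat.clog 2 P)
    refine ⟨?_, ?_, ?_⟩ <;> linarith

end TSQRCost

/-! ### Correctness of the reduction tree -/

section Tree

open Matrix

/-- The first `n` of `2 * n` rows. -/
def upperHalf {n : ℕ} (X : Matrix (Fin (2 * n)) (Fin n) ℂ) : Matrix (Fin n) (Fin n) ℂ :=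
  Matrix.of fun a j => X ⟨a, by omega⟩ j

/-- The last `n` of `2 * n` rows. -/
def lowerHalf {n : ℕ} (X : Matrix (Fin (2 * n)) (Fin n) ℂ) : Matrix (Fin n) (Fin n) ℂ :=
  Matrix.of fun a j => X ⟨n + a, by omega⟩ j

theorem gram_halves {n : ℕ} (X : Matrix (Fin (2 * n)) (Fin n) ℂ) :
    (upperHalf X)ᴴ * upperHalf X + (lowerHalf X)ᴴ * lowerHalf X = Xᴴ * X := by
  ext a b
  simp only [Matrix.add_apply, Matrix.mul_apply, Matrix.conjTranspose_apply, upperHalf, lowerHalf,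
    Matrix.of_apply]
  rw [← Equiv.sum_comp (finCongr (two_mul n).symm), Fin.sum_univ_add]
  rfl

theorem upperHalf_mul {n : ℕ} (X : Matrix (Fin (2 * n)) (Fin n) ℂ) (R : Matrix (Fin n) (Fin n) ℂ) :
    upperHalf (X * R) = upperHalf X * R := by
  ext a b
  simp [upperHalf, Matrix.mul_apply]

theorem lowerHalf_mul {n : ℕ} (X : Matrix (Fin (2 * n)) (Fin n) ℂ) (R : Matrix (Fin n) (Fin n) ℂ) :
    lowerHalf (X * R) = lowerHalf X * R := by
  ext a b
  simp [lowerHalf, Matrix.mul_apply]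

theorem mask_zero {ρ : Type} [DecidableEq ρ] (h : ρ → ℕ) : mask h 0 = 1 := by
  simp [mask]

theorem existsUnique_val {μ o n : ℕ} (h : o + n ≤ μ) : ∀ j < n, ∃! i : Fin μ, (i : ℕ) = o + j :=
  fun j hj => ⟨⟨o + j, by omega⟩, rfl, fun _ hi => Fin.ext hi⟩

theorem gram_unitary_mul {ρ κ : Type} [Fintype ρ] [DecidableEq ρ] {Q : Matrix ρ ρ ℂ}
    (hQ : Q ∈ Matrix.unitaryGroup ρ ℂ) (X : Matrix ρ κ ℂ) : (Q * X)ᴴ * (Q * X) = Xᴴ * X := by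
  have h : Qᴴ * Q = 1 := Matrix.mem_unitaryGroup_iff'.1 hQ
  rw [Matrix.conjTranspose_mul, Matrix.mul_assoc, ← Matrix.mul_assoc Qᴴ, h, Matrix.one_mul]

theorem gram_mul_sum {n : ℕ} (S : Finset ℕ) (G : ℕ → Matrix (Fin n) (Fin n) ℂ)
    (h : ∑ i ∈ S, (G i)ᴴ * G i = 1) (C : Matrix (Fin n) (Fin n) ℂ) :
    ∑ i ∈ S, (G i * C)ᴴ * (G i * C) = Cᴴ * C := by
  have : ∀ i ∈ S, (G i * C)ᴴ * (G i * C) = Cᴴ * ((G i)ᴴ * G i) * C := fun i _ => by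
    simp only [Matrix.conjTranspose_mul, Matrix.mul_assoc]
  rw [Finset.sum_congr rfl this, ← Finset.sum_mul, ← Finset.mul_sum, h, Matrix.mul_one]

variable {P : ℕ} [NeZero P]

/-- The tree implicitly stores the blocks `G i` of a matrix with orthonormal columns, and the
downsweep multiplies by them. At a node, let E be the first n columns of the Q-factor of the stacked
pair: the blocks of the left subtree are multiplied by the upper half of E, those of the right one
by the lower half. Orthonormality passes on because the Gram matrices of both halves add up to Eᴴ E
= 1. -/
theorem upsweep_spec (n k : ℕ) :
    ∀ (lo : ℕ) (R : Dist fun _ : Fin P => ℂ), 1 ≤ k → lo + k ≤ P →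
    (∀ i < k, ∀ a < n, ∀ b < a, R (proc (lo + i)) a b = 0) →
    ∃ R' t, (upsweep n k lo R).value = some (R', t) ∧ (∀ r ∉ group P lo k, R' r = R r) ∧
      (∀ a < n, ∀ b < a, R' (proc lo) a b = 0) ∧
      ∃ G : ℕ → Matrix (Fin n) (Fin n) ℂ, ∑ i ∈ Finset.range k, (G i)ᴴ * G i = 1 ∧
        (∀ i < k, square n (R (proc (lo + i))) = G i * square n (R' (proc lo))) ∧
        ∀ B, ∃ B', (downsweep n t B).value = some B' ∧ (∀ r ∉ group P lo k, B' r = B r) ∧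
          ∀ i < k, square n (B' (proc (lo + i))) = G i * square n (B (proc lo)) := by
  induction k using Nat.strong_induction_on with
  | _ k ih =>
    intro lo R hk1 hP hR
    rw [upsweep]
    split_ifs with hk
    · obtain rfl : k = 1 := by omega
      refine ⟨R, .leaf, value_pure _, fun _ _ => rfl, hR 0 one_pos, fun _ => 1, by simp,
        fun i hi => ?_, fun B => ⟨B, ?_, fun _ _ => rfl, fun i hi => ?_⟩⟩
      · obtain rfl : i = 0 := by omega
        simp
      · rw [downsweep, value_pure]
      · obtain rfl : i = 0 := by omega
        simp
    have e12 : (k + 1) / 2 + k / 2 = k := by omega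
    have e1 : 1 ≤ (k + 1) / 2 := by omega
    have e2 : 1 ≤ k / 2 := by omega
    have ih₁ := ih ((k + 1) / 2) (by omega) lo
    have ih₂ := ih (k / 2) (by omega) (lo + (k + 1) / 2)
    generalize (k + 1) / 2 = k₁ at *
    generalize k / 2 = k₂ at *
    have hq : (proc (lo + k₁) : Fin P) ∉ group P lo k₁ := by
      rw [not_mem_group_iff (by omega)]
      intro i hi h
      have := (proc_eq_iff (P := P) (by omega) (by omega)).1 h
      omega
    have hleft : ∀ i < k₁, (proc (lo + i) : Fin P) ∉ group P (lo + k₁) k₂ := fun i hi => by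
      rw [not_mem_group_iff (by omega)]
      intro j hj h
      have := (proc_eq_iff (P := P) (by omega) (by omega)).1 h
      omega
    have hp : (proc lo : Fin P) ∉ group P (lo + k₁) k₂ := by simpa using hleft 0 (by omega)
    have hright : ∀ i < k₂, (proc (lo + k₁ + i) : Fin P) ∉ group P lo k₁ := fun i hi => by
      rw [not_mem_group_iff (by omega)]
      intro j hj h
      have := (proc_eq_iff (P := P) (by omega) (by omega)).1 h
      omega
    have hpq : (proc lo : Fin P) ≠ proc (lo + k₁) := fun h => by
      have := (proc_eq_iff (P := P) (by omega) (by omega)).1 h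
      omega
    have hsub₁ : group P lo k₁ ⊆ group P lo k := group_subset le_rfl (by omega)
    have hsub₂ : group P (lo + k₁) k₂ ⊆ group P lo k := group_subset (by omega) (by omega)
    have hpm : (proc lo : Fin P) ∈ group P lo k := proc_mem_group (by omega) le_rfl (by omega)
    have hqm : (proc (lo + k₁) : Fin P) ∈ group P lo k :=
      proc_mem_group (by omega) (by omega) (by omega)
    obtain ⟨R₁, l, hv₁, hR₁, hu₁, G₁, hG₁, hQ₁, hd₁⟩ := ih₁ R e1 (by omega)
      fun i hi => hR i (by omega)
    obtain ⟨R₂, r, hv₂, hR₂, hu₂, G₂, hG₂, hQ₂, hd₂⟩ := ih₂ R₁ e2 (by omega) fun i hi => by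
      rw [hR₁ _ (hright i hi), add_assoc]
      exact hR _ (by omega)
    set S : Arr ℂ := fun i j => if i < n then R₂ (proc lo) i j
      else overwrite (tri n) (R₂ (proc (lo + k₁))) (fun _ _ => 0) (i - n) j with hS
    obtain ⟨F, hF, H⟩ := localQR_spec (proc lo : Fin P) (2 * n) n 0 S (by omega)
    set E : Matrix (Fin (2 * n)) (Fin n) ℂ := (1 - tall n (fun i : Fin (2 * n) => F.V i) *
      square n F.T * (tall n fun i : Fin (2 * n) => F.V i)ᴴ) *
        embed (Fin.val : Fin (2 * n) → ℕ) 0 n with hE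
    have hEE : Eᴴ * E = 1 := by
      rw [hE, gram_unitary_mul H.unitary]
      exact embed_conjTranspose_mul_embed (existsUnique_val (by omega))
    have hdec : tall n (fun i : Fin (2 * n) => S i) = E * square n F.R := by
      have := H.dec
      rwa [mask_zero, Matrix.one_mul, ← Matrix.mul_assoc] at this
    have hup : square n (R₂ (proc lo)) = upperHalf E * square n F.R := by
      rw [← upperHalf_mul, ← hdec]
      ext a b
      simp [upperHalf, tall, square, hS]
    have hlow : square n (R₂ (proc (lo + k₁))) = lowerHalf E * square n F.R := by
      rw [← lowerHalf_mul, ← hdec]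
      ext a b
      simp only [lowerHalf, tall, square, hS, Matrix.of_apply, overwrite_apply, mem_tri]
      rw [if_neg (by omega), Nat.add_sub_cancel_left]
      -- Only the triangle is sent. Below the diagonal the blank array already holds the right
      -- zeros, because the R-factor received is upper triangular.
      split_ifs with h
      · rfl
      · exact hu₂ a a.2 b (by omega)
    refine ⟨Function.update R₂ (proc lo) F.R, .node (proc lo) (proc (lo + k₁)) F.V F.T l r, ?_, ?_,
      ?_, fun i => if i < k₁ then G₁ i * upperHalf E else G₂ (i - k₁) * lowerHalf E, ?_, ?_, ?_⟩
    · rw [value_bind_of hv₁]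
      dsimp only
      rw [value_bind_of hv₂]
      dsimp only
      rw [value_bind_of (value_blank _), value_bind_of (value_msg _ _ _ _ _), value_bind_of hF,
        value_pure]
    · intro x hx
      have hxp : x ≠ proc lo := by
        rintro rfl
        exact hx hpm
      rw [Function.update_of_ne hxp, hR₂ _ fun h => hx (hsub₂ h),
        hR₁ _ fun h => hx (hsub₁ h)]
    · intro a ha b hb
      rw [Function.update_self]
      exact H.R_lower ⟨a, ha⟩ ⟨b, by omega⟩ hb
    · rw [← e12, Finset.sum_range_add, ← hEE, ← gram_halves, ← gram_mul_sum _ _ hG₁,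
        ← gram_mul_sum _ _ hG₂]
      congr 1
      · exact Finset.sum_congr rfl fun i hi => by simp only [if_pos (Finset.mem_range.1 hi)]
      · exact Finset.sum_congr rfl fun i hi => by
          simp only [Nat.add_sub_cancel_left, if_neg (show ¬ k₁ + i < k₁ by omega)]
    · intro i hi
      rw [Function.update_self]
      dsimp only
      split_ifs with h
      · rw [hQ₁ i h, Matrix.mul_assoc, ← hup, hR₂ _ hp]
      · have := hQ₂ (i - k₁) (by omega)
        rw [hR₁ _ (hright _ (by omega)), show lo + k₁ + (i - k₁) = lo + i by omega] at this
        rw [this, Matrix.mul_assoc, ← hlow]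
    · intro B
      obtain ⟨C, hC, hCE⟩ := applyQ_spec (proc lo : Fin P) (μ := 2 * n) (n := n) (o := 0) F.V F.T
        (B (proc lo)) (fun i hi => absurd hi (Nat.not_lt_zero i))
      rw [← Matrix.mul_assoc, ← hE] at hCE
      set D := overwrite (rect 0 n 0 n) (fun i j => C (n + i) j) (B (proc (lo + k₁))) with hD
      obtain ⟨B₁, hB₁, hB₁', hBG₁⟩ := hd₁ (Function.update (Function.update B (proc lo) C)
        (proc (lo + k₁)) D)
      obtain ⟨B₂, hB₂, hB₂', hBG₂⟩ := hd₂ B₁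
      rw [Function.update_of_ne hpq, Function.update_self] at hBG₁
      -- The left subtree does not touch processor `lo + k₁`, so the right one starts from the block
      -- that was sent to it.
      rw [hB₁' _ hq, Function.update_self] at hBG₂
      have hC₁ : square n C = upperHalf E * square n (B (proc lo)) := by
        rw [← upperHalf_mul, ← hCE]
        rfl
      have hC₂ : square n D = lowerHalf E * square n (B (proc lo)) := by
        rw [← lowerHalf_mul, ← hCE]
        ext a b
        simp [hD, square, overwrite_apply, mem_rect, lowerHalf, tall]
      refine ⟨B₂, ?_, ?_, ?_⟩
      · rw [downsweep, value_bind_of hC, value_bind_of (value_msg _ _ _ _ _), value_bind_of hB₁, hB₂]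
      · intro x hx
        have hxp : x ≠ proc lo := by
          rintro rfl
          exact hx hpm
        have hxq : x ≠ proc (lo + k₁) := by
          rintro rfl
          exact hx hqm
        rw [hB₂' _ fun h => hx (hsub₂ h), hB₁' _ fun h => hx (hsub₁ h),
          Function.update_of_ne hxq, Function.update_of_ne hxp]
      · intro i hi
        dsimp only
        split_ifs with h
        · rw [hB₂' _ (hleft i h), hBG₁ i h, hC₁, Matrix.mul_assoc]
        · have := hBG₂ (i - k₁) (by omega)
          rw [show lo + k₁ + (i - k₁) = lo + i by omega] at this
          rw [this, hC₂, Matrix.mul_assoc]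

end Tree

/-! ### Correctness of TSQR -/

section TSQR

open Matrix

/-- The product of the two factors that are stored in one array. -/
theorem sum_lower_mul_upper {n a b : ℕ} (ha : a < n) (hb : b < n) (Y : Arr ℂ) :
    ∑ k ∈ Finset.range n, (if k < a then Y a k else if a = k then 1 else 0) *
      (if k ≤ b then Y k b else 0) =
    (∑ k ∈ Finset.range (min a b), Y a k * Y k b) + (if a ≤ b then Y a b else Y a b * Y b b) := by
  have h : Finset.range (min a b + 1) ⊆ Finset.range n := Finset.range_subset_range.2 (by omega)
  rw [← Finset.sum_subset h, Finset.sum_range_succ]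
  · congr 1
    · refine Finset.sum_congr rfl fun k hk => ?_
      rw [Finset.mem_range] at hk
      rw [if_pos (by omega), if_pos (by omega)]
    · rcases le_or_gt a b with hab | hab
      · rw [min_eq_left hab, if_neg (lt_irrefl a), if_pos rfl, if_pos hab, if_pos hab, one_mul]
      · rw [min_eq_right hab.le, if_pos hab, if_pos le_rfl, if_neg (by omega)]
  · intro k hk hk'
    rw [Finset.mem_range] at hk hk'
    by_cases h1 : k ≤ b
    · rw [if_neg (by omega), if_neg (by omega), zero_mul]
    · rw [if_neg h1, mul_zero]

theorem one_sub_mul_apply_of_row_eq_zero {ρ κ : Type} [Fintype ρ] [DecidableEq ρ] {n : ℕ}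
    (V : Matrix ρ (Fin n) ℂ) (T : Matrix (Fin n) (Fin n) ℂ) (M : Matrix (Fin n) ρ ℂ)
    (X : Matrix ρ κ ℂ) {i : ρ} (hV : ∀ j, V i j = 0) (j : κ) :
    ((1 - V * T * M) * X : Matrix ρ κ ℂ) i j = X i j := by
  rw [Matrix.sub_mul, Matrix.one_mul, Matrix.mul_assoc, Matrix.mul_assoc, Matrix.sub_apply,
    Matrix.mul_apply]
  simp [hV]

variable {P : ℕ}

/-- The rows held by the processors, as one family. -/
abbrev RowIndex (m : Fin P → ℕ) : Type := Σ p : Fin P, Fin (m p)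

/-- The rows of a distributed array. -/
def distRows (m : Fin P → ℕ) (X : Dist fun _ : Fin P => ℂ) : RowIndex m → ℕ → ℂ :=
  fun x j => X x.1 x.2 j

theorem gram_distRows {m : Fin P → ℕ} {n : ℕ} (X : Dist fun _ : Fin P => ℂ) :
    (tall n (distRows m X))ᴴ * tall n (distRows m X) =
      ∑ p, (tall n fun i : Fin (m p) => X p i)ᴴ * tall n fun i : Fin (m p) => X p i := by
  ext a b
  simp only [Matrix.mul_apply, Matrix.sum_apply, Fintype.sum_sigma, tall, distRows,
    Matrix.conjTranspose_apply, Matrix.of_apply]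

variable [NeZero P]

/-- The rows of the root come first. -/
def height (m : Fin P → ℕ) (x : RowIndex m) : ℕ := if x.1 = 0 then x.2 else m 0 + x.2

theorem height_root {m : Fin P → ℕ} (i : Fin (m 0)) : height m ⟨0, i⟩ = i := if_pos rfl

theorem height_of_ne {m : Fin P → ℕ} {p : Fin P} (hp : p ≠ 0) (i : Fin (m p)) :
    height m ⟨p, i⟩ = m 0 + i := if_neg hp

/-- Rows of different processors other than the root may share a height. Uniqueness is needed only
below `m 0`, where all rows belong to the root. -/
theorem existsUnique_height {m : Fin P → ℕ} {o n : ℕ} (h : o + n ≤ m 0) :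
    ∀ j < n, ∃! x : RowIndex m, height m x = o + j := by
  intro j hj
  refine ⟨⟨0, ⟨o + j, by omega⟩⟩, height_root _, ?_⟩
  rintro ⟨p, i⟩ hi
  by_cases hp : p = 0
  · subst hp
    have hi : (i : ℕ) = o + j := by rwa [height_root] at hi
    congr
    exact Fin.ext hi
  · have hi : height m ⟨p, i⟩ = o + j := hi
    rw [height_of_ne hp] at hi
    omega

theorem le_height_iff {m : Fin P → ℕ} {o : ℕ} (h : o ≤ m 0) (p : Fin P) (i : Fin (m p)) :
    o ≤ height m ⟨p, i⟩ ↔ top o p ≤ i := by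
  by_cases hp : p = 0
  · subst hp
    rw [height_root, top, if_pos rfl]
  · rw [height_of_ne hp, top, if_neg hp]
    omega

theorem upsweep_all_spec (n : ℕ) (R : Dist fun _ : Fin P => ℂ)
    (hR : ∀ p, ∀ a < n, ∀ b < a, R p a b = 0) :
    ∃ R' t, (upsweep n P 0 R).value = some (R', t) ∧ (∀ a < n, ∀ b < a, R' 0 a b = 0) ∧
      ∃ G : Fin P → Matrix (Fin n) (Fin n) ℂ, ∑ p, (G p)ᴴ * G p = 1 ∧
        (∀ p, square n (R p) = G p * square n (R' 0)) ∧
        ∀ B, ∃ B', (downsweep n t B).value = some B' ∧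
          ∀ p, square n (B' p) = G p * square n (B 0) := by
  obtain ⟨R', t, h1, -, h2, G, h3, h4, h5⟩ := upsweep_spec n P 0 R (NeZero.pos P) (by omega)
    fun i _ => hR _
  rw [proc_zero] at h2 h4 h5
  have hp (p : Fin P) : (proc (0 + p) : Fin P) = p := by rw [zero_add, proc_fin]
  refine ⟨R', t, h1, h2, fun p => G p, ?_, fun p => ?_, fun B => ?_⟩
  · rw [← h3, ← Fin.sum_univ_eq_sum_range fun i => (G i)ᴴ * G i]
  · have := h4 p p.2
    rwa [hp] at this
  · obtain ⟨B', h6, -, h7⟩ := h5 B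
    refine ⟨B', h6, fun p => ?_⟩
    have := h7 p p.2
    rwa [hp] at this

/-- Let W consist of the rows that the local Q-factors produce from [Gₚ; 0]. Then W R' is the matrix
of active rows, and Wᴴ W = Σ Gₚᴴ Gₚ = 1, so `IsHQR.reconstruct` applies. The signed pivots are
nonzero, which makes the solves with `U` succeed; the solve for the kernel has unit diagonal. -/
theorem tsqr_spec {m : Fin P → ℕ} {n o : ℕ} (hm : ∀ p, top o p + n ≤ m p)
    (A : Dist fun _ : Fin P => ℂ) :
    ∃ F, (tsqr m n o A).value = some F ∧
      IsHQR (height m) o n (tall n (distRows m A)) (tall n (distRows m F.V)) (square n F.T)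
        (square n F.R) := by
  have hm0 : o + n ≤ m 0 := by simpa [top] using hm 0
  choose Q hQ HQ using fun p => localQR_spec p (m p) n (top o p) (A p) (hm p)
  obtain ⟨R', t, ht, hR', G, hG, hGR, hdown⟩ := upsweep_all_spec n (fun p => (Q p).R)
    fun p a ha b hb => (HQ p).R_lower ⟨a, ha⟩ ⟨b, by omega⟩ hb
  -- The outcome of the downsweep depends only on the root's block; the identity there turns it into
  -- the matrices `G p`.
  obtain ⟨B, hB, hGB⟩ := hdown (Function.update (fun _ _ _ => 0) 0
    fun i j => if i = j then (1 : ℂ) else 0)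
  have hGB' (p : Fin P) : square n (B p) = G p := by
    rw [hGB, Function.update_self]
    convert Matrix.mul_one (G p)
    ext i j
    simp [square, Matrix.one_apply, Fin.ext_iff]
  choose W hW HW using fun p => applyQ_spec p (μ := m p) (n := n) (o := top o p) (Q p).V (Q p).T
    (B p) fun i hi j hj => (HQ p).basis_upper ⟨i, by have := hm p; omega⟩ ⟨j, hj⟩
      (Nat.lt_add_right _ hi)
  simp only [hGB'] at HW
  obtain ⟨Y, S, hY, HY⟩ := signLU_spec (0 : Fin P) n (fun i j => W 0 (o + i) j)
  set U : Arr ℂ := fun i j => if i ≤ j then Y i j else 0 with hU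
  set L : Arr ℂ := fun i j => if j < i then Y i j else if i = j then 1 else 0 with hL
  set LH : Arr ℂ := overwrite (rect 0 n 0 n) (fun i j => star (L j i)) fun _ _ => 0 with hLH
  set US : Arr ℂ := overwrite (tri n) (fun i j => U i j * star (S j)) fun _ _ => 0 with hUS
  set R : Arr ℂ := overwrite (tri n) (fun i j => 0 - S i * R' 0 i j) fun _ _ => 0 with hR
  obtain ⟨T, hT, HT, -⟩ := rightSolve_spec (0 : Fin P) (r := 0) (r' := n) (n := n) US LH
    fun j hj => by simp [hLH, overwrite_apply, mem_rect, hj, hL]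
  obtain ⟨Up, hUp, -, HUp⟩ := treeBroadcast_spec (P := P) U (tri n) P 0
    (Function.update (fun _ _ _ => 0) 0 U) (NeZero.pos P) (by
      rw [proc_zero, Function.update_self]
      exact fun _ _ _ => rfl)
  have HUp (p : Fin P) : Agree U (tri n) (Up p) := by
    have := HUp p p.2
    rwa [zero_add, proc_fin] at this
  have hUdiag (p : Fin P) (j : ℕ) (hj : j < n) : Up p j j ≠ 0 := by
    rw [HUp p j j (mem_tri.2 ⟨le_rfl, hj⟩), hU]
    simpa using HY.pivot j hj
  choose V hV HV HV0 using fun p => rightSolve_spec p (r := if p = 0 then o + n else 0)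
    (r' := m p) (n := n) (W p) (Up p) (hUdiag p)
  refine ⟨⟨Function.update V 0 fun i j => if o ≤ i ∧ i < o + n then L (i - o) j else V 0 i j, T, R⟩,
    ?_, ?_⟩
  · rw [tsqr, value_bind_of (value_each _ _ Q hQ), value_bind_of ht]
    dsimp only
    rw [value_bind_of (value_each _ _ _ fun p => value_blank p), value_bind_of (value_one _),
      value_bind_of hB, value_bind_of (value_each _ _ W hW), value_bind_of hY]
    dsimp only
    rw [value_bind_of (value_adj _ _ _ _ _), value_bind_of (value_fill _ _ _ _ _
      fun i j _ => by rw [value_bind_of (value_conj _ _), value_mul]), value_bind_of hT,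
      value_bind_of (value_fill _ _ _ _ _
        fun i j _ => by rw [value_bind_of (value_mul _ _ _), value_sub]),
      value_bind_of hUp, value_bind_of (value_each _ _ V hV), value_pure]
  have hWtop (i : Fin (m 0)) (hi : (i : ℕ) < o) (j : Fin n) : W 0 i j = 0 := by
    have h := congrFun₂ (HW 0) i j
    rw [one_sub_mul_apply_of_row_eq_zero _ _ _ _ (fun j => (HQ 0).basis_upper i j
      (by simp only [top, if_true]; omega)),
      embed_mul_apply_of_ne _ _ _ _ fun a => by simp only [top, if_true]; omega] at h
    exact h
  have hLU (a b : Fin n) : W 0 (o + a) b + (if a = b then S a else 0) =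
      ∑ k ∈ Finset.range n, L a k * U k b := by
    rw [hL, hU, sum_lower_mul_upper a.2 b.2, ← HY.done a a.2 b b.2 (by omega)]
    simp only [Fin.ext_iff]
  have hsum (X : Arr ℂ) (i : ℕ) (j : Fin n) : ∑ k ∈ Finset.range n, X i k * U k j =
      ∑ k ∈ Finset.range (j + 1), X i k * U k j := by
    symm
    refine Finset.sum_subset (Finset.range_subset_range.2 j.2) fun k _ hk => ?_
    rw [Finset.mem_range] at hk
    rw [hU]
    simp only
    rw [if_neg (by omega), mul_zero]
  have hR_eq : square n R = -(Matrix.diagonal (fun j : Fin n => S j) * square n (R' 0)) := by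
    ext i j
    simp only [hR, square, overwrite_apply, mem_tri, Matrix.of_apply, Matrix.neg_apply,
      Matrix.diagonal_mul]
    split_ifs with h
    · simp
    · rw [hR' i i.2 j (by omega), mul_zero, neg_zero]
  have hVsolve (p : Fin P) (i : ℕ) (h1 : (if p = 0 then o + n else 0) ≤ i) (h2 : i < m p)
      (j : Fin n) : ∑ k ∈ Finset.range n, V p i k * U k j = W p i j := by
    rw [hsum, ← HV p i h1 h2 j j.2]
    refine Finset.sum_congr rfl fun k hk => ?_
    rw [Finset.mem_range] at hk
    rw [HUp p k j (mem_tri.2 ⟨by omega, j.2⟩)]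
  have hLHt (k j : ℕ) (hk : k < n) (hj : j < n) : LH k j = star (L j k) := by
    simp [hLH, overwrite_apply, mem_rect, hk, hj]
  have hTeq (i j : ℕ) (hi : i < n) (hj : j < n) :
      ∑ k ∈ Finset.range j, T i k * LH k j + T i j = US i j := by
    rw [← HT i (Nat.zero_le _) hi j hj, Finset.sum_range_succ, hLHt j j hj hj]
    simp [hL]
  rw [hR_eq]
  refine IsHQR.reconstruct (W := tall n (distRows m W)) (L := square n L) (U := square n U)
    (existsUnique_height hm0) ?_ ?_ (fun j => HY.sign j j.2) ?_ ?_ ?_ ?_ ?_ ?_ ?_ ?_ ?_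
  · ext ⟨p, i⟩ j
    have h := congrFun₂ (HQ p).dec i j
    rw [hGR p, ← Matrix.mul_assoc (embed _ _ _), ← Matrix.mul_assoc, ← HW p, mask_mul_apply] at h
    rw [mask_mul_apply, if_congr (le_height_iff (by omega) p i) rfl rfl]
    exact h
  · rw [gram_distRows, ← hG]
    refine Finset.sum_congr rfl fun p _ => ?_
    rw [HW p, gram_unitary_mul (HQ p).unitary, Matrix.conjTranspose_mul, Matrix.mul_assoc,
      ← Matrix.mul_assoc _ (embed _ _ _), embed_conjTranspose_mul_embed
      (existsUnique_val (hm p)), Matrix.one_mul]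
  · ext a b
    rw [Matrix.add_apply, embed_conjTranspose_mul_apply (existsUnique_height hm0) _
      (i := ⟨0, ⟨o + a, by omega⟩⟩) a (height_root _), Matrix.mul_apply]
    have := hLU a b
    rw [← Fin.sum_univ_eq_sum_range fun k => L a k * U k b] at this
    rw [Matrix.diagonal_apply]
    exact this
  · intro i j hij
    simp only [square, hL, Matrix.of_apply]
    rw [if_neg (by omega), if_neg (by omega)]
  · intro i
    simp [square, hL]
  · ext ⟨p, i⟩ j
    rw [Matrix.add_apply, Matrix.mul_apply]
    change ∑ k : Fin n, _ * U k j = W p i j + _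
    simp only [tall, distRows, Matrix.of_apply]
    -- The root has inactive rows, where both sides vanish, a leading block, where `L` times `U` is
    -- the factorization, and further rows, which come from the triangular solve. The other
    -- processors have rows of the last kind only.
    by_cases hp : p = 0
    · subst hp
      rw [Function.update_self]
      rcases lt_or_ge (i : ℕ) (o + n) with h1 | h1
      · rcases lt_or_ge (i : ℕ) o with h2 | h2
        · rw [embed_mul_apply_of_ne _ _ _ _ fun a => by rw [height_root]; omega, hWtop i h2, add_zero]
          refine Finset.sum_eq_zero fun k _ => ?_
          rw [if_neg (by omega), HV0 0 i (by simp only [if_true]; omega), zero_mul]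
        · obtain ⟨a, ha⟩ : ∃ a : Fin n, (i : ℕ) = o + a := ⟨⟨i - o, by omega⟩, by simp; omega⟩
          rw [embed_mul_apply_of_eq _ _ _ _ a (by rw [height_root]; exact ha), ha,
            Matrix.diagonal_apply, hLU a j, ← Fin.sum_univ_eq_sum_range fun k => L a k * U k j]
          refine Finset.sum_congr rfl fun k _ => ?_
          rw [if_pos (by omega), Nat.add_sub_cancel_left]
      · rw [embed_mul_apply_of_ne _ _ _ _ fun a => by rw [height_root]; omega, add_zero,
          ← hVsolve 0 i (by simpa using h1) i.2 j,
          ← Fin.sum_univ_eq_sum_range fun k => V 0 i k * U k j]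
        refine Finset.sum_congr rfl fun k _ => ?_
        rw [if_neg (by omega)]
    · rw [Function.update_of_ne hp, embed_mul_apply_of_ne _ _ _ _ fun a => by
          rw [height_of_ne hp]; omega, add_zero, ← hVsolve p i (by simp [hp]) i.2 j,
        ← Fin.sum_univ_eq_sum_range fun k => V p i k * U k j]
  · rintro ⟨p, i⟩ a j hi
    by_cases hp : p = 0
    · subst hp
      rw [height_root] at hi
      simp only [tall, distRows, Matrix.of_apply, square]
      rw [Function.update_self, if_pos (by omega), hi, Nat.add_sub_cancel_left]
    · rw [height_of_ne hp] at hi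
      omega
  · rintro ⟨p, i⟩ j hi
    by_cases hp : p = 0
    · subst hp
      rw [height_root] at hi
      simp only [tall, distRows, Matrix.of_apply]
      rw [Function.update_self, if_neg (by omega), HV0 0 i (by simp only [if_true]; omega)]
    · rw [height_of_ne hp] at hi
      omega
  · ext i j
    have h : ∑ k ∈ Finset.range n, T i k * LH k j = US i j := by
      rw [← hTeq i j i.2 j.2, ← Finset.sum_subset (Finset.range_subset_range.2 j.2),
        Finset.sum_range_succ, hLHt j j j.2 j.2]
      · simp [hL]
      · intro k hk hk'
        rw [Finset.mem_range] at hk hk'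
        rw [hLHt k j hk j.2, hL]
        simp only
        rw [if_neg (by omega), if_neg (by omega), star_zero, mul_zero]
    rw [Matrix.diagonal_conjTranspose, Matrix.mul_diagonal, Matrix.mul_apply]
    rw [← Fin.sum_univ_eq_sum_range fun k => T i k * LH k j] at h
    simp only [square, Matrix.conjTranspose_apply, Matrix.of_apply, Pi.star_apply]
    simp only [hLHt _ _ (Fin.is_lt _) (Fin.is_lt _)] at h
    rw [h, hUS, overwrite_apply]
    split_ifs with hij
    · rfl
    · rw [mem_tri] at hij
      rw [hU]
      simp only
      rw [if_neg (by omega), zero_mul]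
  -- Forward substitution along a row: below the diagonal the right-hand side vanishes, and so do
  -- the entries of the row found before.
  · have : ∀ j < n, ∀ i < n, j < i → T i j = 0 := by
      intro j
      induction j using Nat.strong_induction_on with
      | _ j ih =>
        intro hj i hi hij
        have h := hTeq i j hi hj
        rw [Finset.sum_eq_zero fun k hk => ?_, zero_add] at h
        · rw [h, hUS, overwrite_apply, if_neg (by rw [mem_tri]; omega)]
        · rw [Finset.mem_range] at hk
          rw [ih k hk (by omega) i hi (by omega), zero_mul]
    exact fun i j hij => this j j.2 i i.2 hij
  · exact fun i j hij => hR' i i.2 j hij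

end TSQR

/-! ### One-dimensional matrix multiplication -/

section Products

open Matrix

variable {P : ℕ} [NeZero P]

/-- The program sums over active rows only. Requiring products, rather than one of the factors, to
vanish on the inactive rows covers both uses: in V_Lᴴ A₂ the left factor vanishes there, in V_Lᴴ [0;
V_R] the right one. -/
theorem mulAdj_spec {m : Fin P → ℕ} {o I J : ℕ} (X Y : Dist fun _ : Fin P => ℂ)
    (h : ∀ p, ∀ i < top o p, ∀ a < I, ∀ b < J, star (X p i a) * Y p i b = 0) :
    ∃ M, (mulAdj m o I J X Y).value = some M ∧
      (Matrix.of fun a b => M a b : Matrix (Fin I) (Fin J) ℂ) =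
        (tall I (distRows m X))ᴴ * tall J (distRows m Y) := by
  set C : Dist fun _ : Fin P => ℂ := fun p => overwrite (rect 0 I 0 J)
    (fun i j => ∑ k ∈ Finset.Ico (top o p) (m p),
      overwrite (rect 0 I (top o p) (m p)) (fun i j => star (X p j i)) (fun _ _ => 0) i k * Y p k j)
    fun _ _ => 0 with hC
  obtain ⟨M, hM, hMC⟩ := reduce_spec I J C
  refine ⟨M 0, ?_, ?_⟩
  · rw [mulAdj, value_bind_of (value_each _ _ C fun p => by
      rw [value_bind_of (value_adj _ _ _ _ _), value_mm]), value_bind_of hM, value_pure]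
  · ext a b
    rw [Matrix.of_apply, hMC a a.2 b b.2, Matrix.mul_apply, Fintype.sum_sigma]
    refine Finset.sum_congr rfl fun p _ => ?_
    simp only [Matrix.conjTranspose_apply, tall, distRows, Matrix.of_apply]
    rw [sum_fin_eq_sum_Ico (o := top o p) (fun i => star (X p i a) * Y p i b)
      fun i hi => h p i hi a a.2 b b.2]
    simp only [hC, overwrite_apply, mem_rect, Nat.zero_le, a.2, b.2, true_and, if_true]
    refine Finset.sum_congr rfl fun k hk => ?_
    rw [if_pos (Finset.mem_Ico.1 hk)]

theorem mulRoot_spec {m : Fin P → ℕ} {o K J : ℕ} (X : Dist fun _ : Fin P => ℂ) (M : Arr ℂ) :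
    ∃ Y, (mulRoot m o K J X M).value = some Y ∧ ∀ p i, top o p ≤ i → i < m p → ∀ j < J,
      Y p i j = ∑ k ∈ Finset.range K, X p i k * M k j := by
  obtain ⟨M', hM, hM'⟩ := broadcast_spec M K J (Function.update (fun _ _ _ => 0) (0 : Fin P) M)
    fun i _ j _ => by rw [Function.update_self]
  refine ⟨fun p => overwrite (rect (top o p) (m p) 0 J)
    (fun i j => ∑ k ∈ Finset.Ico 0 K, X p i k * M' p k j) fun _ _ => 0, ?_, ?_⟩
  · rw [mulRoot, value_bind_of (value_each _ _ _ fun p => value_blank p), value_bind_of hM]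
    exact value_each _ _ _ fun p => value_mm _ _ _ _ _ _
  · intro p i h1 h2 j hj
    simp only [overwrite_apply, mem_rect]
    rw [if_pos ⟨⟨h1, h2⟩, Nat.zero_le _, hj⟩, ← Finset.range_eq_Ico]
    refine Finset.sum_congr rfl fun k hk => ?_
    rw [hM' p k (Finset.mem_range.1 hk) j hj]

theorem cost_mulAdj {m : Fin P → ℕ} {o I J μ : ℕ} (hμ : ∀ p, m p ≤ μ) (hμ1 : 1 ≤ μ) (hI : 1 ≤ I)
    (hJ : 1 ≤ J) (X Y : Dist fun _ : Fin P => ℂ) : Cost Set.univ (mulAdj m o I J X Y)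
      (14 * (μ * (I * J)) + 8 * P, 20 * (I * J + P), 8 * Nat.clog 2 P) := by
  rw [mulAdj]
  apply Cost.le
  · apply Cost.bind (k := ((1 + I * μ) + (1 + I * J * (1 + μ * 2)), 0, 0))
    · refine cost_each _ fun p => ((localCost_adj _ _ _ _).bind fun _ =>
        localCost_mm _ _ _ _).le ?_
      have := hμ p
      simp only [length_rect, List.Ico.length, Nat.sub_zero]
      gcongr <;> omega
    · intro C
      exact (cost_reduce I J C).bind_pure
  · simp only [Prod.mk_add_mk, Prod.mk_le_mk]
    have h1 : I * J ≤ μ * (I * J) := Nat.le_mul_of_pos_left _ hμ1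
    have h2 : I * μ ≤ μ * (I * J) := by
      rw [mul_comm I μ]
      exact Nat.mul_le_mul_left _ (Nat.le_mul_of_pos_right _ hJ)
    have h3 : 1 ≤ I * J := Nat.mul_pos hI hJ
    refine ⟨?_, ?_, ?_⟩ <;> linarith

theorem cost_mulRoot {m : Fin P → ℕ} {o K J μ : ℕ} (hμ : ∀ p, m p ≤ μ) (hμ1 : 1 ≤ μ) (hK : 1 ≤ K)
    (hJ : 1 ≤ J) (X : Dist fun _ : Fin P => ℂ) (M : Arr ℂ) : Cost Set.univ (mulRoot m o K J X M)
      (5 * (μ * (K * J)), 20 * (K * J + P), 8 * Nat.clog 2 P) := by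
  rw [mulRoot]
  apply Cost.le
  · apply Cost.bind (k := (1, 0, 0))
    · exact cost_each _ fun p => localCost_blank
    · intro Z
      apply (cost_broadcast K J _).bind
      intro M'
      refine cost_each (k := (1 + μ * J * (1 + K * 2), 0, 0)) _ fun p =>
        (localCost_mm _ _ _ _).le ?_
      have := hμ p
      simp only [length_rect, List.Ico.length, Nat.sub_zero]
      gcongr
      omega
  · simp only [Prod.mk_add_mk, Prod.mk_le_mk]
    have h1 : K * J ≤ μ * (K * J) := Nat.le_mul_of_pos_left _ hμ1
    have h2 : μ * J ≤ μ * (K * J) := Nat.mul_le_mul_left _ (Nat.le_mul_of_pos_left _ hK)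
    have h3 : 1 ≤ K * J := Nat.mul_pos hK hJ
    refine ⟨?_, ?_, ?_⟩ <;> linarith

end Products

/-! ### 1D-CAQR-EG -/

section CAQREG

open Matrix

variable {P : ℕ} [NeZero P]

/-- TSQR at the leaves and `IsHQR.compose` at the splits. Correctness does not depend on the block
size. -/
theorem caqrEG_spec {m : Fin P → ℕ} (b : ℕ) (n : ℕ) :
    ∀ (o : ℕ) (A : Dist fun _ : Fin P => ℂ), (∀ p, top o p + n ≤ m p) →
    ∃ F, (caqrEG m b n o A).value = some F ∧
      IsHQR (height m) o n (tall n (distRows m A)) (tall n (distRows m F.V)) (square n F.T)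
        (square n F.R) := by
  induction n using Nat.strong_induction_on with
  | _ n ih =>
    intro o A hm
    have hm0 : o + n ≤ m 0 := by simpa [top] using hm 0
    rw [caqrEG]
    split_ifs with hb
    · exact tsqr_spec hm A
    have ih₁ := ih (n / 2) (by omega)
    have ih₂ := ih (n - n / 2) (by omega)
    have hn : n = n / 2 + (n - n / 2) := by omega
    clear ih hb
    generalize n - n / 2 = l at *
    generalize n / 2 = k at *
    subst hn
    have htop (p : Fin P) : top (o + k) p ≤ top o p + k := by
      rw [top, top]
      split_ifs <;> omega
    obtain ⟨F, hF, H₁⟩ := ih₁ o A fun p => by have := hm p; omega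
    obtain ⟨M₁, hM₁, hM₁'⟩ := mulAdj_spec (m := m) (o := o) (I := k) (J := l) F.V
      (fun p i j => A p i (k + j)) fun p i hi a ha b hb => by
        by_cases hp : p = 0
        · subst hp
          simp only [top, if_true] at hi
          have : F.V 0 i a = 0 := H₁.basis_upper ⟨0, ⟨i, by omega⟩⟩ ⟨a, ha⟩ (by
            rw [height_root]
            exact Nat.lt_add_right _ hi)
          rw [this, star_zero, zero_mul]
        · simp [top, hp] at hi
    set TH : Arr ℂ := overwrite (rect 0 k 0 k) (fun i j => star (F.T j i)) fun _ _ => 0 with hTH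
    set M₂ : Arr ℂ := overwrite (rect 0 k 0 l) (fun i j => ∑ a ∈ Finset.Ico 0 k, TH i a * M₁ a j)
      fun _ _ => 0 with hM₂
    obtain ⟨VM, hVM, hVM'⟩ := mulRoot_spec (m := m) (o := o) (K := k) (J := l) F.V M₂
    set B : Dist fun _ : Fin P => ℂ := fun p => overwrite (rect (top o p) (m p) 0 l)
      (fun i j => A p i (k + j) - VM p i j) fun i j => A p i (k + j) with hB
    obtain ⟨G, hG, H₂⟩ := ih₂ (o + k) B fun p => by
      have := hm p
      have := htop p
      omega
    obtain ⟨M₃, hM₃, hM₃'⟩ := mulAdj_spec (m := m) (o := o + k) (I := k) (J := l) F.V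
      G.V fun p i hi a ha b hb => by
        by_cases hp : p = 0
        · subst hp
          simp only [top, if_true] at hi
          have : G.V 0 i b = 0 := H₂.basis_upper ⟨0, ⟨i, by omega⟩⟩ ⟨b, hb⟩ (by
            rw [height_root]
            exact Nat.lt_add_right _ hi)
          rw [this, mul_zero]
        · simp [top, hp] at hi
    set M₄ : Arr ℂ := overwrite (rect 0 k 0 l) (fun i j => ∑ a ∈ Finset.Ico 0 l, M₃ i a * G.T a j)
      fun _ _ => 0 with hM₄
    set M₅ : Arr ℂ := overwrite (rect 0 k 0 l) (fun i j => ∑ a ∈ Finset.Ico 0 k, F.T i a * M₄ a j)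
      fun _ _ => 0 with hM₅
    set M₆ : Arr ℂ := overwrite (rect 0 k 0 l) (fun i j => 0 - M₅ i j) fun _ _ => 0 with hM₆
    have hM₂' : (Matrix.of fun a b => M₂ a b : Matrix (Fin k) (Fin l) ℂ) = (square k F.T)ᴴ *
        ((tall k (distRows m F.V))ᴴ * tall l (distRows m fun p i j => A p i (k + j))) := by
      rw [← hM₁']
      ext a b
      simp only [hM₂, hTH, overwrite_apply, mem_rect, Matrix.of_apply, Matrix.mul_apply,
        Matrix.conjTranspose_apply, square, Nat.zero_le, a.2, b.2, true_and, and_true, if_true]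
      rw [← Finset.range_eq_Ico, ← Fin.sum_univ_eq_sum_range
        fun c => (if c < k then star (F.T c a) else 0) * M₁ c b]
      simp
    have hM₄' : (Matrix.of fun a b => M₄ a b : Matrix (Fin k) (Fin l) ℂ) =
        (tall k (distRows m F.V))ᴴ * tall l (distRows m G.V) * square l G.T := by
      rw [← hM₃']
      ext a b
      simp only [hM₄, overwrite_apply, mem_rect, Matrix.of_apply, Matrix.mul_apply, square,
        Nat.zero_le, a.2, b.2, true_and, and_true, if_true]
      rw [← Finset.range_eq_Ico, ← Fin.sum_univ_eq_sum_range fun c => M₃ a c * G.T c b]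
    have hM₆' : (Matrix.of fun a b => M₆ a b : Matrix (Fin k) (Fin l) ℂ) = -(square k F.T *
        ((tall k (distRows m F.V))ᴴ * tall l (distRows m G.V) * square l G.T)) := by
      rw [← hM₄']
      ext a b
      simp only [hM₆, hM₅, overwrite_apply, mem_rect, Matrix.of_apply, Matrix.mul_apply, square,
        Nat.zero_le, a.2, b.2, true_and, and_true, if_true, Matrix.neg_apply, zero_sub]
      rw [← Finset.range_eq_Ico, ← Fin.sum_univ_eq_sum_range fun c => F.T a c * M₄ c b]
    refine ⟨⟨fun p i j => if j < k then F.V p i j else G.V p i (j - k),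
      fun i j => if j < k then (if i < k then F.T i j else 0)
        else if i < k then M₆ i (j - k) else G.T (i - k) (j - k),
      fun i j => if j < k then (if i < k then F.R i j else 0)
        else if i < k then B 0 (o + i) (j - k) else G.R (i - k) (j - k)⟩, ?_, ?_⟩
    · dsimp only
      rw [value_bind_of hF, value_bind_of hM₁, value_bind_of (value_adj _ _ _ _ _),
        value_bind_of (value_mm _ _ _ _ _ _), value_bind_of hVM,
        value_bind_of (value_each _ _ B fun p => value_fill _ _ _ _ _ fun i j _ => value_sub _ _ _),
        value_bind_of hG, value_bind_of hM₃, value_bind_of (value_mm _ _ _ _ _ _),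
        value_bind_of (value_mm _ _ _ _ _ _), value_bind_of (value_blank _),
        value_bind_of (value_fill _ _ _ _ _ fun i j _ => value_sub _ _ _), value_pure]
    · dsimp only
      rw [tall_eq_cols k l (distRows m A) (distRows m A) (distRows m fun p i j => A p i (k + j))
          (fun _ _ _ => rfl) fun _ _ _ => rfl,
        tall_eq_cols k l _ (distRows m F.V) (distRows m G.V)
          (fun x j hj => by simp only [distRows, if_pos hj]) (fun x j hj => by
            simp only [distRows]
            rw [if_neg (by omega), Nat.add_sub_cancel_left]),
        square_eq_blocks k l F.T M₆ (fun _ _ => 0) G.T _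
          (fun i hi j hj => by rw [if_pos hj, if_pos hi])
          (fun i hi j hj => by rw [if_neg (by omega), if_pos hi, Nat.add_sub_cancel_left])
          (fun i hi j hj => by rw [if_pos hj, if_neg (by omega)])
          (fun i hi j hj => by
            rw [if_neg (by omega), if_neg (by omega), Nat.add_sub_cancel_left,
              Nat.add_sub_cancel_left]),
        square_eq_blocks k l F.R (fun i j => B 0 (o + i) j) (fun _ _ => 0) G.R _
          (fun i hi j hj => by rw [if_pos hj, if_pos hi])
          (fun i hi j hj => by rw [if_neg (by omega), if_pos hi, Nat.add_sub_cancel_left])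
          (fun i hi j hj => by rw [if_pos hj, if_neg (by omega)])
          (fun i hi j hj => by
            rw [if_neg (by omega), if_neg (by omega), Nat.add_sub_cancel_left,
              Nat.add_sub_cancel_left]), hM₆']
      refine H₁.compose H₂ ?_ ?_
      · ext ⟨p, i⟩ j
        rw [mask_mul_apply, mask_mul_apply]
        split_ifs with hi
        · rw [le_height_iff (by omega)] at hi
          rw [← hM₂', Matrix.sub_apply, Matrix.mul_apply]
          simp only [tall, distRows, Matrix.of_apply, hB, overwrite_apply, mem_rect]
          rw [if_pos ⟨⟨hi, i.2⟩, Nat.zero_le _, j.2⟩, hVM' p i hi i.2 j j.2,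
            ← Fin.sum_univ_eq_sum_range fun c => F.V p i c * M₂ c j]
        · rfl
      · rintro ⟨p, i⟩ a j hi
        by_cases hp : p = 0
        · subst hp
          rw [height_root] at hi
          simp only [tall, distRows, Matrix.of_apply, hi]
        · rw [height_of_ne hp] at hi
          omega

/-- Here `x` is the number of splits. Only widths greater than b are split, so if there is any
split, every leaf has at least b / 2 columns and the x + 1 leaves satisfy (x + 1) b ≤ 2 n. The
bounds are shaped to add up over the halves k and l of n. Leaf terms are linear in n once n ≤ b, and
for the operations also n ≤ N, is used. For the quadratic terms, the cross terms 2 k l pay for the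
products. The contributions of a split that do not shrink with n are counted by x: 60 P words from
three collectives, 16 P operations from two reductions, and 24 ≤ 30 messages per tree level.
Messages leave an offset of 6 per leaf, which the remaining 6 absorbs. -/
theorem cost_caqrEG {m : Fin P → ℕ} {μ b N : ℕ} (hμ : ∀ p, m p ≤ μ) (hb : 1 ≤ b) (n : ℕ) :
    1 ≤ n → n ≤ N → (∀ p, n ≤ m p) → ∃ x, (x + 1) * b ≤ max (2 * n) b ∧
    ∀ (o : ℕ) (A : Dist fun _ : Fin P => ℂ), Cost Set.univ (caqrEG m b n o A)
      (100 * μ * n ^ 2 + 130 * n * (b * N * Nat.clog 2 P) + 16 * P * x,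
        30 * n ^ 2 + 6 * n * (b * Nat.clog 2 P) + 60 * P * x, (30 * x + 6) * Nat.clog 2 P) := by
  induction n using Nat.strong_induction_on with
  | _ n ih =>
    intro hn hN hm
    by_cases hnb : n ≤ b ∨ n ≤ 1
    · refine ⟨0, by simp, fun o A => ?_⟩
      rw [caqrEG, dif_pos hnb]
      refine (cost_tsqr hn hm hμ o A).le ?_
      have h1 : n ^ 3 * Nat.clog 2 P ≤ n * (b * N * Nat.clog 2 P) := by
        rw [← mul_assoc]
        gcongr
        rw [pow_succ', sq]
        gcongr
        omega
      have h2 : n ^ 2 * Nat.clog 2 P ≤ n * (b * Nat.clog 2 P) := by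
        rw [← mul_assoc, sq]
        gcongr
        omega
      simp only [Prod.mk_le_mk]
      refine ⟨?_, ?_, ?_⟩ <;> linarith [Nat.zero_le (n ^ 2)]
    have hnμ : n ≤ μ := (hm 0).trans (hμ 0)
    obtain ⟨x₁, hx₁, hc₁⟩ := ih (n / 2) (by omega) (by omega) (by omega) fun p => by
      have := hm p
      omega
    obtain ⟨x₂, hx₂, hc₂⟩ := ih (n - n / 2) (by omega) (by omega) (by omega) fun p => by
      have := hm p
      omega
    refine ⟨x₁ + x₂ + 1, ?_, fun o A => ?_⟩
    · rw [max_eq_left (by omega)] at hx₁ hx₂ ⊢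
      have : (x₁ + x₂ + 1 + 1) * b = (x₁ + 1) * b + (x₂ + 1) * b := by ring
      omega
    · rw [caqrEG, dif_neg hnb]
      have hn' : n = n / 2 + (n - n / 2) := by omega
      have hk1 : 1 ≤ n / 2 := by omega
      have hkl : n / 2 ≤ n - n / 2 := by omega
      clear ih hx₁ hx₂ hm hnb
      generalize n - n / 2 = l at *
      generalize n / 2 = k at *
      subst hn'
      have hl1 : 1 ≤ l := by omega
      have hμ1 : 1 ≤ μ := by omega
      have h0 : (0 : Fin P) ∈ (Set.univ : Set (Fin P)) := trivial
      dsimp only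
      apply Cost.le
      · apply (hc₁ _ _).bind
        intro F
        apply (cost_mulAdj hμ hμ1 hk1 hl1 _ _).bind
        intro M₁
        apply ((localCost_adj _ _ _ _).cost h0).bind
        intro TH
        apply ((localCost_mm _ _ _ _).cost h0).bind
        intro M₂
        apply (cost_mulRoot hμ hμ1 hk1 hl1 _ _).bind
        intro VM
        apply Cost.bind (k := (μ * l * 1, 0, 0))
        · refine cost_each _ fun p => (localCost_fill _ (fun _ _ _ => localCost_op _) _).le ?_
          simp only [length_rect, Nat.sub_zero]
          gcongr
          exact (Nat.sub_le _ _).trans (hμ p)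
        intro B
        apply (hc₂ _ _).bind
        intro G
        apply (cost_mulAdj hμ hμ1 hk1 hl1 _ _).bind
        intro M₃
        apply ((localCost_mm _ _ _ _).cost h0).bind
        intro M₄
        apply ((localCost_mm _ _ _ _).cost h0).bind
        intro M₅
        apply (localCost_blank.cost h0).bind
        intro Z
        exact ((localCost_fill _ (fun _ _ _ => localCost_op _) _).cost h0).bind_pure
      · simp only [Prod.mk_add_mk, Prod.mk_le_mk, length_rect, List.Ico.length, Nat.sub_zero]
        -- All local work of the split is bounded by multiples of μ k l, within the cross term 200 μ
        -- k l of 100 μ (k + l)².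
        have h1 : 1 ≤ k * l := Nat.mul_pos hk1 hl1
        have h2 : k * l ≤ μ * (k * l) := Nat.le_mul_of_pos_left _ hμ1
        have h3 : k * k ≤ μ * (k * l) := (Nat.mul_le_mul_left k hkl).trans h2
        have h4 : k * l * k ≤ μ * (k * l) := by
          rw [mul_comm μ]
          exact Nat.mul_le_mul_left _ (by omega)
        have h5 : k * l * l ≤ μ * (k * l) := by
          rw [mul_comm μ]
          exact Nat.mul_le_mul_left _ (by omega)
        have h6 : μ * l ≤ μ * (k * l) := Nat.mul_le_mul_left _ (Nat.le_mul_of_pos_left _ hk1)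
        refine ⟨?_, ?_, ?_⟩
        · nlinarith
        · nlinarith
        · nlinarith

end CAQREG

/-! ### From rows of given heights to matrices -/

section Layout

open Matrix

variable {P m n : ℕ} [NeZero P] (D : Layout P m n)

theorem Layout.sum_rows : ∑ p, D.rows p = m := by
  have := Fintype.card_congr D.pos
  simpa using this

/-- If one processor had fewer than n rows, then by balance none would have more than n, and the
total would be below P n. -/
theorem Layout.le_rows (h : P * n ≤ m) (p : Fin P) : n ≤ D.rows p := by
  by_contra! hp
  have : ∑ q, D.rows q < ∑ _q : Fin P, n :=
    Finset.sum_lt_sum (fun q _ => by have := D.balanced q p; omega) ⟨p, Finset.mem_univ p, hp⟩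
  rw [D.sum_rows, Finset.sum_const, Finset.card_univ, Fintype.card_fin, smul_eq_mul] at this
  omega

/-- By balance every processor has at least `D.rows p - 1` rows; compare with the total m. -/
theorem Layout.rows_le (p : Fin P) : D.rows p ≤ m / P + 1 := by
  have : ∑ _q : Fin P, (D.rows p - 1) ≤ ∑ q, D.rows q :=
    Finset.sum_le_sum fun q _ => by have := D.balanced p q; omega
  rw [D.sum_rows, Finset.sum_const, Finset.card_univ, Fintype.card_fin, smul_eq_mul, mul_comm] at this
  have := (Nat.le_div_iff_mul_le (NeZero.pos P)).2 this
  omega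

/-- Positions and heights may order the rows differently, but they agree on the n leading rows, and
nothing else enters the conditions on V and [R; 0]. -/
theorem Layout.pos_eq_iff (x : RowIndex D.rows) (j : Fin n) :
    (D.pos x : ℕ) = j ↔ height D.rows x = j := by
  have hl := D.leading
  constructor
  · intro h
    have hy := D.pos_leading ⟨j, by omega⟩ j.2
    have : x = ⟨0, ⟨j, by omega⟩⟩ := D.pos.injective (Fin.ext (h.trans hy.symm))
    rw [this, height_root]
  · obtain ⟨p, i⟩ := x
    by_cases hp : p = 0
    · subst hp
      rw [height_root]
      intro h
      rw [D.pos_leading i (by omega), h]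
    · rw [height_of_ne hp]
      omega

theorem IsHQR.isHouseholderQR {A : Matrix (Fin m) (Fin n) ℂ} {V : Dist fun _ : Fin P => ℂ}
    {T R : Matrix (Fin n) (Fin n) ℂ}
    (H : IsHQR (height D.rows) 0 n (tall n (distRows D.rows (D.load A)))
      (tall n (distRows D.rows V)) T R) : IsHouseholderQR A (D.collect V) T R := by
  have hh (i : Fin m) (j : Fin n) : height D.rows (D.pos.symm i) = j ↔ (i : ℕ) = j := by
    rw [← D.pos_eq_iff, Equiv.apply_symm_apply]
  have hV : D.collect V = (tall n (distRows D.rows V)).submatrix D.pos.symm id := rfl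
  have hA : A = (tall n (distRows D.rows (D.load A))).submatrix D.pos.symm id := by
    ext i j
    simp [tall, distRows, Layout.load]
  have hQ : 1 - D.collect V * T * (D.collect V)ᴴ = (1 - tall n (distRows D.rows V) * T *
      (tall n (distRows D.rows V))ᴴ).submatrix D.pos.symm D.pos.symm := by
    rw [hV, Matrix.submatrix_sub, Pi.sub_apply, Pi.sub_apply, Matrix.submatrix_one_equiv]
    rfl
  refine ⟨fun i j hij => H.basis_diag _ j ?_, fun i j hij => H.basis_upper _ j ?_, H.kernel_lower,
    H.R_lower, ?_, ?_⟩
  · rw [zero_add]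
    exact (hh i j).2 hij
  · rw [zero_add]
    have := (hh i ⟨i, by omega⟩).2 rfl
    rw [this]
    exact hij
  · rw [hQ, Matrix.mem_unitaryGroup_iff, Matrix.star_eq_conjTranspose,
      Matrix.conjTranspose_submatrix, Matrix.submatrix_mul_equiv, ← Matrix.star_eq_conjTranspose,
      Matrix.mem_unitaryGroup_iff.1 H.unitary, Matrix.submatrix_one_equiv]
  · have hd := H.dec
    rw [mask_zero, Matrix.one_mul] at hd
    nth_rewrite 1 [hA]
    rw [hd, hQ, ← Matrix.submatrix_mul_equiv _ _ _ D.pos.symm]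
    congr 1
    ext i j
    rw [Matrix.submatrix_apply, Matrix.of_apply]
    split_ifs with hi
    · exact embed_mul_apply_of_eq _ _ _ _ ⟨i, hi⟩ (by rw [zero_add]; exact (hh i ⟨i, hi⟩).2 rfl) _
    · refine embed_mul_apply_of_ne _ _ _ _ (fun a h => hi ?_) _
      rw [zero_add] at h
      rw [(hh i a).1 h]
      exact a.2

end Layout

/-! ### Block sizes -/

section BlockSize

theorem one_le_logb {P : ℕ} (hP : 2 ≤ P) : 1 ≤ Real.logb 2 P := by
  rw [Real.le_logb_iff_rpow_le (by norm_num) (by positivity), Real.rpow_one]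
  exact_mod_cast hP

/-- Rounding up adds at most 1, which is at most log P for P ≥ 2. -/
theorem clog_le_two_mul_logb {P : ℕ} (hP : 2 ≤ P) : (Nat.clog 2 P : ℝ) ≤ 2 * Real.logb 2 P := by
  have h1 := one_le_logb hP
  have h2 : (2 : ℝ) ^ (Nat.clog 2 P - 1) ≤ P := by
    exact_mod_cast (Nat.pow_pred_clog_lt_self one_lt_two hP).le
  have h3 : ((Nat.clog 2 P - 1 : ℕ) : ℝ) ≤ Real.logb 2 P := by
    rw [Real.le_logb_iff_rpow_le (by norm_num) (by positivity), Real.rpow_natCast]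
    exact h2
  have h4 : (Nat.clog 2 P : ℝ) ≤ ((Nat.clog 2 P - 1 : ℕ) : ℝ) + 1 := by
    exact_mod_cast (by omega : Nat.clog 2 P ≤ Nat.clog 2 P - 1 + 1)
  linarith

/-- Take n / log P, rounded up. As P ≥ 1, the hypothesis gives log P ≤ √|K| n, so the 1 that
rounding may add is at most √|K| n / log P. -/
theorem exists_blockSize {K : ℝ} {P n : ℕ} (hn : 1 ≤ n)
    (hK : (P : ℝ) * Real.logb 2 P ^ 2 ≤ K * (n : ℝ) ^ 2) :
    ∃ b, IsBlockSize 1 (1 + √|K|) P n b := by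
  by_cases hP : 2 ≤ P
  · have hl := one_le_logb hP
    have hn' : (1 : ℝ) ≤ n := by exact_mod_cast hn
    have hP' : (1 : ℝ) ≤ P := by exact_mod_cast (by omega : 1 ≤ P)
    have hpos : 0 < (n : ℝ) / Real.logb 2 P := by positivity
    refine ⟨⌈(n : ℝ) / Real.logb 2 P⌉₊, Nat.ceil_pos.2 hpos, fun _ => ⟨?_, ?_⟩⟩
    · rw [one_mul]
      exact Nat.le_ceil _
    · have h1 : Real.logb 2 P ≤ √|K| * n := by
        refine Real.le_sqrt_of_sq_le (y := |K| * (n : ℝ) ^ 2) ?_ |>.trans_eq ?_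
        · have := mul_le_mul_of_nonneg_right (le_abs_self K) (sq_nonneg (n : ℝ))
          nlinarith [sq_nonneg (Real.logb 2 P)]
        · rw [Real.sqrt_mul (abs_nonneg K), Real.sqrt_sq (by positivity)]
      have h2 : 1 ≤ √|K| * ((n : ℝ) / Real.logb 2 P) := by
        rw [← mul_div_assoc, le_div_iff₀ (by positivity), one_mul]
        exact h1
      have := Nat.ceil_lt_add_one hpos.le
      linarith
  · exact ⟨1, le_rfl, fun h => absurd h hP⟩

/-- The costs of 1D-CAQR-EG for a suitable block size. -/
theorem costs_le {K c₁ c₂ y : ℝ} (h₁ : 0 < c₁) (h₂ : 0 < c₂) {P n b x μ : ℕ} (hP : 1 ≤ P)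
    (hn : 1 ≤ n) (hK : (P : ℝ) * Real.logb 2 P ^ 2 ≤ K * (n : ℝ) ^ 2) (hb : IsBlockSize c₁ c₂ P n b)
    (hx : x * b ≤ 2 * n) (hny : (n : ℝ) ≤ y) (hμ : (μ : ℝ) ≤ y + 1) :
    ((100 * μ * n ^ 2 + 130 * n * (b * n * Nat.clog 2 P) + 16 * P * x : ℕ) : ℝ) ≤
        (500 + 260 * c₂ + 120 * |K| / c₁ + 120 / c₁) * (y * (n : ℝ) ^ 2) ∧
      ((30 * n ^ 2 + 6 * n * (b * Nat.clog 2 P) + 60 * P * x : ℕ) : ℝ) ≤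
        (500 + 260 * c₂ + 120 * |K| / c₁ + 120 / c₁) * (n : ℝ) ^ 2 ∧
      (((30 * x + 6) * Nat.clog 2 P : ℕ) : ℝ) ≤
        (500 + 260 * c₂ + 120 * |K| / c₁ + 120 / c₁) * Real.logb 2 P ^ 2 := by
  have hn' : (1 : ℝ) ≤ n := by exact_mod_cast hn
  have hy : 1 ≤ y := hn'.trans hny
  have hb' : (1 : ℝ) ≤ b := by exact_mod_cast hb.1
  have hx' : (x : ℝ) * b ≤ 2 * n := by exact_mod_cast hx
  have hx0 : (0 : ℝ) ≤ x := by positivity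
  have hn2 : (n : ℝ) ≤ (n : ℝ) ^ 2 := by nlinarith
  have hyn : (n : ℝ) ^ 2 ≤ y * (n : ℝ) ^ 2 := by nlinarith [sq_nonneg (n : ℝ)]
  have hyn3 : (n : ℝ) * (n : ℝ) ^ 2 ≤ y * (n : ℝ) ^ 2 := by gcongr
  have hμn : (μ : ℝ) * (n : ℝ) ^ 2 ≤ 2 * (y * (n : ℝ) ^ 2) := by
    have : (μ : ℝ) * (n : ℝ) ^ 2 ≤ (y + 1) * (n : ℝ) ^ 2 := by gcongr
    linarith
  have hc : 0 ≤ 120 * |K| / c₁ := by positivity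
  have hc' : 0 ≤ 120 / c₁ := by positivity
  rcases hP.eq_or_lt with rfl | hP
  -- On one processor all logarithms vanish and b ≥ 1 alone suffices: x ≤ 2 n is absorbed by n².
  · have hxn : (x : ℝ) ≤ 2 * n := by nlinarith
    have e (z : ℝ) (hz : 0 ≤ z) :
        500 * z ≤ (500 + 260 * c₂ + 120 * |K| / c₁ + 120 / c₁) * z := by
      gcongr
      linarith
    have e1 := e (y * (n : ℝ) ^ 2) (by positivity)
    have e2 := e ((n : ℝ) ^ 2) (by positivity)
    push_cast
    simp only [Nat.clog_one_right, Nat.cast_zero, mul_zero, add_zero]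
    refine ⟨?_, ?_, by simp⟩ <;> linarith
  · have hl := one_le_logb hP
    have hL := clog_le_two_mul_logb hP
    obtain ⟨hb1, hb2⟩ := hb.2 hP
    generalize Real.logb 2 P = l at *
    generalize Nat.clog 2 P = L at *
    have hl0 : 0 < l := by linarith
    have hP0 : (0 : ℝ) ≤ P := by positivity
    have hbl : (b : ℝ) * l ≤ c₂ * n := by
      rwa [← mul_div_assoc, le_div_iff₀ hl0] at hb2
    -- The lower bound on b limits the number of splits: x ≤ 2 n / b ≤ (2 / c₁) log P.
    have hxl : (x : ℝ) ≤ 2 / c₁ * l := by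
      rw [← mul_div_assoc, div_le_iff₀ hl0] at hb1
      have h3 : (x : ℝ) * c₁ * n ≤ 2 * l * n := by
        calc (x : ℝ) * c₁ * n = x * (c₁ * n) := by ring
          _ ≤ x * (b * l) := by gcongr
          _ = x * b * l := by ring
          _ ≤ 2 * n * l := by gcongr
          _ = 2 * l * n := by ring
      have h4 := le_of_mul_le_mul_right h3 (by linarith)
      rw [div_mul_eq_mul_div, le_div_iff₀ h₁]
      exact h4
    have hl2 : l ≤ l ^ 2 := by nlinarith
    -- Here P (log P)² = O(n²) is used; it controls the P extra words and operations of each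
    -- collective.
    have hPx : (P : ℝ) * x ≤ 2 * |K| / c₁ * (n : ℝ) ^ 2 := by
      calc (P : ℝ) * x ≤ P * (2 / c₁ * l ^ 2) := by gcongr; exact hxl.trans (by gcongr)
        _ = 2 / c₁ * (P * l ^ 2) := by ring
        _ ≤ 2 / c₁ * (|K| * (n : ℝ) ^ 2) := by
          refine mul_le_mul_of_nonneg_left (hK.trans ?_) (by positivity)
          exact mul_le_mul_of_nonneg_right (le_abs_self K) (sq_nonneg _)
        _ = _ := by ring
    have hbL : (b : ℝ) * L ≤ 2 * c₂ * n := by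
      calc (b : ℝ) * L ≤ b * (2 * l) := by gcongr
        _ = 2 * (b * l) := by ring
        _ ≤ 2 * (c₂ * n) := by gcongr
        _ = _ := by ring
    have hnbL : (n : ℝ) * (b * L) ≤ 2 * c₂ * (n : ℝ) ^ 2 := by
      calc (n : ℝ) * (b * L) ≤ n * (2 * c₂ * n) := by gcongr
        _ = _ := by ring
    have hnnbL : (n : ℝ) * (b * n * L) ≤ 2 * c₂ * (y * (n : ℝ) ^ 2) := by
      calc (n : ℝ) * (b * n * L) = n * (n * (b * L)) := by ring
        _ ≤ n * (2 * c₂ * (n : ℝ) ^ 2) := by gcongr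
        _ = 2 * c₂ * (n * (n : ℝ) ^ 2) := by ring
        _ ≤ _ := by gcongr
    have hxL : (x : ℝ) * L ≤ 4 / c₁ * l ^ 2 := by
      calc (x : ℝ) * L ≤ (2 / c₁ * l) * (2 * l) := by gcongr
        _ = _ := by ring
    push_cast
    have e1 : 120 * |K| / c₁ = 60 * (2 * |K| / c₁) := by ring
    have e2 : 120 / c₁ = 30 * (4 / c₁) := by ring
    have k1 : 0 ≤ 2 * |K| / c₁ := by positivity
    have k2 : 0 ≤ 4 / c₁ := by positivity
    rw [e1, e2]
    generalize 2 * |K| / c₁ = u at *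
    generalize 4 / c₁ = v at *
    have hPx' : u * (n : ℝ) ^ 2 ≤ u * (y * (n : ℝ) ^ 2) := by gcongr
    have z1 : 0 ≤ y * (n : ℝ) ^ 2 := by positivity
    have z2 : 0 ≤ (n : ℝ) ^ 2 := by positivity
    have z3 : 0 ≤ l ^ 2 := by positivity
    have w1 := mul_nonneg h₂.le z1
    have w2 := mul_nonneg h₂.le z2
    have w3 := mul_nonneg h₂.le z3
    have u1 := mul_nonneg k1 z1
    have u2 := mul_nonneg k1 z2
    have u3 := mul_nonneg k1 z3
    have v1 := mul_nonneg k2 z1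
    have v2 := mul_nonneg k2 z2
    have v3 := mul_nonneg k2 z3
    refine ⟨?_, ?_, ?_⟩ <;> linarith

end BlockSize

end CAQR

/-! ### Assembly of correctness and costs. -/

theorem theorem2 (K : ℝ) :
    (∃ c₁ c₂ : ℝ, 0 < c₁ ∧ 0 < c₂ ∧ ∀ P n : ℕ, 1 ≤ P → 1 ≤ n →
      (P : ℝ) * Real.logb 2 P ^ 2 ≤ K * (n : ℝ) ^ 2 → ∃ b : ℕ, CAQR.IsBlockSize c₁ c₂ P n b) ∧
    ∀ c₁ c₂ : ℝ, 0 < c₁ → 0 < c₂ → ∃ C : ℝ, 0 < C ∧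
      ∀ (m n P b : ℕ) [NeZero P], 1 ≤ n → (P : ℝ) ≤ (m : ℝ) / (n : ℝ) →
        (P : ℝ) * Real.logb 2 P ^ 2 ≤ K * (n : ℝ) ^ 2 →
        CAQR.IsBlockSize c₁ c₂ P n b →
        ∀ (D : CAQR.Layout P m n) (A : Matrix (Fin m) (Fin n) ℂ),
          ∃ (F : CAQR.DistQR (fun _ : Fin P => ℂ)) (t : List (CAQR.Task P)),
            (CAQR.caqrEG D.rows b n 0 (D.load A)).run = some (F, t) ∧
            CAQR.IsHouseholderQR A (D.collect F.V) (CAQR.square n F.T) (CAQR.square n F.R) ∧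
            CAQR.CostsAtMost t (C * ((m : ℝ) * (n : ℝ) ^ 2 / (P : ℝ))) (C * (n : ℝ) ^ 2)
              (C * Real.logb 2 P ^ 2) := by
  refine ⟨⟨1, 1 + √|K|, one_pos, by positivity, fun P n _ hn hK => CAQR.exists_blockSize hn hK⟩,
    -- The constant collects generous absolute constants, 130 · 2 c₂ from the trees of the leaves,
    -- 60 · 2 |K| / c₁ from the term P x, and 30 · 4 / c₁ from the messages of the splits.
    fun c₁ c₂ h₁ h₂ => ⟨500 + 260 * c₂ + 120 * |K| / c₁ + 120 / c₁, by positivity, ?_⟩⟩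
  intro m n P b _ hn hm hK hb D A
  have hP : 1 ≤ P := NeZero.pos P
  have hP' : (0 : ℝ) < P := by exact_mod_cast hP
  have hn' : (0 : ℝ) < n := by exact_mod_cast hn
  rw [le_div_iff₀ hn'] at hm
  have hPn : P * n ≤ m := by exact_mod_cast hm
  have hrows := D.le_rows hPn
  obtain ⟨F, hF, H⟩ := CAQR.caqrEG_spec (m := D.rows) b n 0 (D.load A) fun p => by
    have := hrows p
    simpa [CAQR.top] using this
  obtain ⟨x, hx, hcost⟩ := CAQR.cost_caqrEG D.rows_le hb.1 n hn le_rfl hrows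
  obtain ⟨⟨F', t⟩, hrun, rfl⟩ := Option.map_eq_some_iff.1 hF
  -- The maximum is at most 2 n + b, and the additional b cancels.
  have hx' : x * b ≤ 2 * n := by
    rw [add_mul, one_mul] at hx
    have := hb.1
    omega
  have hy : (n : ℝ) ≤ m / P := by
    rw [le_div_iff₀ hP', mul_comm]
    exact hm
  have hμ : ((m / P + 1 : ℕ) : ℝ) ≤ (m : ℝ) / P + 1 := by
    push_cast
    gcongr
    exact Nat.cast_div_le
  obtain ⟨e1, e2, e3⟩ := CAQR.costs_le h₁ h₂ hP hn hK hb hx' hy hμ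
  refine ⟨F', t, hrun, H.isHouseholderQR D, (hcost 0 (D.load A)).costsAtMost hrun ?_ e2 e3⟩
  rw [mul_div_right_comm (m : ℝ)]
  exact e1
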